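/- Let $q\ge 0$ and let $H_q=-\tfrac12\frac{d^2}{dx^2}+q\delta$ be the self-adjoint operator in $L^2(\mathbb R)$ with domain $$D(H_q)=\{u\in H^1(\mathbb R)\cap H^2(\mathbb R\setminus\{0\}) : u'(0+)-u'(0-)=2q\,u(0)\},\qquad H_qu=-\tfrac12u''\ \text{ on }\mathbb R\setminus\{0\},$$ and let $\{e^{-itH_q}\}_{t\in\mathbb R}$ be the unitary group it generates. Put $t_q(\xi)=\frac{i\xi}{i\xi-q}$, $r_q(\xi)=\frac{q}{i\xi-q}$, $$f_+(x,\xi)=\begin{cases}e^{ix\xi}&x\ge0,\\ \frac1{t_q(\xi)}e^{ix\xi}+\frac{r_q(\xi)}{t_q(\xi)}e^{-ix\xi}&x<0,\end{cases}\qquad f_-(x,\xi)=\begin{cases}\frac1{t_q(\xi)}e^{-ix\xi}+\frac{r_q(\xi)}{t_q(\xi)}e^{ix\xi}&x\ge0,\\ e^{-ix\xi}&x<0,\end{cases}$$ $$\Psi(x,\xi)=\begin{cases}t_q(\xi)f_+(x,\xi)&\xi\ge0,\\ t_q(-\xi)f_-(x,-\xi)&\xi<0,\end{cases}$$ and let the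 inverse distorted Fourier transform be $$\mathcal F_q^{-1}[\phi](x)=\frac1{\sqrt{2\pi}}\int_{-\infty}^{\infty}\overline{\Psi(x,-\xi)}\,\phi(\xi)\,d\xi ,$$ where for $\phi\in L^2(\mathbb R)$ the integral is the limit in $L^2(\mathbb R)$, as $N\to\infty$, of the integrals over $[-N,N]$. Proposition 3.1. Let $2\le p\le\infty$, and let $\beta\ge0$ satisfy $\beta\le1$ if $p=2$, and $\beta<\frac{p+2}{2p}=\frac12+\frac1p$ if $p>2$ (so $\beta<\frac12$ if $p=\infty$). Then there is a constant $C>0$, depending only on $q$, $p$ and $\beta$, such that for every $\phi\in L^2(\mathbb R)$ whose distributional derivative $\partial_\xi\phi$ lies in $L^2(\mathbb R)$ and whose continuous representative satisfies $\phi(0)=0$, and for every $t>0$, $$(e^{-itH_q}\mathcal F_q^{-1}\phi)(x)=t^{-1/2}\,\phi\!\left(\frac xt\right)e^{\frac{ix^2}{2t}-\frac{i\pi}4}+R(t,x)\quad\text{for almost every }x\in\mathbb R,$$ where $R(t)=R(t,\cdot)\in L^p(\mathbb R)$ satisfies $$\|R(t)\|_{L^p}\le C\,t^{-\frac12+\frac1p-\frac\beta2}\left(\|\phi\|_{L^2}+\|\partial_\xi\phi\|_{L^2}\right).$$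 -/

import Mathlib

open MeasureTheory Filter Topology Set
open scoped ENNReal ContDiff

namespace DeltaNLS

/-- The Hilbert space `L²(ℝ)` of complex-valued functions. -/
abbrev L2 : Type := Lp ℂ 2 (volume : Measure ℝ)

/-! ### Weak derivatives on subsets of the line -/

/-- `g` is the weak (distributional) derivative of `f` on the open set `Ω ⊆ ℝ`: both are locally
integrable on `Ω` and `∫ η' f = - ∫ η g` for every test function `η ∈ C_c^∞(Ω)`. -/
def HasWeakDerivOn (Ω : Set ℝ) (f g : ℝ → ℂ) : Prop :=
  LocallyIntegrableOn f Ω ∧ LocallyIntegrableOn g Ω ∧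
    ∀ η : ℝ → ℝ, ContDiff ℝ ∞ η → HasCompactSupport η → tsupport η ⊆ Ω →
      ∫ x, deriv η x • f x = -∫ x, η x • g x

theorem integrable_smul_of_tsupport_subset {Ω : Set ℝ} {f : ℝ → ℂ}
    (hf : LocallyIntegrableOn f Ω) {η ζ : ℝ → ℝ} (hζ : Continuous ζ)
    (hc : HasCompactSupport η) (hs : tsupport η ⊆ Ω) (hsub : Function.support ζ ⊆ tsupport η) :
    Integrable (fun x => ζ x • f x) := by
  have h1 : IntegrableOn f (tsupport η) := hf.integrableOn_compact_subset hs hc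
  have h2 : IntegrableOn (fun x => ζ x • f x) (tsupport η) :=
    h1.continuousOn_smul hζ.continuousOn hc
  rw [integrableOn_iff_integrable_of_support_subset] at h2
  · exact h2
  · intro x hx
    apply hsub
    intro h0
    exact hx (by simp [h0])

theorem HasWeakDerivOn.integrable {Ω : Set ℝ} {f g : ℝ → ℂ} (h : HasWeakDerivOn Ω f g)
    {η : ℝ → ℝ} (h1 : ContDiff ℝ ∞ η) (h2 : HasCompactSupport η) (h3 : tsupport η ⊆ Ω) :
    Integrable (fun x => deriv η x • f x) ∧ Integrable (fun x => η x • g x) :=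
  ⟨integrable_smul_of_tsupport_subset h.1 (h1.continuous_deriv (by simp)) h2 h3
      support_deriv_subset,
    integrable_smul_of_tsupport_subset h.2.1 h1.continuous h2 h3 (subset_tsupport _)⟩

theorem HasWeakDerivOn.add {Ω : Set ℝ} {f g f' g' : ℝ → ℂ} (h : HasWeakDerivOn Ω f g)
    (h' : HasWeakDerivOn Ω f' g') : HasWeakDerivOn Ω (f + f') (g + g') := by
  refine ⟨h.1.add h'.1, h.2.1.add h'.2.1, fun η h1 h2 h3 => ?_⟩
  simp only [Pi.add_apply, smul_add]
  rw [integral_add (h.integrable h1 h2 h3).1 (h'.integrable h1 h2 h3).1,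
    integral_add (h.integrable h1 h2 h3).2 (h'.integrable h1 h2 h3).2,
    h.2.2 η h1 h2 h3, h'.2.2 η h1 h2 h3]
  ring

theorem HasWeakDerivOn.const_smul {Ω : Set ℝ} {f g : ℝ → ℂ} (c : ℂ)
    (h : HasWeakDerivOn Ω f g) : HasWeakDerivOn Ω (c • f) (c • g) := by
  refine ⟨fun x hx => ?_, fun x hx => ?_, fun η h1 h2 h3 => ?_⟩
  · obtain ⟨s, hs, hi⟩ := h.1 x hx
    exact ⟨s, hs, hi.smul c⟩
  · obtain ⟨s, hs, hi⟩ := h.2.1 x hx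
    exact ⟨s, hs, hi.smul c⟩
  · simp only [Pi.smul_apply, smul_comm _ c]
    rw [integral_smul, integral_smul, h.2.2 η h1 h2 h3, smul_neg]

theorem HasWeakDerivOn.congr_ae {Ω : Set ℝ} {f g f' g' : ℝ → ℂ} (h : HasWeakDerivOn Ω f g)
    (hf : f =ᵐ[volume] f') (hg : g =ᵐ[volume] g') : HasWeakDerivOn Ω f' g' := by
  refine ⟨fun x hx => ?_, fun x hx => ?_, fun η h1 h2 h3 => ?_⟩
  · obtain ⟨s, hs, hi⟩ := h.1 x hx
    exact ⟨s, hs, hi.congr (ae_restrict_of_ae hf)⟩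
  · obtain ⟨s, hs, hi⟩ := h.2.1 x hx
    exact ⟨s, hs, hi.congr (ae_restrict_of_ae hg)⟩
  · have e1 : ∫ x, deriv η x • f' x = ∫ x, deriv η x • f x :=
      integral_congr_ae (by filter_upwards [hf] with x hx; rw [hx])
    have e2 : ∫ x, η x • g' x = ∫ x, η x • g x :=
      integral_congr_ae (by filter_upwards [hg] with x hx; rw [hx])
    rw [e1, e2, h.2.2 η h1 h2 h3]

/-- The weak derivative of the zero function vanishes almost everywhere. -/
theorem HasWeakDerivOn.ae_eq_zero {Ω : Set ℝ} (hΩ : IsOpen Ω) {f g : ℝ → ℂ}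
    (h : HasWeakDerivOn Ω f g) (hf : f =ᵐ[volume] 0) : ∀ᵐ x, x ∈ Ω → g x = 0 := by
  refine hΩ.ae_eq_zero_of_integral_contDiff_smul_eq_zero h.2.1 fun η h1 h2 h3 => ?_
  have e := h.2.2 η h1 h2 h3
  have e1 : ∫ x, deriv η x • f x = 0 := by
    rw [integral_congr_ae (g := fun _ => (0 : ℂ))]
    · simp
    · filter_upwards [hf] with x hx
      simp [hx]
  rw [e1] at e
  exact neg_eq_zero.mp e.symm

/-! ### The Hamiltonian `H_q = -(1/2) d²/dx² + q δ` -/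

/-- `u ∈ H¹(ℝ) ∩ H²(ℝ ∖ {0})` with `u'(0+) - u'(0-) = 2 q u(0)`, where `u₁` is the first weak
derivative of `u` and `u₂` the second one away from the origin. The values `u(0)` and `u'(0±)` are
those of the continuous representatives `f` of `u` on `ℝ` and `g` of `u₁` on `ℝ ∖ {0}`. -/
def InDomain (q : ℝ) (u u₁ u₂ : L2) : Prop :=
  HasWeakDerivOn univ u u₁ ∧ HasWeakDerivOn {0}ᶜ u₁ u₂ ∧
    ∃ f g : ℝ → ℂ, u =ᵐ[volume] f ∧ Continuous f ∧ u₁ =ᵐ[volume] g ∧ ContinuousOn g {0}ᶜ ∧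
      ∃ dp dm : ℂ, Tendsto g (𝓝[>] 0) (𝓝 dp) ∧ Tendsto g (𝓝[<] 0) (𝓝 dm) ∧
        dp - dm = 2 * (q : ℂ) * f 0

theorem InDomain.add {q : ℝ} {u u₁ u₂ v v₁ v₂ : L2} (hu : InDomain q u u₁ u₂)
    (hv : InDomain q v v₁ v₂) : InDomain q (u + v) (u₁ + v₁) (u₂ + v₂) := by
  obtain ⟨a1, a2, f, g, a3, a4, a5, a6, dp, dm, a7, a8, a9⟩ := hu
  obtain ⟨b1, b2, f', g', b3, b4, b5, b6, dp', dm', b7, b8, b9⟩ := hv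
  refine ⟨(a1.add b1).congr_ae (Lp.coeFn_add u v).symm (Lp.coeFn_add u₁ v₁).symm,
    (a2.add b2).congr_ae (Lp.coeFn_add u₁ v₁).symm (Lp.coeFn_add u₂ v₂).symm,
    f + f', g + g', (Lp.coeFn_add u v).trans (a3.add b3), a4.add b4,
    (Lp.coeFn_add u₁ v₁).trans (a5.add b5), a6.add b6, dp + dp', dm + dm',
    a7.add b7, a8.add b8, ?_⟩
  simp only [Pi.add_apply]
  linear_combination a9 + b9

theorem InDomain.const_smul {q : ℝ} {u u₁ u₂ : L2} (c : ℂ) (hu : InDomain q u u₁ u₂) :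
    InDomain q (c • u) (c • u₁) (c • u₂) := by
  obtain ⟨a1, a2, f, g, a3, a4, a5, a6, dp, dm, a7, a8, a9⟩ := hu
  refine ⟨(a1.const_smul c).congr_ae (Lp.coeFn_smul c u).symm (Lp.coeFn_smul c u₁).symm,
    (a2.const_smul c).congr_ae (Lp.coeFn_smul c u₁).symm (Lp.coeFn_smul c u₂).symm,
    c • f, c • g, (Lp.coeFn_smul c u).trans (a3.const_smul c), a4.const_smul c,
    (Lp.coeFn_smul c u₁).trans (a5.const_smul c), a6.const_smul c, c • dp, c • dm,
    a7.const_smul c, a8.const_smul c, ?_⟩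
  simp only [Pi.smul_apply, smul_eq_mul]
  linear_combination c * a9

theorem inDomain_zero (q : ℝ) : InDomain q 0 0 0 := by
  have hz : HasWeakDerivOn univ (0 : ℝ → ℂ) 0 :=
    ⟨fun x _ => ⟨univ, by simp, integrableOn_zero⟩,
      fun x _ => ⟨univ, by simp, integrableOn_zero⟩, by simp⟩
  have hz' : HasWeakDerivOn {0}ᶜ (0 : ℝ → ℂ) 0 :=
    ⟨fun x _ => ⟨{0}ᶜ, self_mem_nhdsWithin, integrableOn_zero⟩,
      fun x _ => ⟨{0}ᶜ, self_mem_nhdsWithin, integrableOn_zero⟩, by simp⟩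
  have h0 := Lp.coeFn_zero ℂ 2 (volume : Measure ℝ)
  exact ⟨hz.congr_ae h0.symm h0.symm, hz'.congr_ae h0.symm h0.symm, 0, 0, h0,
    continuous_zero, h0, continuousOn_const, 0, 0, tendsto_const_nhds, tendsto_const_nhds,
    by simp⟩

/-- The graph of `H_q`: the pairs `(u, v)` with `u ∈ D(H_q)` and `v = -(1/2) u''` on
`ℝ ∖ {0}`. -/
def hamiltonianGraph (q : ℝ) : Submodule ℂ (L2 × L2) where
  carrier := {p | ∃ u₁ u₂ : L2, InDomain q p.1 u₁ u₂ ∧ p.2 = (-(1 / 2) : ℂ) • u₂}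
  add_mem' := by
    rintro ⟨u, v⟩ ⟨u', v'⟩ ⟨u₁, u₂, h, hv⟩ ⟨u₁', u₂', h', hv'⟩
    refine ⟨u₁ + u₁', u₂ + u₂', h.add h', ?_⟩
    change v + v' = _
    rw [show v = _ from hv, show v' = _ from hv', smul_add]
  zero_mem' := ⟨0, 0, inDomain_zero q, by simp⟩
  smul_mem' := by
    rintro c ⟨u, v⟩ ⟨u₁, u₂, h, hv⟩
    refine ⟨c • u₁, c • u₂, h.const_smul c, ?_⟩
    change c • v = _
    rw [show v = _ from hv, smul_comm]

theorem hamiltonianGraph_singleValued (q : ℝ) :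
    ∀ p ∈ hamiltonianGraph q, p.1 = 0 → p.2 = 0 := by
  rintro ⟨u, v⟩ ⟨u₁, u₂, ⟨h1, h2, -⟩, hv⟩ (hu : u = 0)
  have hu0 : (u : ℝ → ℂ) =ᵐ[volume] 0 := by
    rw [hu]
    exact Lp.coeFn_zero _ _ _
  have e1 : (u₁ : ℝ → ℂ) =ᵐ[volume] 0 := by
    filter_upwards [h1.ae_eq_zero isOpen_univ hu0] with x hx
    exact hx (mem_univ x)
  have e2 : (u₂ : ℝ → ℂ) =ᵐ[volume] 0 := by
    have hne : ∀ᵐ x : ℝ, x ≠ 0 := by simp [ae_iff]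
    filter_upwards [h2.ae_eq_zero isOpen_compl_singleton e1, hne] with x hx hx0
    exact hx hx0
  have e3 : u₂ = 0 := (Lp.eq_zero_iff_ae_eq_zero).2 e2
  change v = 0
  rw [show v = _ from hv, e3, smul_zero]

/-- The Schrödinger operator `H_q = -(1/2) d²/dx² + q δ`, as an unbounded operator in
`L²(ℝ)`. -/
noncomputable def hamiltonian (q : ℝ) : L2 →ₗ.[ℂ] L2 :=
  (hamiltonianGraph q).toLinearPMap

theorem hamiltonian_graph (q : ℝ) : (hamiltonian q).graph = hamiltonianGraph q :=
  Submodule.toLinearPMap_graph_eq _ (hamiltonianGraph_singleValued q)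

/-! ### The unitary group generated by a self-adjoint operator -/

/-- `U` is a strongly continuous one-parameter unitary group whose infinitesimal generator is
exactly `-i A` (same domain, same values); that is, `U t = e^{-itA}`. -/
structure IsUnitaryGroupOf {E : Type*} [NormedAddCommGroup E] [InnerProductSpace ℂ E]
    (A : E →ₗ.[ℂ] E) (U : ℝ → E →L[ℂ] E) : Prop where
  zero : U 0 = ContinuousLinearMap.id ℂ E
  add : ∀ s t, U (s + t) = (U s).comp (U t)
  isometry : ∀ t u, ‖U t u‖ = ‖u‖
  cont : ∀ u, Continuous fun t => U t u
  generator : ∀ u v, (u, v) ∈ A.graph ↔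
    Tendsto (fun t : ℝ => (t : ℂ)⁻¹ • (U t u - u)) (𝓝[≠] 0) (𝓝 (-Complex.I • v))

open Classical in
/-- `e^{-itA}`: the unitary group with generator `-i A`, which exists and is unique when `A` is
self-adjoint (and `0` by convention if there is none). -/
noncomputable def expNegI {E : Type*} [NormedAddCommGroup E] [InnerProductSpace ℂ E]
    (A : E →ₗ.[ℂ] E) (t : ℝ) : E →L[ℂ] E :=
  if h : ∃ U : ℝ → E →L[ℂ] E, IsUnitaryGroupOf A U then h.choose t else 0

/-! ### The distorted Fourier transform -/

/-- The transmission coefficient `t_q(ξ) = iξ / (iξ - q)`. -/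
noncomputable def transmission (q ξ : ℝ) : ℂ := Complex.I * ξ / (Complex.I * ξ - q)

/-- The reflection coefficient `r_q(ξ) = q / (iξ - q)`. -/
noncomputable def reflection (q ξ : ℝ) : ℂ := q / (Complex.I * ξ - q)

/-- The Jost function `f_+(x, ξ)`. -/
noncomputable def jostPlus (q x ξ : ℝ) : ℂ :=
  if 0 ≤ x then Complex.exp (Complex.I * x * ξ)
  else 1 / transmission q ξ * Complex.exp (Complex.I * x * ξ) +
    reflection q ξ / transmission q ξ * Complex.exp (-(Complex.I * x * ξ))

/-- The Jost function `f_-(x, ξ)`. -/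
noncomputable def jostMinus (q x ξ : ℝ) : ℂ :=
  if 0 ≤ x then 1 / transmission q ξ * Complex.exp (-(Complex.I * x * ξ)) +
    reflection q ξ / transmission q ξ * Complex.exp (Complex.I * x * ξ)
  else Complex.exp (-(Complex.I * x * ξ))

/-- The distorted plane waves `Ψ(x, ξ)` of `H_q`. (The value at the single frequency `ξ = 0` is
immaterial.) -/
noncomputable def distortedWave (q x ξ : ℝ) : ℂ :=
  if 0 ≤ ξ then transmission q ξ * jostPlus q x ξ
  else transmission q (-ξ) * jostMinus q x (-ξ)

/-- The integral `(2π)^{-1/2} ∫ conj Ψ(x, -ξ) φ(ξ) dξ` truncated to `|ξ| ≤ N`. -/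
noncomputable def truncatedInvFourier (q : ℝ) (φ : ℝ → ℂ) (N x : ℝ) : ℂ :=
  ((1 / √(2 * Real.pi) : ℝ) : ℂ) *
    ∫ ξ in (-N)..N, (starRingEnd ℂ) (distortedWave q x (-ξ)) * φ ξ

open Classical in
/-- The inverse distorted Fourier transform
`F_q⁻¹[φ](x) = (2π)^{-1/2} ∫ conj Ψ(x, -ξ) φ(ξ) dξ` on `L²(ℝ)`. As for the ordinary Fourier
transform on `L²`, the integral is the limit in `L²(ℝ)` of the truncated integrals (and the value
is `0` by convention if the limit does not exist). -/
noncomputable def distortedInvFourier (q : ℝ) (φ : ℝ → ℂ) : L2 :=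
  if h : ∃ ψ : L2, Tendsto
      (fun N : ℝ => eLpNorm (fun x => ψ x - truncatedInvFourier q φ N x) 2 volume) atTop (𝓝 0)
  then h.choose else 0

/-- The leading term `t^{-1/2} φ(x/t) e^{ix²/(2t) - iπ/4}`. -/
noncomputable def leadingTerm (φ : ℝ → ℂ) (t x : ℝ) : ℂ :=
  ((t ^ (-(1 / 2) : ℝ) : ℝ) : ℂ) * φ (x / t) *
    Complex.exp (Complex.I * x ^ 2 / (2 * t) - Complex.I * Real.pi / 4)

end DeltaNLS

namespace DeltaNLS

/-! ### The fundamental theorem of calculus for weak derivatives -/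

/-! Write ρ(ξ) = -q/(q + iξ), ρ₊ = 1_{ξ>0} ρ, F for the unitary Fourier transform, and E for f ↦ f +
f(-·). Going through the signs of x and ξ shows that, for ξ ≠ 0, the conjugated wave is e^{ixξ} +
ρ₊(ξ) e^{-i|x|ξ} + ρ₊(-ξ) e^{i|x|ξ} (`conj_distortedWave`). Hence the inverse distorted transform is
F⁻¹φ + E 1_{x<0} F⁻¹(ρ₊ Eφ), which is the bounded operator `distInvL`; its adjoint is `distL`.

Unitarity rests on two facts. The number 1 + 2ρ is unimodular, and for q > 0 the multiplier ρ̄ =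
-q/(q - iξ) averages the translates f(· + s) over s > 0 with weight -q e^{-qs}, so it preserves
functions supported in x < 0. Expanding the norm then shows that `distL` is an isometry
(`norm_distL`). That its adjoint is injective (`distInvL_injective`) comes down to a rank-one
equation whose only solution is 0. This is the absence of a bound state for q ≥ 0.

In this representation H_q is multiplication by ξ²/2. Differentiating the distorted integral gives
the jump condition, and conversely integrating a Wronskian over the two half-lines shows that every
element of the domain is of this form. Thus conjugating e^{-itξ²/2} by the transform gives a unitary
group generated by H_q (`isUnitaryGroupOf_schrodL`). An energy argument identifies it with the group
chosen in `expNegI` (`expNegI_hamiltonian`).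

Since e^{-itξ²/2} is even, the evolution of F_q⁻¹φ is the free evolution of φ plus E 1_{x<0} applied
to the free evolution of a = ρ₊ Eφ. The free evolution factors as chirp, dilation, F, chirp, up to a
constant (`invFourierL_phase_fourierL`). Replacing the inner chirp by 1 gives the leading term, and
the error is governed by (e^{iy²/(2t)} - 1) F⁻¹a (`freeRem_eq`). The leading term of a lives on x >
0, because a lives on ξ > 0, and is removed by the restriction to x < 0 (`halfL_leading_scatL`);
only that of φ survives.

The error is bounded through ‖yF⁻¹a‖₂, that is through the H¹ size of a. Here φ(0) = 0 is essential:
ρ₊ jumps at 0 when q > 0, and the product ρ₊ Eφ stays continuous only because Eφ vanishes there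
(`norm_rhoPos_mul_sub_le`). The L² error is O(min(1, t^{-1/2})) and the uniform error is O(t^{-1/2}
min(1, t^{-1/4})) (`freeRem_bounds`). Interpolation in p, separately for t ≤ 1 and t ≥ 1, gives
every exponent β between 0 and 1/2 + 1/p (`eLpNorm_le_of_decay`). -/

theorem deriv_smoothTransition_eq_zero {x : ℝ} (hx : x ∉ Icc (0 : ℝ) 1) :
    deriv Real.smoothTransition x = 0 := by
  rw [mem_Icc, not_and_or, not_le, not_le] at hx
  rcases hx with hx | hx
  · have : Real.smoothTransition =ᶠ[𝓝 x] fun _ => (0 : ℝ) := by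
      filter_upwards [gt_mem_nhds hx] with y hy
      exact Real.smoothTransition.zero_of_nonpos hy.le
    rw [this.deriv_eq]; simp
  · have : Real.smoothTransition =ᶠ[𝓝 x] fun _ => (1 : ℝ) := by
      filter_upwards [lt_mem_nhds hx] with y hy
      exact Real.smoothTransition.one_of_one_le hy.le
    rw [this.deriv_eq]; simp

theorem continuous_deriv_smoothTransition : Continuous (deriv Real.smoothTransition) :=
  (Real.smoothTransition.contDiff (n := 1)).continuous_deriv le_rfl

theorem hasCompactSupport_deriv_smoothTransition :
    HasCompactSupport (deriv Real.smoothTransition) :=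
  HasCompactSupport.intro isCompact_Icc fun _ hx => deriv_smoothTransition_eq_zero hx

theorem integral_deriv_smoothTransition : ∫ x, deriv Real.smoothTransition x = 1 := by
  have h1 : ∫ x in (0 : ℝ)..1, deriv Real.smoothTransition x = 1 := by
    rw [intervalIntegral.integral_deriv_eq_sub]
    · simp
    · exact fun x _ => Real.smoothTransition.contDiffAt.differentiableAt (n := 1) (by simp)
    · exact continuous_deriv_smoothTransition.intervalIntegrable _ _
  rw [← h1, intervalIntegral.integral_of_le zero_le_one, ← integral_Icc_eq_integral_Ioc,
    setIntegral_eq_integral_of_forall_compl_eq_zero]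
  exact fun x hx => deriv_smoothTransition_eq_zero hx

/-- The derivative of the smooth transition is a bump on [0, 1] of mass one, so its rescalings form
an approximate identity. The centre is allowed to move with ε because the right-hand ramp of
`smoothIndicator` starts at b - ε. -/
theorem tendsto_integral_deriv_smoothTransition {F : ℝ → ℂ} (hF : Continuous F) {c : ℝ → ℝ}
    {a : ℝ} (hc : ContinuousAt c 0) (hca : c 0 = a) :
    Tendsto (fun ε : ℝ => ∫ x, (ε⁻¹ * deriv Real.smoothTransition ((x - c ε) / ε)) • F x)
      (𝓝[>] 0) (𝓝 (F a)) := by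
  set k := deriv Real.smoothTransition with hk
  have e1 : ∀ ε : ℝ, 0 < ε → ∫ x, (ε⁻¹ * k ((x - c ε) / ε)) • F x
      = ∫ y, k y • F (c ε + ε * y) := by
    intro ε hε
    have h := Measure.integral_comp_mul_left
      (fun x => (ε⁻¹ * k (x / ε)) • F (c ε + x)) ε
    have h2 := integral_add_right_eq_self (μ := (volume : Measure ℝ))
      (fun x => (ε⁻¹ * k ((x - c ε) / ε)) • F x) (c ε)
    rw [← h2]
    have e3 : (fun x => (ε⁻¹ * k ((x + c ε - c ε) / ε)) • F (x + c ε))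
        = fun x => (ε⁻¹ * k (x / ε)) • F (c ε + x) := by
      funext x; rw [add_sub_cancel_right, add_comm x]
    rw [e3]
    have e4 : (∫ x, (ε⁻¹ * k (x / ε)) • F (c ε + x))
        = ε • ∫ x, (ε⁻¹ * k (ε * x / ε)) • F (c ε + ε * x) := by
      rw [h, abs_of_pos (inv_pos.2 hε), smul_smul, mul_inv_cancel₀ hε.ne', one_smul]
    rw [e4, ← integral_smul]
    refine integral_congr_ae (Eventually.of_forall fun x => ?_)
    simp only [smul_smul]
    rw [mul_div_cancel_left₀ _ hε.ne', ← mul_assoc, mul_inv_cancel₀ hε.ne', one_mul]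
  have e2 : Tendsto (fun ε : ℝ => ∫ y, k y • F (c ε + ε * y)) (𝓝[>] 0) (𝓝 (∫ y, k y • F a)) := by
    obtain ⟨C, hC⟩ := (isCompact_Icc (a := a - 2) (b := a + 2)).exists_bound_of_continuousOn
      hF.continuousOn
    have hce : ∀ᶠ ε in 𝓝[>] (0 : ℝ), |c ε - a| < 1 := by
      have : ∀ᶠ ε in 𝓝 (0 : ℝ), |c ε - a| < 1 := by
        have := Metric.tendsto_nhds.1 hc.tendsto 1 one_pos
        simpa [Real.dist_eq, hca] using this
      exact this.filter_mono nhdsWithin_le_nhds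
    have hε1 : ∀ᶠ ε in 𝓝[>] (0 : ℝ), ε < 1 :=
      (gt_mem_nhds one_pos).filter_mono nhdsWithin_le_nhds
    refine tendsto_integral_filter_of_dominated_convergence (fun y => ‖k y‖ * C) ?_ ?_ ?_ ?_
    · exact Eventually.of_forall fun ε =>
        (continuous_deriv_smoothTransition.smul (hF.comp (by fun_prop))).aestronglyMeasurable
    · filter_upwards [hce, hε1, self_mem_nhdsWithin] with ε h1 h2 h3
      refine Eventually.of_forall fun y => ?_
      rw [norm_smul]
      by_cases hy : y ∈ Icc (0 : ℝ) 1
      · refine mul_le_mul_of_nonneg_left (hC _ ?_) (norm_nonneg _)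
        rw [mem_Ioi] at h3
        rw [abs_lt] at h1
        constructor <;> nlinarith [hy.1, hy.2]
      · simp [hk, deriv_smoothTransition_eq_zero hy]
    · exact (((continuous_deriv_smoothTransition.integrable_of_hasCompactSupport
        hasCompactSupport_deriv_smoothTransition).norm).mul_const C)
    · refine Eventually.of_forall fun y => ?_
      refine Tendsto.const_smul ?_ _
      have h0 : Tendsto (fun ε : ℝ => c ε + ε * y) (𝓝[>] 0) (𝓝 (a + 0 * y)) := by
        rw [← hca]
        exact ((hc.tendsto).add (tendsto_id.mul_const y)).mono_left nhdsWithin_le_nhds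
      rw [zero_mul, add_zero] at h0
      exact (hF.tendsto a).comp h0
  have e3 : ∫ y, k y • F a = F a := by
    rw [integral_smul_const, hk, integral_deriv_smoothTransition, one_smul]
  rw [e3] at e2
  refine e2.congr' ?_
  filter_upwards [self_mem_nhdsWithin] with ε hε
  exact (e1 ε hε).symm

/-- The smooth approximation from inside of the indicator function of `[a, b]`. -/
noncomputable def smoothIndicator (a b ε x : ℝ) : ℝ :=
  Real.smoothTransition ((x - a) / ε) - Real.smoothTransition ((x - (b - ε)) / ε)

theorem contDiff_smoothIndicator (a b ε : ℝ) : ContDiff ℝ ∞ (smoothIndicator a b ε) := by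
  unfold smoothIndicator
  exact (Real.smoothTransition.contDiff.comp (by fun_prop)).sub
    (Real.smoothTransition.contDiff.comp (by fun_prop))

theorem smoothIndicator_eq_zero {a b ε x : ℝ} (hε : 0 < ε) (hεb : ε < b - a)
    (hx : x ∉ Icc a b) : smoothIndicator a b ε x = 0 := by
  rw [mem_Icc, not_and_or, not_le, not_le] at hx
  unfold smoothIndicator
  rcases hx with hx | hx
  · rw [Real.smoothTransition.zero_of_nonpos, Real.smoothTransition.zero_of_nonpos, sub_zero]
    · exact div_nonpos_of_nonpos_of_nonneg (by linarith) hε.le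
    · exact div_nonpos_of_nonpos_of_nonneg (by linarith) hε.le
  · rw [Real.smoothTransition.one_of_one_le, Real.smoothTransition.one_of_one_le, sub_self]
    · rw [le_div_iff₀ hε]; linarith
    · rw [le_div_iff₀ hε]; linarith

theorem deriv_smoothIndicator (a b ε x : ℝ) : deriv (smoothIndicator a b ε) x =
    ε⁻¹ * deriv Real.smoothTransition ((x - a) / ε) -
      ε⁻¹ * deriv Real.smoothTransition ((x - (b - ε)) / ε) := by
  have hd : ∀ y, HasDerivAt Real.smoothTransition (deriv Real.smoothTransition y) y := fun y =>
    (Real.smoothTransition.contDiffAt.differentiableAt (n := 1) (by simp)).hasDerivAt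
  have h : ∀ c : ℝ, HasDerivAt (fun x => Real.smoothTransition ((x - c) / ε))
      (ε⁻¹ * deriv Real.smoothTransition ((x - c) / ε)) x := fun c => by
    have := (hd ((x - c) / ε)).comp x (((hasDerivAt_id x).sub_const c).div_const ε)
    rw [mul_comm, ← one_div]
    exact this
  exact ((h a).sub (h (b - ε))).deriv

/-- Test the weak derivative against smooth indicators of [a, b]: they increase to the indicator,
while their derivatives tend to a unit mass at a minus one at b. -/
theorem HasWeakDerivOn.integral_eq_sub {Ω : Set ℝ} {f g : ℝ → ℂ} (h : HasWeakDerivOn Ω f g)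
    (hf : ContinuousOn f Ω) {a b : ℝ} (hab : a ≤ b) (hI : Icc a b ⊆ Ω) :
    ∫ x in a..b, g x = f b - f a := by
  rcases hab.eq_or_lt with rfl | hab'
  · simp
  have hgI : IntegrableOn g (Icc a b) := h.2.1.integrableOn_compact_subset hI isCompact_Icc
  -- Extending f by constants outside [a, b] gives a function continuous on the whole line, as the
  -- approximate identity requires; the derivative of the test function does not see the change.
  set F : ℝ → ℂ := fun x => f (projIcc a b hab x) with hF
  have hFc : Continuous F :=
    (continuousOn_iff_continuous_domRestrict.1 (hf.mono hI)).comp continuous_projIcc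
  have hFa : F a = f a := by simp [hF]
  have hFb : F b = f b := by simp [hF]
  have hFf : ∀ x ∈ Icc a b, F x = f x := fun x hx => by simp [hF, projIcc_of_mem hab hx]
  have hε0 : ∀ᶠ ε in 𝓝[>] (0 : ℝ), ε < b - a :=
    (gt_mem_nhds (sub_pos.2 hab')).filter_mono nhdsWithin_le_nhds
  have t1 := (tendsto_integral_deriv_smoothTransition hFc (c := fun _ => a)
    continuousAt_const rfl).sub
    (tendsto_integral_deriv_smoothTransition hFc (c := fun ε => b - ε) (a := b)
    (by fun_prop) (by simp))
  have hint : ∀ ε : ℝ, 0 < ε → ∀ c : ℝ, Integrable fun x =>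
      (ε⁻¹ * deriv Real.smoothTransition ((x - c) / ε)) • F x := by
    intro ε hε c
    refine Continuous.integrable_of_hasCompactSupport ?_ ?_
    · exact (continuous_const.mul
        (continuous_deriv_smoothTransition.comp (by fun_prop))).smul hFc
    · refine HasCompactSupport.intro (isCompact_Icc (a := c) (b := c + ε)) fun x hx => ?_
      rw [deriv_smoothTransition_eq_zero, mul_zero, zero_smul]
      intro hx'
      apply hx
      rw [mem_Icc, le_div_iff₀ hε, div_le_iff₀ hε] at hx'
      constructor <;> linarith [hx'.1, hx'.2]
  have t2 : Tendsto (fun ε : ℝ => ∫ x, smoothIndicator a b ε x • g x) (𝓝[>] 0)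
      (𝓝 (∫ x, (Ioo a b).indicator g x)) := by
    refine tendsto_integral_filter_of_dominated_convergence ((Icc a b).indicator fun x => ‖g x‖)
      ?_ ?_ ?_ ?_
    · filter_upwards [self_mem_nhdsWithin, hε0] with ε h1 h2
      have hts : tsupport (smoothIndicator a b ε) ⊆ Icc a b :=
        closure_minimal (fun x hx => by
          by_contra hx'
          exact hx (smoothIndicator_eq_zero h1 h2 hx')) isClosed_Icc
      exact (h.integrable (contDiff_smoothIndicator a b ε)
        (isCompact_Icc.of_isClosed_subset (isClosed_tsupport _) hts)
        (hts.trans hI)).2.aestronglyMeasurable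
    · filter_upwards [self_mem_nhdsWithin, hε0] with ε h1 h2
      refine Eventually.of_forall fun x => ?_
      by_cases hx : x ∈ Icc a b
      · rw [indicator_of_mem hx, norm_smul]
        refine mul_le_of_le_one_left (norm_nonneg _) ?_
        rw [Real.norm_eq_abs, abs_le, smoothIndicator]
        constructor <;> linarith [Real.smoothTransition.nonneg ((x - a) / ε),
          Real.smoothTransition.le_one ((x - a) / ε),
          Real.smoothTransition.nonneg ((x - (b - ε)) / ε),
          Real.smoothTransition.le_one ((x - (b - ε)) / ε)]
      · rw [indicator_of_notMem hx, smoothIndicator_eq_zero h1 h2 hx, zero_smul, norm_zero]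
    · exact (integrable_indicator_iff measurableSet_Icc).2 hgI.norm
    · have hab0 : ∀ᵐ x : ℝ, x ≠ a ∧ x ≠ b := by
        rw [eventually_and]; exact ⟨by simp [ae_iff], by simp [ae_iff]⟩
      filter_upwards [hab0] with x hx
      by_cases hxI : x ∈ Ioo a b
      · have hx1 : ∀ᶠ ε in 𝓝[>] (0 : ℝ), ε < x - a :=
          (gt_mem_nhds (sub_pos.2 hxI.1)).filter_mono nhdsWithin_le_nhds
        have hx2 : ∀ᶠ ε in 𝓝[>] (0 : ℝ), ε < b - x :=
          (gt_mem_nhds (sub_pos.2 hxI.2)).filter_mono nhdsWithin_le_nhds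
        rw [indicator_of_mem hxI]
        refine tendsto_const_nhds.congr' ?_
        filter_upwards [hx1, hx2, self_mem_nhdsWithin] with ε h1 h2 h3
        rw [mem_Ioi] at h3
        rw [smoothIndicator, Real.smoothTransition.one_of_one_le,
          Real.smoothTransition.zero_of_nonpos, sub_zero, one_smul]
        · exact div_nonpos_of_nonpos_of_nonneg (by linarith) h3.le
        · rw [le_div_iff₀ h3]; linarith
      · rw [indicator_of_notMem hxI]
        refine tendsto_const_nhds.congr' ?_
        filter_upwards [self_mem_nhdsWithin, hε0] with ε h1 h2
        rw [smoothIndicator_eq_zero h1 h2, zero_smul]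
        exact fun h' => hxI ⟨lt_of_le_of_ne h'.1 (Ne.symm hx.1), lt_of_le_of_ne h'.2 hx.2⟩
  have t3 : Tendsto (fun ε : ℝ => -∫ x, smoothIndicator a b ε x • g x) (𝓝[>] 0)
      (𝓝 (F a - F b)) := by
    refine t1.congr' ?_
    filter_upwards [self_mem_nhdsWithin, hε0] with ε h1 h2
    have hts : tsupport (smoothIndicator a b ε) ⊆ Icc a b :=
      closure_minimal (fun x hx => by
        by_contra hx'
        exact hx (smoothIndicator_eq_zero h1 h2 hx')) isClosed_Icc
    rw [← h.2.2 _ (contDiff_smoothIndicator a b ε)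
        (isCompact_Icc.of_isClosed_subset (isClosed_tsupport _) hts) (hts.trans hI),
      ← integral_sub (hint ε h1 _) (hint ε h1 _)]
    refine integral_congr_ae (Eventually.of_forall fun x => ?_)
    simp only
    rw [← sub_smul, ← deriv_smoothIndicator]
    by_cases hx : x ∈ Icc a b
    · rw [hFf x hx]
    · have : deriv (smoothIndicator a b ε) x = 0 := by
        by_contra h'
        exact hx (hts (support_deriv_subset h'))
      rw [this, zero_smul, zero_smul]
  have := tendsto_nhds_unique t3 t2.neg
  rw [integral_indicator measurableSet_Ioo, ← integral_Ioc_eq_integral_Ioo,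
    ← intervalIntegral.integral_of_le hab, hFa, hFb] at this
  linear_combination this

/-! ### Classical derivatives, products and limits of weak derivatives -/

theorem continuous_smul_of_tsupport_subset {Ω : Set ℝ} (hΩ : IsOpen Ω) {f : ℝ → ℂ}
    (hf : ContinuousOn f Ω) {η : ℝ → ℝ} (hη : Continuous η) (hs : tsupport η ⊆ Ω) :
    Continuous fun x => η x • f x := by
  rw [continuous_iff_continuousAt]
  intro x
  by_cases hx : x ∈ tsupport η
  · exact hη.continuousAt.smul (hf.continuousAt (hΩ.mem_nhds (hs hx)))
  · have : (fun x => η x • f x) =ᶠ[𝓝 x] fun _ => (0 : ℂ) := by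
      filter_upwards [(isClosed_tsupport η).isOpen_compl.mem_nhds hx] with y hy
      rw [image_eq_zero_of_notMem_tsupport hy, zero_smul]
    exact continuousAt_const.congr this.symm

/-- Integration by parts tolerates one exceptional point as long as f is continuous there. This is
what makes a kink at the origin harmless, while a jump has to be excluded by taking 0 out of Ω. -/
theorem hasWeakDerivOn_of_hasDerivAt {Ω : Set ℝ} (hΩ : IsOpen Ω) {f g : ℝ → ℂ}
    (hf : ContinuousOn f Ω) (hd : ∀ x ∈ Ω, x ≠ 0 → HasDerivAt f (g x) x)
    (hg : LocallyIntegrableOn g Ω) : HasWeakDerivOn Ω f g := by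
  have hfl : LocallyIntegrableOn f Ω := hf.locallyIntegrableOn hΩ.measurableSet
  refine ⟨hfl, hg, fun η h1 h2 h3 => ?_⟩
  have i1 := integrable_smul_of_tsupport_subset hfl (h1.continuous_deriv (by simp)) h2 h3
      support_deriv_subset
  have i2 := integrable_smul_of_tsupport_subset hg h1.continuous h2 h3 (subset_tsupport _)
  obtain ⟨N, hN⟩ := h2.isBounded.subset_closedBall (0 : ℝ)
  rw [Real.closedBall_eq_Icc, zero_sub, zero_add] at hN
  set b := |N| + 1 with hb
  have hbN : N < b := by have := le_abs_self N; linarith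
  have hb0 : 0 < b := by positivity
  have hz : ∀ x, x ∉ Ioo (-b) b → x ∉ tsupport η := fun x hx hx' => by
    apply hx
    have := hN hx'
    constructor <;> linarith [this.1, this.2]
  have hderiv : ∀ x ∈ Ioo (min (-b) b) (max (-b) b) \ {0},
      HasDerivAt (fun x => η x • f x) (deriv η x • f x + η x • g x) x := by
    intro x hx
    by_cases hx' : x ∈ tsupport η
    · have e := ((h1.differentiable (by simp)) x).hasDerivAt.smul (hd x (h3 hx') (by simpa using hx.2))
      rw [add_comm]
      exact e
    · have e1 : (fun x => η x • f x) =ᶠ[𝓝 x] fun _ => (0 : ℂ) := by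
        filter_upwards [(isClosed_tsupport η).isOpen_compl.mem_nhds hx'] with y hy
        rw [image_eq_zero_of_notMem_tsupport hy, zero_smul]
      have e2 : deriv η x = 0 := by
        by_contra h'
        exact hx' (support_deriv_subset h')
      rw [e2, image_eq_zero_of_notMem_tsupport hx', zero_smul, zero_smul, add_zero]
      exact (hasDerivAt_const x (0 : ℂ)).congr_of_eventuallyEq e1
  have key := MeasureTheory.integral_eq_of_hasDerivAt_off_countable (a := -b) (b := b)
    (fun x => η x • f x) (fun x => deriv η x • f x + η x • g x) (countable_singleton (0 : ℝ))
    (continuous_smul_of_tsupport_subset hΩ hf h1.continuous h3).continuousOn hderiv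
    (i1.add i2).intervalIntegrable
  rw [image_eq_zero_of_notMem_tsupport (hz b (by simp)),
    image_eq_zero_of_notMem_tsupport (hz (-b) (by simp)), zero_smul, zero_smul, sub_zero,
    intervalIntegral.integral_of_le (by linarith), integral_Ioc_eq_integral_Ioo,
    setIntegral_eq_integral_of_forall_compl_eq_zero, integral_add i1 i2] at key
  · exact eq_neg_of_add_eq_zero_left key
  · intro x hx
    have e2 : deriv η x = 0 := by
      by_contra h'
      exact hz x hx (support_deriv_subset h')
    rw [e2, image_eq_zero_of_notMem_tsupport (hz x hx), zero_smul, zero_smul, add_zero]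

/-- Complex-valued test functions are as good as real-valued ones. -/
theorem HasWeakDerivOn.integral_deriv_mul {Ω : Set ℝ} {f g : ℝ → ℂ} (h : HasWeakDerivOn Ω f g)
    {η : ℝ → ℂ} (h1 : ContDiff ℝ ∞ η) (h2 : HasCompactSupport η) (h3 : tsupport η ⊆ Ω) :
    ∫ x, deriv η x * f x = -∫ x, η x * g x := by
  have hd : ∀ x, HasDerivAt η (deriv η x) x := fun x => (h1.differentiable (by simp) x).hasDerivAt
  have key : ∀ L : ℂ →L[ℝ] ℝ, ∫ x, (L (deriv η x)) • f x = -∫ x, L (η x) • g x ∧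
      Integrable (fun x => (L (deriv η x)) • f x) ∧ Integrable (fun x => (L (η x)) • g x) := by
    intro L
    have c1 : ContDiff ℝ ∞ fun x => L (η x) := L.contDiff.comp h1
    have c2 : HasCompactSupport fun x => L (η x) := h2.comp_left (map_zero L)
    have c3 : tsupport (fun x => L (η x)) ⊆ Ω :=
      (closure_mono (t := Function.support η)
        fun x (hx : L (η x) ≠ 0) (hx' : η x = 0) => hx (by rw [hx', map_zero])).trans h3
    have c4 : deriv (fun x => L (η x)) = fun x => L (deriv η x) :=
      funext fun x => (L.hasFDerivAt.comp_hasDerivAt x (hd x)).deriv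
    have a1 := h.2.2 _ c1 c2 c3
    have a2 := h.integrable c1 c2 c3
    rw [c4] at a1 a2
    exact ⟨a1, a2⟩
  obtain ⟨r1, r2, r3⟩ := key Complex.reCLM
  obtain ⟨s1, s2, s3⟩ := key Complex.imCLM
  have split : ∀ (z w : ℂ), z * w = z.re • w + Complex.I * (z.im • w) := fun z w => by
    conv_lhs => rw [← Complex.re_add_im z]
    simp only [Complex.real_smul]
    ring
  simp only [Complex.reCLM_apply, Complex.imCLM_apply] at r1 r2 r3 s1 s2 s3
  simp_rw [fun x => split (deriv η x) (f x), fun x => split (η x) (g x)]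
  rw [integral_add r2 (s2.const_mul _), integral_add r3 (s3.const_mul _), integral_const_mul,
    integral_const_mul, r1, s1]
  ring

/-- The factor h is absorbed into the test function: ηh is smooth on the whole line, although h is
smooth only on Ω, because η vanishes near every point outside its closed support. Since h is
complex, complex test functions are needed. -/
theorem HasWeakDerivOn.mul_left {Ω : Set ℝ} (hΩ : IsOpen Ω) {f g h : ℝ → ℂ}
    (H : HasWeakDerivOn Ω f g) (hh : ContDiffOn ℝ ∞ h Ω) :
    HasWeakDerivOn Ω (fun x => h x * f x) (fun x => deriv h x * f x + h x * g x) := by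
  have hc' : ContinuousOn (deriv h) Ω := hh.continuousOn_deriv_of_isOpen hΩ (by simp)
  have l1 : LocallyIntegrableOn (fun x => h x * f x) Ω :=
    H.1.continuousOn_mul hh.continuousOn hΩ.isLocallyClosed
  have l2 : LocallyIntegrableOn (fun x => h x * g x) Ω :=
    H.2.1.continuousOn_mul hh.continuousOn hΩ.isLocallyClosed
  have l3 : LocallyIntegrableOn (fun x => deriv h x * f x) Ω :=
    H.1.continuousOn_mul hc' hΩ.isLocallyClosed
  refine ⟨l1, l3.add l2, fun η h1 h2 h3 => ?_⟩
  have zero_nhds : ∀ x ∉ tsupport η, (fun x => (η x : ℂ) * h x) =ᶠ[𝓝 x] fun _ => (0 : ℂ) := by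
    intro x hx
    filter_upwards [(isClosed_tsupport η).isOpen_compl.mem_nhds hx] with y hy
    rw [image_eq_zero_of_notMem_tsupport hy, Complex.ofReal_zero, zero_mul]
  have k1 : ContDiff ℝ ∞ fun x => (η x : ℂ) * h x := by
    rw [contDiff_iff_contDiffAt]
    intro x
    by_cases hx : x ∈ tsupport η
    · exact (Complex.ofRealCLM.contDiff.comp h1).contDiffAt.mul
        (hh.contDiffAt (hΩ.mem_nhds (h3 hx)))
    · exact contDiffAt_const.congr_of_eventuallyEq (zero_nhds x hx)
  have ksub : tsupport (fun x => (η x : ℂ) * h x) ⊆ tsupport η :=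
    closure_mono fun x hx hx' => hx (by simp [hx'])
  have k2 : HasCompactSupport fun x => (η x : ℂ) * h x :=
    h2.of_isClosed_subset (isClosed_tsupport _) ksub
  have kd : ∀ x, deriv (fun x => (η x : ℂ) * h x) x = deriv η x * h x + η x * deriv h x := by
    intro x
    by_cases hx : x ∈ tsupport η
    · have d1 : HasDerivAt h (deriv h x) x :=
        ((hh.contDiffAt (hΩ.mem_nhds (h3 hx))).differentiableAt (by simp)).hasDerivAt
      exact ((h1.differentiable (by simp) x).hasDerivAt.ofReal_comp.mul d1).deriv
    · have e2 : deriv η x = 0 := by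
        by_contra h'
        exact hx (support_deriv_subset h')
      rw [(zero_nhds x hx).deriv_eq, e2, image_eq_zero_of_notMem_tsupport hx]
      simp
  have i1 := integrable_smul_of_tsupport_subset l3 h1.continuous h2 h3 (subset_tsupport _)
  have i2 := integrable_smul_of_tsupport_subset l2 h1.continuous h2 h3 (subset_tsupport _)
  have i3 := integrable_smul_of_tsupport_subset l1 (h1.continuous_deriv (by simp)) h2 h3
      support_deriv_subset
  have key := H.integral_deriv_mul k1 k2 (ksub.trans h3)
  simp only [kd] at key
  have e1 : ∫ x, (deriv η x * h x + η x * deriv h x) * f x =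
      (∫ x, deriv η x • (h x * f x)) + ∫ x, η x • (deriv h x * f x) := by
    rw [← integral_add i3 i1]
    refine integral_congr_ae (Eventually.of_forall fun x => ?_)
    simp only [Complex.real_smul]
    ring
  have e2 : ∫ x, η x • (deriv h x * f x + h x * g x) =
      (∫ x, η x • (deriv h x * f x)) + ∫ x, ↑(η x) * h x * g x := by
    simp only [smul_add]
    rw [integral_add i1 i2]
    congr 1
    refine integral_congr_ae (Eventually.of_forall fun x => ?_)
    simp only [Complex.real_smul]
    ring
  rw [e1] at key
  rw [e2]
  linear_combination key

theorem L2_locallyIntegrable (f : L2) : LocallyIntegrable f :=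
  (Lp.memLp f).locallyIntegrable (by norm_num)

theorem tendsto_integral_smul {ι : Type*} {l : Filter ι} {f : ι → L2} {f₀ : L2}
    (hf : Tendsto f l (𝓝 f₀)) {η : ℝ → ℝ} (hη : Continuous η) (hc : HasCompactSupport η) :
    Tendsto (fun i => ∫ x, η x • f i x) l (𝓝 (∫ x, η x • f₀ x)) := by
  have hm : MemLp (fun x => (η x : ℂ)) 2 (volume : Measure ℝ) :=
    (Complex.continuous_ofReal.comp hη).memLp_of_hasCompactSupport
      (hc.comp_left (g := fun x : ℝ => (x : ℂ)) (by simp))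
  have e : ∀ f : L2, ∫ x, η x • f x = inner ℂ hm.toLp f := fun f => by
    rw [L2.inner_def]
    refine integral_congr_ae ?_
    filter_upwards [hm.coeFn_toLp] with x hx
    rw [hx]
    simp [mul_comm]
  simp only [e]
  exact tendsto_const_nhds.inner hf

/-- Weak differentiation is closed in `L²`. -/
theorem hasWeakDerivOn_of_tendsto {Ω : Set ℝ} {ι : Type*} {l : Filter ι} [l.NeBot] {f g : ι → L2}
    {f₀ g₀ : L2} (hf : Tendsto f l (𝓝 f₀)) (hg : Tendsto g l (𝓝 g₀))
    (h : ∀ i, HasWeakDerivOn Ω (f i) (g i)) : HasWeakDerivOn Ω f₀ g₀ := by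
  refine ⟨(L2_locallyIntegrable f₀).locallyIntegrableOn _,
    (L2_locallyIntegrable g₀).locallyIntegrableOn _, fun η h1 h2 h3 => ?_⟩
  refine tendsto_nhds_unique (tendsto_integral_smul hf (h1.continuous_deriv (by simp))
    h2.deriv) ?_
  simp only [(h _).2.2 η h1 h2 h3]
  exact (tendsto_integral_smul hg h1.continuous h2).neg

/-! ### Bounded multipliers on `L²` -/

/-- Bounded measurable functions. -/
structure BddMeas (m : ℝ → ℂ) : Prop where
  measurable : Measurable m
  bdd : ∃ C : ℝ, ∀ x, ‖m x‖ ≤ C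

theorem BddMeas.memLp {m : ℝ → ℂ} (hm : BddMeas m) {f : ℝ → ℂ} (hf : MemLp f 2) :
    MemLp (fun x => m x * f x) 2 := by
  obtain ⟨C, hC⟩ := hm.bdd
  refine hf.of_le_mul (c := C) (hm.measurable.aestronglyMeasurable.mul hf.1) ?_
  refine Eventually.of_forall fun x => ?_
  rw [norm_mul]
  exact mul_le_mul_of_nonneg_right (hC x) (norm_nonneg _)

theorem BddMeas.mul {m n : ℝ → ℂ} (hm : BddMeas m) (hn : BddMeas n) :
    BddMeas fun x => m x * n x := by
  obtain ⟨C, hC⟩ := hm.bdd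
  obtain ⟨D, hD⟩ := hn.bdd
  refine ⟨hm.measurable.mul hn.measurable, C * D, fun x => ?_⟩
  rw [norm_mul]
  exact mul_le_mul (hC x) (hD x) (norm_nonneg _) ((norm_nonneg _).trans (hC x))

theorem BddMeas.add {m n : ℝ → ℂ} (hm : BddMeas m) (hn : BddMeas n) :
    BddMeas fun x => m x + n x := by
  obtain ⟨C, hC⟩ := hm.bdd
  obtain ⟨D, hD⟩ := hn.bdd
  exact ⟨hm.measurable.add hn.measurable, C + D, fun x => (norm_add_le _ _).trans
    (add_le_add (hC x) (hD x))⟩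

theorem BddMeas.const (c : ℂ) : BddMeas fun _ => c := ⟨measurable_const, ‖c‖, fun _ => le_rfl⟩

theorem BddMeas.conj {m : ℝ → ℂ} (hm : BddMeas m) :
    BddMeas fun x => (starRingEnd ℂ) (m x) := by
  obtain ⟨C, hC⟩ := hm.bdd
  exact ⟨Complex.continuous_conj.measurable.comp hm.measurable, C, fun x => by simpa using hC x⟩

theorem BddMeas.indicator {m : ℝ → ℂ} (hm : BddMeas m) {s : Set ℝ} (hs : MeasurableSet s) :
    BddMeas (s.indicator m) := by
  obtain ⟨C, hC⟩ := hm.bdd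
  exact ⟨hm.measurable.indicator hs, C, fun x => (norm_indicator_le_norm_self _ _).trans (hC x)⟩

theorem BddMeas.comp {m : ℝ → ℂ} (hm : BddMeas m) {σ : ℝ → ℝ} (hσ : Measurable σ) :
    BddMeas fun x => m (σ x) := by
  obtain ⟨C, hC⟩ := hm.bdd
  exact ⟨hm.measurable.comp hσ, C, fun x => hC _⟩

theorem BddMeas.exp_I {θ : ℝ → ℝ} (hθ : Measurable θ) :
    BddMeas fun x => Complex.exp (Complex.I * θ x) := by
  refine ⟨by fun_prop, 1, fun x => ?_⟩
  rw [mul_comm, Complex.norm_exp_ofReal_mul_I]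

open Classical in
/-- Multiplication by a bounded measurable function, as an operator on `L²`. -/
noncomputable def mulL (m : ℝ → ℂ) : L2 →L[ℂ] L2 :=
  if h : BddMeas m then
    LinearMap.mkContinuous
      { toFun := fun f => (h.memLp (Lp.memLp f)).toLp
        map_add' := fun f g => by
          refine Lp.ext ?_
          filter_upwards [(h.memLp (Lp.memLp (f + g))).coeFn_toLp, Lp.coeFn_add f g,
            Lp.coeFn_add (h.memLp (Lp.memLp f)).toLp (h.memLp (Lp.memLp g)).toLp,
            (h.memLp (Lp.memLp f)).coeFn_toLp, (h.memLp (Lp.memLp g)).coeFn_toLp]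
            with x h1 h2 h3 h4 h5
          rw [h1, h3, Pi.add_apply, h4, h5, h2, Pi.add_apply, mul_add]
        map_smul' := fun c f => by
          refine Lp.ext ?_
          filter_upwards [(h.memLp (Lp.memLp (c • f))).coeFn_toLp, Lp.coeFn_smul c f,
            Lp.coeFn_smul c (h.memLp (Lp.memLp f)).toLp,
            (h.memLp (Lp.memLp f)).coeFn_toLp] with x h1 h2 h3 h4
          rw [h1, RingHom.id_apply, h3, Pi.smul_apply, h4, h2, Pi.smul_apply, smul_eq_mul,
            smul_eq_mul, mul_left_comm] } h.bdd.choose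
      (fun f => by
        refine Lp.norm_le_mul_norm_of_ae_le_mul ?_
        filter_upwards [(h.memLp (Lp.memLp f)).coeFn_toLp] with x hx
        simp only [LinearMap.coe_mk, AddHom.coe_mk, hx, norm_mul]
        exact mul_le_mul_of_nonneg_right (h.bdd.choose_spec x) (norm_nonneg _))
  else 0

theorem mulL_ae {m : ℝ → ℂ} (hm : BddMeas m) (f : L2) : mulL m f =ᵐ[volume] fun x => m x * f x := by
  rw [mulL, dif_pos hm]
  exact (hm.memLp (Lp.memLp f)).coeFn_toLp

theorem mulL_congr {m n : ℝ → ℂ} (hm : BddMeas m) (hn : BddMeas n) (h : m =ᵐ[volume] n) (f : L2) :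
    mulL m f = mulL n f := by
  refine Lp.ext ?_
  filter_upwards [mulL_ae hm f, mulL_ae hn f, h] with x h1 h2 h3
  rw [h1, h2, h3]

theorem mulL_mulL {m n : ℝ → ℂ} (hm : BddMeas m) (hn : BddMeas n) (f : L2) :
    mulL m (mulL n f) = mulL (fun x => m x * n x) f := by
  refine Lp.ext ?_
  filter_upwards [mulL_ae hm (mulL n f), mulL_ae hn f, mulL_ae (hm.mul hn) f] with x h1 h2 h3
  rw [h1, h2, h3, mul_assoc]

theorem mulL_add_left {m n : ℝ → ℂ} (hm : BddMeas m) (hn : BddMeas n) (f : L2) :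
    mulL m f + mulL n f = mulL (fun x => m x + n x) f := by
  refine Lp.ext ?_
  filter_upwards [mulL_ae hm f, mulL_ae hn f, mulL_ae (hm.add hn) f,
    Lp.coeFn_add (mulL m f) (mulL n f)] with x h1 h2 h3 h4
  rw [h4, Pi.add_apply, h1, h2, h3, add_mul]

theorem mulL_const (c : ℂ) (f : L2) : mulL (fun _ => c) f = c • f := by
  refine Lp.ext ?_
  filter_upwards [mulL_ae (BddMeas.const c) f, Lp.coeFn_smul c f] with x h1 h2
  rw [h1, h2, Pi.smul_apply, smul_eq_mul]

theorem inner_mulL {m : ℝ → ℂ} (hm : BddMeas m) (f g : L2) :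
    inner ℂ (mulL m f) g = inner ℂ f (mulL (fun x => (starRingEnd ℂ) (m x)) g) := by
  rw [L2.inner_def, L2.inner_def]
  refine integral_congr_ae ?_
  filter_upwards [mulL_ae hm f, mulL_ae hm.conj g] with x h1 h2
  simp only [h1, h2, RCLike.inner_apply, map_mul]
  ring

theorem norm_mulL_of_norm_eq_one {m : ℝ → ℂ} (hm : BddMeas m) (h1 : ∀ x, ‖m x‖ = 1) (f : L2) :
    ‖mulL m f‖ = ‖f‖ := by
  refine le_antisymm (Lp.norm_le_norm_of_ae_le ?_) (Lp.norm_le_norm_of_ae_le ?_) <;>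
  · filter_upwards [mulL_ae hm f] with x hx
    rw [hx, norm_mul, h1, one_mul]

theorem norm_mulL_le {m : ℝ → ℂ} (hm : BddMeas m) {C : ℝ} (hC : ∀ x, ‖m x‖ ≤ C) (f : L2) :
    ‖mulL m f‖ ≤ C * ‖f‖ := by
  refine Lp.norm_le_mul_norm_of_ae_le_mul ?_
  filter_upwards [mulL_ae hm f] with x hx
  rw [hx, norm_mul]
  exact mul_le_mul_of_nonneg_right (hC x) (norm_nonneg _)

/-! ### Affine changes of variables on `L²` -/

theorem map_affine_volume {c : ℝ} (hc : c ≠ 0) (d : ℝ) :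
    Measure.map (fun x : ℝ => c * x + d) volume = ENNReal.ofReal |c⁻¹| • volume := by
  have h1 : (fun x : ℝ => c * x + d) = (fun x => x + d) ∘ (fun x => c * x) := rfl
  rw [h1, ← Measure.map_map (by fun_prop) (by fun_prop), Real.map_volume_mul_left hc,
    Measure.map_smul, map_add_right_eq_self]

theorem quasiMeasurePreserving_affine {c : ℝ} (hc : c ≠ 0) (d : ℝ) :
    Measure.QuasiMeasurePreserving (fun x : ℝ => c * x + d) volume volume :=
  ⟨by fun_prop, by
    rw [map_affine_volume hc]
    exact Measure.smul_absolutelyContinuous⟩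

theorem ae_affine {c : ℝ} (hc : c ≠ 0) (d : ℝ) {p : ℝ → Prop} (h : ∀ᵐ x, p x) :
    ∀ᵐ x : ℝ, p (c * x + d) :=
  (quasiMeasurePreserving_affine hc d).ae h

theorem eLpNorm_comp_affine {c : ℝ} (hc : c ≠ 0) (d : ℝ) {f : ℝ → ℂ}
    (hf : AEStronglyMeasurable f volume) (p : ℝ≥0∞) :
    eLpNorm (fun x => f (c * x + d)) p volume =
      ENNReal.ofReal |c⁻¹| ^ (1 / p).toReal * eLpNorm f p volume := by
  have h0 : ENNReal.ofReal |c⁻¹| ≠ 0 := by simp [hc]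
  have hf' : AEStronglyMeasurable f (Measure.map (fun x : ℝ => c * x + d) volume) := by
    rw [map_affine_volume hc]
    exact hf.smul_measure _
  rw [← smul_eq_mul, ← eLpNorm_smul_measure_of_ne_zero h0, ← map_affine_volume hc d,
    eLpNorm_map_measure hf' (by fun_prop)]
  rfl

theorem memLp_comp_affine {c : ℝ} (hc : c ≠ 0) (d : ℝ) {f : ℝ → ℂ} {p : ℝ≥0∞} (hf : MemLp f p) :
    MemLp (fun x => f (c * x + d)) p := by
  refine ⟨hf.1.comp_quasiMeasurePreserving (quasiMeasurePreserving_affine hc d), ?_⟩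
  rw [eLpNorm_comp_affine hc d hf.1]
  exact ENNReal.mul_lt_top (ENNReal.rpow_lt_top_of_nonneg (by positivity) (by simp)) hf.2

theorem integral_comp_affine (c d : ℝ) (f : ℝ → ℂ) :
    ∫ x, f (c * x + d) = |c⁻¹| • ∫ x, f x := by
  rw [Measure.integral_comp_mul_left (fun x => f (x + d)) c, integral_add_right_eq_self]

open Classical in
/-- The change of variables `x ↦ c x + d`, as an operator on `L²`. -/
noncomputable def compL (c d : ℝ) : L2 →L[ℂ] L2 :=
  if h : c ≠ 0 then
    LinearMap.mkContinuous
      { toFun := fun f => (memLp_comp_affine h d (Lp.memLp f)).toLp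
        map_add' := fun f g => by
          refine Lp.ext ?_
          filter_upwards [(memLp_comp_affine h d (Lp.memLp (f + g))).coeFn_toLp,
            ae_affine h d (Lp.coeFn_add f g),
            Lp.coeFn_add (memLp_comp_affine h d (Lp.memLp f)).toLp
              (memLp_comp_affine h d (Lp.memLp g)).toLp,
            (memLp_comp_affine h d (Lp.memLp f)).coeFn_toLp,
            (memLp_comp_affine h d (Lp.memLp g)).coeFn_toLp] with x h1 h2 h3 h4 h5
          rw [h1, h3, Pi.add_apply, h4, h5, h2, Pi.add_apply]
        map_smul' := fun a f => by
          refine Lp.ext ?_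
          filter_upwards [(memLp_comp_affine h d (Lp.memLp (a • f))).coeFn_toLp,
            ae_affine h d (Lp.coeFn_smul a f),
            Lp.coeFn_smul a (memLp_comp_affine h d (Lp.memLp f)).toLp,
            (memLp_comp_affine h d (Lp.memLp f)).coeFn_toLp] with x h1 h2 h3 h4
          rw [h1, RingHom.id_apply, h3, Pi.smul_apply, h4, h2, Pi.smul_apply] }
      (ENNReal.ofReal |c⁻¹| ^ (1 / (2 : ℝ≥0∞)).toReal).toReal
      (fun f => by
        simp only [LinearMap.coe_mk, AddHom.coe_mk]
        rw [Lp.norm_toLp, eLpNorm_comp_affine h d (Lp.memLp f).1, ENNReal.toReal_mul, ← Lp.norm_def])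
  else 0

theorem compL_ae {c : ℝ} (hc : c ≠ 0) (d : ℝ) (f : L2) :
    compL c d f =ᵐ[volume] fun x => f (c * x + d) := by
  rw [compL, dif_pos hc]
  exact (memLp_comp_affine hc d (Lp.memLp f)).coeFn_toLp

theorem compL_compL {c c' : ℝ} (hc : c ≠ 0) (hc' : c' ≠ 0) (d d' : ℝ) (f : L2) :
    compL c d (compL c' d' f) = compL (c' * c) (c' * d + d') f := by
  refine Lp.ext ?_
  filter_upwards [compL_ae hc d (compL c' d' f), ae_affine hc d (compL_ae hc' d' f),
    compL_ae (mul_ne_zero hc' hc) (c' * d + d') f] with x h1 h2 h3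
  rw [h1, h2, h3]
  congr 1
  ring

theorem compL_one_zero (f : L2) : compL 1 0 f = f := by
  refine Lp.ext ?_
  filter_upwards [compL_ae one_ne_zero 0 f] with x hx
  rw [hx, one_mul, add_zero]

theorem compL_mulL {c : ℝ} (hc : c ≠ 0) (d : ℝ) {m : ℝ → ℂ} (hm : BddMeas m) (f : L2) :
    compL c d (mulL m f) = mulL (fun x => m (c * x + d)) (compL c d f) := by
  refine Lp.ext ?_
  filter_upwards [compL_ae hc d (mulL m f), ae_affine hc d (mulL_ae hm f), compL_ae hc d f,
    mulL_ae (hm.comp (σ := fun x => c * x + d) (by fun_prop)) (compL c d f)] with x h1 h2 h3 h4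
  rw [h1, h2, h4, h3]

theorem inner_compL_compL {c : ℝ} (hc : c ≠ 0) (d : ℝ) (f g : L2) :
    inner ℂ (compL c d f) (compL c d g) = |c⁻¹| • inner ℂ f g := by
  rw [L2.inner_def, L2.inner_def, ← integral_comp_affine c d]
  refine integral_congr_ae ?_
  filter_upwards [compL_ae hc d f, compL_ae hc d g] with x h1 h2
  rw [h1, h2]

theorem L2_norm_sq (f : L2) : ‖f‖ ^ 2 = (inner ℂ f f).re :=
  (inner_self_eq_norm_sq (𝕜 := ℂ) f).symm

theorem norm_compL {c : ℝ} (hc : c ≠ 0) (d : ℝ) (f : L2) :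
    ‖compL c d f‖ = √|c⁻¹| * ‖f‖ := by
  have h := congrArg Complex.re (inner_compL_compL hc d f f)
  rw [Complex.smul_re, ← L2_norm_sq, ← L2_norm_sq, smul_eq_mul] at h
  rw [← sq_eq_sq₀ (norm_nonneg _) (by positivity), mul_pow, Real.sq_sqrt (abs_nonneg _)]
  exact h

/-- The reflection `f ↦ f(-·)`. -/
noncomputable def reflL : L2 →L[ℂ] L2 := compL (-1) 0

theorem reflL_ae (f : L2) : reflL f =ᵐ[volume] fun x => f (-x) := by
  filter_upwards [compL_ae (neg_ne_zero.2 one_ne_zero) 0 f] with x hx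
  rw [reflL, hx]
  simp

theorem ae_neg {p : ℝ → Prop} (h : ∀ᵐ x, p x) : ∀ᵐ x : ℝ, p (-x) := by
  filter_upwards [ae_affine (neg_ne_zero.2 one_ne_zero) 0 h] with x hx
  simpa using hx

theorem reflL_reflL (f : L2) : reflL (reflL f) = f := by
  rw [reflL, compL_compL (by norm_num) (by norm_num)]
  simpa using compL_one_zero f

theorem inner_reflL_left (f g : L2) : inner ℂ (reflL f) g = inner ℂ f (reflL g) := by
  have h := inner_compL_compL (neg_ne_zero.2 (one_ne_zero (α := ℝ))) 0 f (reflL g)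
  rw [← reflL, reflL_reflL] at h
  simpa using h

theorem reflL_mulL {m : ℝ → ℂ} (hm : BddMeas m) (f : L2) :
    reflL (mulL m f) = mulL (fun x => m (-x)) (reflL f) := by
  have h := compL_mulL (neg_ne_zero.2 (one_ne_zero (α := ℝ))) 0 hm f
  simpa [reflL] using h

/-! ### Dominated convergence in `L²` -/

/-- Dominated convergence for ‖G i - f‖², with majorant (b + ‖f‖)². The explicit representatives `G`
are there because the filter may run over uncountably many indices, so that null sets depending on i
could not be discarded together before taking a pointwise limit. -/
theorem tendsto_L2_of_dominated {ι : Type*} {l : Filter ι} [l.IsCountablyGenerated]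
    {F : ι → L2} {f : L2} {G : ι → ℝ → ℂ} (hFG : ∀ i, F i =ᵐ[volume] G i) {b : ℝ → ℝ}
    (hb : MemLp b 2) (hbd : ∀ᶠ i in l, ∀ᵐ x, ‖G i x‖ ≤ b x)
    (hlim : ∀ᵐ x, Tendsto (fun i => G i x) l (𝓝 (f x))) : Tendsto F l (𝓝 f) := by
  rw [tendsto_iff_norm_sub_tendsto_zero]
  have key : Tendsto (fun i => ∫ x, ‖G i x - f x‖ ^ 2) l (𝓝 (∫ _ : ℝ, (0 : ℝ))) := by
    have hi : Integrable fun x => (b x + ‖f x‖) ^ 2 := (hb.add (Lp.memLp f).norm).integrable_sq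
    refine tendsto_integral_filter_of_dominated_convergence _ ?_ ?_ hi ?_
    · refine Eventually.of_forall fun i => ?_
      exact ((((Lp.aestronglyMeasurable (F i)).congr (hFG i)).sub
        (Lp.aestronglyMeasurable f)).norm.pow 2)
    · filter_upwards [hbd] with i hi
      filter_upwards [hi] with x hx
      rw [Real.norm_eq_abs, abs_of_nonneg (by positivity)]
      have := norm_sub_le (G i x) (f x)
      gcongr
      linarith
    · filter_upwards [hlim] with x hx
      have := ((hx.sub_const (f x)).norm).pow 2
      simpa using this
  rw [integral_zero] at key
  have e : ∀ i, ‖F i - f‖ = √(∫ x, ‖G i x - f x‖ ^ 2) := fun i => by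
    rw [eq_comm, Real.sqrt_eq_iff_mul_self_eq (by positivity) (norm_nonneg _), ← pow_two,
      L2_norm_sq, L2.inner_def]
    refine Eq.trans (integral_congr_ae ?_) (integral_re (L2.integrable_inner (𝕜 := ℂ) _ _))
    filter_upwards [Lp.coeFn_sub (F i) f, hFG i] with x h1 h2
    rw [inner_self_eq_norm_sq, h1, Pi.sub_apply, h2]
  simp only [e]
  have := (Real.continuous_sqrt.tendsto _).comp key
  rwa [Real.sqrt_zero] at this

/-- The frequency (or space) cutoff to `[-N, N]`. -/
noncomputable def cutL (N : ℝ) : L2 →L[ℂ] L2 := mulL ((Icc (-N) N).indicator fun _ => 1)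

theorem bddMeas_cut (N : ℝ) : BddMeas ((Icc (-N) N).indicator fun _ => (1 : ℂ)) :=
  (BddMeas.const 1).indicator measurableSet_Icc

theorem cutL_ae (N : ℝ) (f : L2) : cutL N f =ᵐ[volume] (Icc (-N) N).indicator f := by
  filter_upwards [mulL_ae (bddMeas_cut N) f] with x hx
  rw [cutL, hx]
  by_cases h : x ∈ Icc (-N) N <;> simp [h]

theorem tendsto_cutL (f : L2) : Tendsto (fun N => cutL N f) atTop (𝓝 f) := by
  refine tendsto_L2_of_dominated (fun N => cutL_ae N f) (Lp.memLp f).norm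
    (Eventually.of_forall fun N => Eventually.of_forall fun x => norm_indicator_le_norm_self _ _)
    (Eventually.of_forall fun x => ?_)
  refine tendsto_const_nhds.congr' ?_
  filter_upwards [eventually_ge_atTop |x|] with N hN
  rw [indicator_of_mem]
  exact ⟨(abs_le.1 hN).1, (abs_le.1 hN).2⟩

theorem integrable_cutL (N : ℝ) (f : L2) : Integrable (cutL N f) := by
  refine (integrable_congr (cutL_ae N f)).2 ?_
  rw [integrable_indicator_iff measurableSet_Icc]
  exact (L2_locallyIntegrable f).integrableOn_isCompact isCompact_Icc

/-! ### The unitary Fourier transform on `L²` -/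

-- On L¹ ∩ L² the Plancherel extension is given by the integral: both sides are locally integrable
-- and have the same pairing with every test function, since the Fourier integral can be moved onto
-- the test function.
open FourierTransform in
theorem fourierInv_L2_ae (f : L2) (hf : Integrable f) :
    ((𝓕⁻ f : L2) : ℝ → ℂ) =ᵐ[volume] 𝓕⁻ (f : ℝ → ℂ) := by
  have hcont : Continuous (𝓕⁻ (f : ℝ → ℂ)) := by
    have h := VectorFourier.fourierIntegral_continuous (L := innerₗ ℝ) Real.continuous_fourierChar
      continuous_inner hf
    have e : 𝓕⁻ (f : ℝ → ℂ) = fun x => 𝓕 (f : ℝ → ℂ) (-x) :=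
      funext fun x => Real.fourierInv_eq_fourier_neg _ _
    rw [e]
    exact h.comp continuous_neg
  refine ae_eq_of_integral_contDiff_smul_eq (L2_locallyIntegrable _) hcont.locallyIntegrable
    fun η h1 h2 => ?_
  have c1 : HasCompactSupport fun x => (η x : ℂ) :=
    h2.comp_left (g := fun x : ℝ => (x : ℂ)) (by simp)
  have c2 : ContDiff ℝ ∞ fun x => (η x : ℂ) := Complex.ofRealCLM.contDiff.comp h1
  set g : SchwartzMap ℝ ℂ := c1.toSchwartzMap c2 with hg
  have hgx : ∀ x, g x = η x := fun x => rfl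
  have h := congrArg (fun T => T g) (Lp.fourierInv_toTemperedDistribution_eq f)
  simp only [TemperedDistribution.fourierInv_apply, Lp.toTemperedDistribution_apply] at h
  simp only [hgx] at h
  have e1 : ∫ x, η x • (𝓕⁻ f : L2) x = ∫ x, (η x : ℂ) • (𝓕⁻ f : L2) x := by
    simp only [Complex.real_smul, smul_eq_mul]
  rw [e1, ← h]
  have e2 : ∀ x, (𝓕⁻ g) x = 𝓕 (g : ℝ → ℂ) (-x) := fun x => by
    rw [SchwartzMap.fourierInv_coe, Real.fourierInv_eq_fourier_neg]
  have key : ∫ ξ, 𝓕 (g : ℝ → ℂ) ξ • f (-ξ) = ∫ x, g x • 𝓕 (fun y => f (-y)) x := by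
    have := VectorFourier.integral_fourierIntegral_smul_eq_flip (L := innerₗ ℝ)
      (μ := volume) (ν := volume) (f := (g : ℝ → ℂ)) (g := fun y => f (-y))
      Real.continuous_fourierChar continuous_inner g.integrable hf.comp_neg
    rw [flip_innerₗ] at this
    exact this
  simp only [e2]
  rw [← integral_neg_eq_self]
  simp only [neg_neg]
  rw [key]
  refine integral_congr_ae (Eventually.of_forall fun x => ?_)
  simp only [hgx, Complex.real_smul, smul_eq_mul, Real.fourierInv_eq_fourier_comp_neg]

open FourierTransform in
/-- The inverse Fourier transform `(2π)^{-1/2} ∫ e^{ixξ} f(ξ) dξ` on `L²`. -/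
noncomputable def invFourierL : L2 →L[ℂ] L2 :=
  (((√(2 * Real.pi))⁻¹ : ℝ) : ℂ) • (compL (2 * Real.pi)⁻¹ 0 ∘L
    ((Lp.fourierTransformₗᵢ ℝ ℂ).symm.toContinuousLinearEquiv : L2 →L[ℂ] L2))

open FourierTransform in
/-- The Fourier transform `(2π)^{-1/2} ∫ e^{-ixξ} f(x) dx` on `L²`. -/
noncomputable def fourierL : L2 →L[ℂ] L2 :=
  ((√(2 * Real.pi) : ℝ) : ℂ) •
    (((Lp.fourierTransformₗᵢ ℝ ℂ).toContinuousLinearEquiv : L2 →L[ℂ] L2) ∘L compL (2 * Real.pi) 0)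

open FourierTransform in
theorem invFourierL_apply (f : L2) :
    invFourierL f = (((√(2 * Real.pi))⁻¹ : ℝ) : ℂ) • compL (2 * Real.pi)⁻¹ 0 (𝓕⁻ f : L2) := rfl

open FourierTransform in
theorem fourierL_apply (f : L2) :
    fourierL f = ((√(2 * Real.pi) : ℝ) : ℂ) • (𝓕 (compL (2 * Real.pi) 0 f) : L2) := rfl

theorem sqrt_two_pi_pos : 0 < √(2 * Real.pi) := by positivity

open FourierTransform in
theorem invFourierL_fourierL (f : L2) : invFourierL (fourierL f) = f := by
  have hp : (2 * Real.pi) ≠ 0 := by positivity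
  rw [invFourierL_apply, fourierL_apply, FourierTransform.fourierInv_smul, fourierInv_fourier_eq, map_smul,
    smul_smul, compL_compL (inv_ne_zero hp) hp, mul_inv_cancel₀ hp, mul_zero, add_zero,
    compL_one_zero, ← Complex.ofReal_mul, inv_mul_cancel₀ sqrt_two_pi_pos.ne', Complex.ofReal_one,
    one_smul]

open FourierTransform in
theorem fourierL_invFourierL (f : L2) : fourierL (invFourierL f) = f := by
  have hp : (2 * Real.pi) ≠ 0 := by positivity
  rw [fourierL_apply, invFourierL_apply, map_smul, compL_compL hp (inv_ne_zero hp),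
    inv_mul_cancel₀ hp, mul_zero, add_zero, compL_one_zero, FourierTransform.fourier_smul,
    fourier_fourierInv_eq, smul_smul, ← Complex.ofReal_mul, mul_inv_cancel₀ sqrt_two_pi_pos.ne',
    Complex.ofReal_one, one_smul]

theorem norm_invFourierL (f : L2) : ‖invFourierL f‖ = ‖f‖ := by
  have hp : 0 < (2 * Real.pi) := by positivity
  rw [invFourierL_apply, norm_smul, norm_compL (inv_ne_zero hp.ne'), inv_inv, abs_of_pos hp,
    Complex.norm_real, Real.norm_eq_abs, abs_of_pos (inv_pos.2 sqrt_two_pi_pos), ← mul_assoc,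
    inv_mul_cancel₀ sqrt_two_pi_pos.ne', one_mul]
  exact (Lp.fourierTransformₗᵢ ℝ ℂ).symm.norm_map f

/-- The inverse Fourier transform as a unitary operator. -/
noncomputable def invFourierIso : L2 ≃ₗᵢ[ℂ] L2 where
  toFun := invFourierL
  map_add' := map_add _
  map_smul' := map_smul _
  invFun := fourierL
  left_inv := fourierL_invFourierL
  right_inv := invFourierL_fourierL
  norm_map' := norm_invFourierL

theorem norm_fourierL (f : L2) : ‖fourierL f‖ = ‖f‖ := invFourierIso.symm.norm_map f

theorem inner_fourierL (f g : L2) : inner ℂ (fourierL f) (fourierL g) = inner ℂ f g :=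
  invFourierIso.symm.inner_map_map f g

theorem inner_invFourierL_left (f g : L2) :
    inner ℂ (invFourierL f) g = inner ℂ f (fourierL g) := by
  rw [← inner_fourierL, fourierL_invFourierL]

/-- The integral defining the inverse Fourier transform. -/
noncomputable def invF (f : ℝ → ℂ) (x : ℝ) : ℂ :=
  (((√(2 * Real.pi))⁻¹ : ℝ) : ℂ) * ∫ ξ : ℝ, Complex.exp (Complex.I * x * ξ) * f ξ

theorem invFourierL_ae (f : L2) (hf : Integrable f) : invFourierL f =ᵐ[volume] invF f := by
  have hp : (2 * Real.pi)⁻¹ ≠ 0 := by positivity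
  rw [invFourierL_apply]
  filter_upwards [Lp.coeFn_smul (((√(2 * Real.pi))⁻¹ : ℝ) : ℂ)
    (compL (2 * Real.pi)⁻¹ 0 (FourierTransformInv.fourierInv f : L2)), compL_ae hp 0 _,
    ae_affine hp 0 (fourierInv_L2_ae f hf)] with x h1 h2 h3
  rw [h1, Pi.smul_apply, h2, h3, invF, Real.fourierInv_eq', smul_eq_mul]
  congr 1
  refine integral_congr_ae (Eventually.of_forall fun ξ => ?_)
  simp only [smul_eq_mul]
  congr 2
  simp only [RCLike.inner_apply, conj_trivial]
  push_cast
  have : (Real.pi : ℂ) ≠ 0 := by exact_mod_cast Real.pi_ne_zero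
  field_simp
  ring

/-- The cutoffs `cutL N f` are integrable and converge to f. Operator identities for the Fourier
transform can therefore be checked on the explicit integrals. -/
theorem clm_ext_integrable {A B : L2 →L[ℂ] L2} (h : ∀ f : L2, Integrable f → A f = B f) (f : L2) :
    A f = B f := by
  refine tendsto_nhds_unique ((A.continuous.tendsto f).comp (tendsto_cutL f)) ?_
  refine ((B.continuous.tendsto f).comp (tendsto_cutL f)).congr fun N => ?_
  exact (h _ (integrable_cutL N f)).symm

theorem invF_congr {f g : ℝ → ℂ} (h : f =ᵐ[volume] g) (x : ℝ) : invF f x = invF g x := by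
  unfold invF
  congr 1
  refine integral_congr_ae ?_
  filter_upwards [h] with ξ hξ
  rw [hξ]

theorem integrable_compL {c : ℝ} (hc : c ≠ 0) (d : ℝ) {f : L2} (hf : Integrable f) :
    Integrable (compL c d f) := by
  refine (integrable_congr (compL_ae hc d f)).2 ?_
  exact (hf.comp_add_right d).comp_mul_left' hc

theorem integrable_reflL {f : L2} (hf : Integrable f) : Integrable (reflL f) :=
  integrable_compL (by norm_num) 0 hf

theorem integrable_mulL {m : ℝ → ℂ} (hm : BddMeas m) {f : L2} (hf : Integrable f) :
    Integrable (mulL m f) := by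
  obtain ⟨C, hC⟩ := hm.bdd
  refine (integrable_congr (mulL_ae hm f)).2 ?_
  exact hf.bdd_mul (c := C) hm.measurable.aestronglyMeasurable (Eventually.of_forall hC)

theorem invF_neg (f : ℝ → ℂ) (x : ℝ) : invF f (-x) = invF (fun ξ => f (-ξ)) x := by
  unfold invF
  congr 1
  rw [← integral_neg_eq_self]
  refine integral_congr_ae (Eventually.of_forall fun ξ => ?_)
  simp only
  congr 2
  push_cast
  ring

theorem invFourierL_reflL (f : L2) : invFourierL (reflL f) = reflL (invFourierL f) := by
  refine clm_ext_integrable (A := invFourierL ∘L reflL) (B := reflL ∘L invFourierL)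
    (fun f hf => Lp.ext ?_) f
  simp only [ContinuousLinearMap.comp_apply]
  filter_upwards [invFourierL_ae _ (integrable_reflL hf), reflL_ae (invFourierL f),
    ae_neg (invFourierL_ae f hf)] with x h1 h2 h3
  rw [h1, h2, h3, invF_neg]
  exact invF_congr (reflL_ae f) x

theorem fourierL_reflL (f : L2) : fourierL (reflL f) = reflL (fourierL f) := by
  conv_lhs => rw [← invFourierL_fourierL f, ← invFourierL_reflL, fourierL_invFourierL]

/-- Translation becomes modulation under the inverse Fourier transform. -/
theorem invFourierL_compL_one (h : ℝ) (f : L2) : invFourierL (compL 1 h f) =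
    mulL (fun x => Complex.exp (Complex.I * (-(h * x) : ℝ))) (invFourierL f) := by
  have hm : BddMeas fun x : ℝ => Complex.exp (Complex.I * (-(h * x) : ℝ)) :=
    BddMeas.exp_I (by fun_prop)
  refine clm_ext_integrable (A := invFourierL ∘L compL 1 h)
    (B := mulL (fun x => Complex.exp (Complex.I * (-(h * x) : ℝ))) ∘L invFourierL)
    (fun f hf => Lp.ext ?_) f
  simp only [ContinuousLinearMap.comp_apply]
  filter_upwards [invFourierL_ae _ (integrable_compL one_ne_zero h hf), mulL_ae hm (invFourierL f),
    invFourierL_ae f hf] with x h1 h2 h3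
  rw [h1, h2, h3, invF_congr (compL_ae one_ne_zero h f) x]
  unfold invF
  rw [mul_left_comm (Complex.exp _)]
  congr 1
  rw [← integral_const_mul, ← integral_add_right_eq_self (fun ξ : ℝ => Complex.exp (Complex.I * (-(h * x) : ℝ)) *
    (Complex.exp (Complex.I * x * ξ) * f ξ)) h]
  refine integral_congr_ae (Eventually.of_forall fun ξ => ?_)
  simp only [one_mul]
  rw [← mul_assoc, ← Complex.exp_add]
  congr 2
  push_cast
  ring

-- Both sides are continuous in f and agree on Schwartz functions. The integral formula for
-- `fourierL` then follows from that for the inverse transform.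
open FourierTransform in
theorem fourier_L2_eq_reflL (f : L2) : (𝓕 f : L2) = reflL (𝓕⁻ f : L2) := by
  refine DenseRange.induction_on (p := fun f : L2 => (𝓕 f : L2) = reflL (𝓕⁻ f : L2))
    (SchwartzMap.denseRange_toLpCLM (E := ℝ) (F := ℂ) (p := 2) (μ := volume) ENNReal.ofNat_ne_top)
    f ?_ ?_
  · exact isClosed_eq (Lp.fourierTransformₗᵢ ℝ ℂ).continuous
      (reflL.continuous.comp (Lp.fourierTransformₗᵢ ℝ ℂ).symm.continuous)
  · intro g
    change 𝓕 (g.toLp 2) = reflL (𝓕⁻ (g.toLp 2))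
    rw [SchwartzMap.toLp_fourier_eq, SchwartzMap.toLp_fourierInv_eq]
    refine Lp.ext ?_
    have h0 : ((𝓕⁻ g).toLp 2 volume : ℝ → ℂ) =ᵐ[volume] (𝓕⁻ g : SchwartzMap ℝ ℂ) := (𝓕⁻ g).coeFn_toLp 2 volume
    filter_upwards [(𝓕 g).coeFn_toLp 2, reflL_ae ((𝓕⁻ g).toLp 2), ae_neg h0] with x h1 h2 h3
    rw [h1, h2, h3, SchwartzMap.fourierInv_coe, Real.fourierInv_eq_fourier_neg, neg_neg,
      SchwartzMap.fourier_coe]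

theorem fourierL_ae (f : L2) (hf : Integrable f) : fourierL f =ᵐ[volume] fun ξ => invF f (-ξ) := by
  have hp0 : 0 < 2 * Real.pi := by positivity
  have hp : 2 * Real.pi ≠ 0 := hp0.ne'
  rw [fourierL_apply, fourier_L2_eq_reflL]
  filter_upwards [Lp.coeFn_smul ((√(2 * Real.pi) : ℝ) : ℂ)
    (reflL (FourierTransformInv.fourierInv (compL (2 * Real.pi) 0 f) : L2)), reflL_ae _,
    ae_neg (fourierInv_L2_ae _ (integrable_compL hp 0 hf))] with x h1 h2 h3
  rw [h1, Pi.smul_apply, h2, h3, invF, Real.fourierInv_eq', smul_eq_mul]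
  have e1 := integral_comp_affine (2 * Real.pi) 0
    fun ξ : ℝ => Complex.exp (Complex.I * (-x : ℝ) * ξ) * f ξ
  rw [abs_of_pos (inv_pos.2 hp0)] at e1
  have e2 : ∫ ξ : ℝ, Complex.exp (Complex.I * (-x : ℝ) * ξ) * f ξ =
      (2 * Real.pi) • ∫ y : ℝ, Complex.exp (Complex.I * (-x : ℝ) * ((2 * Real.pi * y + 0 : ℝ) : ℂ)) *
        f (2 * Real.pi * y + 0) := by
    rw [e1, smul_smul, mul_inv_cancel₀ hp, one_smul]
  rw [e2, Complex.real_smul, ← mul_assoc, ← Complex.ofReal_mul]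
  have e3 : (√(2 * Real.pi))⁻¹ * (2 * Real.pi) = √(2 * Real.pi) := by
    rw [inv_mul_eq_iff_eq_mul₀ sqrt_two_pi_pos.ne', Real.mul_self_sqrt hp0.le]
  rw [e3]
  congr 1
  refine integral_congr_ae ?_
  filter_upwards [compL_ae hp 0 f] with y hy
  rw [hy, smul_eq_mul]
  congr 2
  simp only [RCLike.inner_apply, conj_trivial]
  push_cast
  ring

/-- The Fourier transform is the reflection of its inverse. -/
theorem fourierL_eq_reflL_invFourierL (f : L2) : fourierL f = reflL (invFourierL f) := by
  refine clm_ext_integrable (A := fourierL) (B := reflL ∘L invFourierL) (fun f hf => Lp.ext ?_) f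
  simp only [ContinuousLinearMap.comp_apply]
  filter_upwards [fourierL_ae f hf, reflL_ae (invFourierL f), ae_neg (invFourierL_ae f hf)]
    with x h1 h2 h3
  rw [h1, h2, h3]

/-- Translation becomes modulation under the Fourier transform. -/
theorem fourierL_compL_one (h : ℝ) (f : L2) : fourierL (compL 1 h f) =
    mulL (fun x => Complex.exp (Complex.I * (h * x : ℝ))) (fourierL f) := by
  have hm : BddMeas fun x : ℝ => Complex.exp (Complex.I * (-(h * x) : ℝ)) :=
    BddMeas.exp_I (by fun_prop)
  rw [fourierL_eq_reflL_invFourierL, invFourierL_compL_one, reflL_mulL hm,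
    fourierL_eq_reflL_invFourierL]
  congr 2
  funext x
  simp

/-! ### The distorted Fourier transform as an operator on `L²` -/

/-- The conjugate of the reflection coefficient at positive frequencies, `-q / (q + iξ)`. -/
noncomputable def rho (q ξ : ℝ) : ℂ := -q / (q + Complex.I * ξ)

/-- `rho` restricted to positive frequencies. -/
noncomputable def rhoPos (q : ℝ) : ℝ → ℂ := (Ioi 0).indicator (rho q)

theorem add_I_mul_ne_zero {q : ℝ} (hq : q ≠ 0) (ξ : ℝ) : (q : ℂ) + Complex.I * ξ ≠ 0 := by
  intro h
  have := congrArg Complex.re h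
  simp at this
  exact hq this

theorem abs_le_norm_add_I_mul (q ξ : ℝ) : |q| ≤ ‖(q : ℂ) + Complex.I * ξ‖ := by
  have := Complex.abs_re_le_norm ((q : ℂ) + Complex.I * ξ)
  simpa using this

theorem norm_rho_le (q ξ : ℝ) : ‖rho q ξ‖ ≤ 1 := by
  rw [rho, norm_div, norm_neg, Complex.norm_real, Real.norm_eq_abs]
  exact div_le_one_of_le₀ (abs_le_norm_add_I_mul q ξ) (norm_nonneg _)

theorem bddMeas_rho (q : ℝ) : BddMeas (rho q) :=
  ⟨by unfold rho; fun_prop, 1, norm_rho_le q⟩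

theorem bddMeas_rhoPos (q : ℝ) : BddMeas (rhoPos q) := (bddMeas_rho q).indicator measurableSet_Ioi

theorem conj_rho (q ξ : ℝ) : (starRingEnd ℂ) (rho q ξ) = rho q (-ξ) := by
  simp [rho]

/-- This says that 1 + 2ρ = (iξ - q)/(iξ + q) has modulus one: it is the scattering phase of the
even channel. The case q = 0 is separate because the denominator then vanishes at ξ = 0. -/
theorem rho_add_conj (q ξ : ℝ) :
    (starRingEnd ℂ) (rho q ξ) + rho q ξ + 2 * (rho q ξ * (starRingEnd ℂ) (rho q ξ)) = 0 := by
  rw [conj_rho]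
  by_cases hq : q = 0
  · simp [rho, hq]
  have h1 := add_I_mul_ne_zero hq ξ
  have h2 := add_I_mul_ne_zero hq (-ξ)
  unfold rho
  push_cast at h2 ⊢
  rw [mul_neg, ← sub_eq_add_neg] at h2 ⊢
  field_simp
  ring

/-- Restriction to the negative half-line. -/
noncomputable def halfL : L2 →L[ℂ] L2 := mulL ((Iio 0).indicator fun _ => 1)

theorem bddMeas_half : BddMeas ((Iio 0).indicator fun _ => (1 : ℂ)) :=
  (BddMeas.const 1).indicator measurableSet_Iio

theorem halfL_ae (f : L2) : halfL f =ᵐ[volume] (Iio 0).indicator f := by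
  filter_upwards [mulL_ae bddMeas_half f] with x hx
  rw [halfL, hx]
  by_cases h : x ∈ Iio (0 : ℝ) <;> simp [h]

theorem halfL_halfL (f : L2) : halfL (halfL f) = halfL f := by
  rw [halfL, mulL_mulL bddMeas_half bddMeas_half]
  congr 2
  funext x
  by_cases h : x ∈ Iio (0 : ℝ) <;> simp [h]

theorem inner_halfL_left (f g : L2) : inner ℂ (halfL f) g = inner ℂ f (halfL g) := by
  rw [halfL, inner_mulL bddMeas_half]
  congr 3
  funext x
  by_cases h : x ∈ Iio (0 : ℝ) <;> simp [h]

theorem ae_ne_zero : ∀ᵐ x : ℝ, x ≠ 0 := by simp [ae_iff]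

theorem halfL_reflL_halfL (f : L2) : halfL (reflL (halfL f)) = 0 := by
  refine Lp.ext ?_
  filter_upwards [halfL_ae (reflL (halfL f)), reflL_ae (halfL f), ae_neg (halfL_ae f),
    Lp.coeFn_zero ℂ 2 (volume : Measure ℝ)] with x h1 h2 h3 h4
  rw [h1, h4, Pi.zero_apply]
  by_cases h : x < 0
  · rw [indicator_of_mem (by exact h), h2, h3, indicator_of_notMem]
    simp only [mem_Iio]
    linarith
  · rw [indicator_of_notMem (by exact h)]

/-- `f ↦ f + f(-·)`. -/
noncomputable def evenL : L2 →L[ℂ] L2 := ContinuousLinearMap.id ℂ L2 + reflL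

theorem evenL_apply (f : L2) : evenL f = f + reflL f := rfl

theorem inner_evenL_left (f g : L2) : inner ℂ (evenL f) g = inner ℂ f (evenL g) := by
  rw [evenL_apply, evenL_apply, inner_add_left, inner_add_right, inner_reflL_left]

theorem reflL_evenL (f : L2) : reflL (evenL f) = evenL f := by
  rw [evenL_apply, map_add, reflL_reflL, add_comm]

theorem evenL_halfL_of_reflL_eq {f : L2} (hf : reflL f = f) : evenL (halfL f) = f := by
  refine Lp.ext ?_
  have hf' := reflL_ae f
  rw [hf] at hf'
  filter_upwards [Lp.coeFn_add (halfL f) (reflL (halfL f)), halfL_ae f, reflL_ae (halfL f),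
    ae_neg (halfL_ae f), ae_ne_zero, hf'] with x h1 h2 h3 h4 h5 h6
  rw [evenL_apply, h1, Pi.add_apply, h2, h3, h4]
  rcases lt_or_gt_of_ne h5 with h | h
  · rw [indicator_of_mem (by exact h), indicator_of_notMem (by simp only [mem_Iio]; linarith),
      add_zero]
  · rw [indicator_of_notMem (by simp only [mem_Iio]; linarith),
      indicator_of_mem (by simp only [mem_Iio]; linarith), zero_add, ← h6]

/-- The inverse distorted Fourier transform on `L²`. -/
noncomputable def distInvL (q : ℝ) : L2 →L[ℂ] L2 :=
  invFourierL + evenL ∘L halfL ∘L invFourierL ∘L mulL (rhoPos q) ∘L evenL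

/-- The distorted Fourier transform on `L²`. -/
noncomputable def distL (q : ℝ) : L2 →L[ℂ] L2 :=
  fourierL + evenL ∘L mulL (fun ξ => (starRingEnd ℂ) (rhoPos q ξ)) ∘L fourierL ∘L halfL ∘L evenL

theorem distInvL_apply (q : ℝ) (φ : L2) : distInvL q φ = invFourierL φ +
    evenL (halfL (invFourierL (mulL (rhoPos q) (evenL φ)))) := rfl

theorem distL_apply (q : ℝ) (u : L2) : distL q u = fourierL u +
    evenL (mulL (fun ξ => (starRingEnd ℂ) (rhoPos q ξ)) (fourierL (halfL (evenL u)))) := rfl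

theorem inner_distInvL_left (q : ℝ) (φ u : L2) :
    inner ℂ (distInvL q φ) u = inner ℂ φ (distL q u) := by
  rw [distInvL_apply, distL_apply, inner_add_left, inner_add_right, inner_invFourierL_left,
    inner_evenL_left, inner_halfL_left, inner_invFourierL_left, inner_mulL (bddMeas_rhoPos q),
    inner_evenL_left]

theorem inner_distL_left (q : ℝ) (u φ : L2) :
    inner ℂ (distL q u) φ = inner ℂ u (distInvL q φ) := by
  rw [← inner_conj_symm, ← inner_distInvL_left, inner_conj_symm]

/-! ### The Fourier multiplier `1 / (q - iξ)` -/

/-- The multiplier `1 / (q - iξ)`. -/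
noncomputable def resolventSymbol (q ξ : ℝ) : ℂ := 1 / (q - Complex.I * ξ)

theorem bddMeas_resolventSymbol {q : ℝ} (hq : 0 < q) : BddMeas (resolventSymbol q) := by
  refine ⟨by unfold resolventSymbol; fun_prop, q⁻¹, fun ξ => ?_⟩
  rw [resolventSymbol, norm_div, norm_one, one_div]
  refine inv_anti₀ hq ?_
  have := abs_le_norm_add_I_mul q (-ξ)
  rw [abs_of_pos hq] at this
  simpa [sub_eq_add_neg] using this

theorem resolventSymbol_eq_integral {q : ℝ} (hq : 0 < q) (ξ : ℝ) :
    resolventSymbol q ξ = ∫ s in Ioi (0 : ℝ), Complex.exp ((-q + Complex.I * ξ) * s) := by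
  rw [integral_exp_mul_complex_Ioi (by simpa using hq), resolventSymbol, Complex.ofReal_zero,
    mul_zero, Complex.exp_zero, neg_div, ← div_neg]
  congr 1
  ring

/-- Since 1/(q - iξ) = ∫₀^∞ e^{-qs} e^{iξs} ds and e^{isξ} is translation by s in space, Fubini
turns the multiplier into a one-sided average of translates. Only s > 0 occurs because q > 0. -/
theorem inner_resolventSymbol {q : ℝ} (hq : 0 < q) (a b : L2) :
    inner ℂ (fourierL a) (mulL (resolventSymbol q) (fourierL b)) =
      ∫ s in Ioi (0 : ℝ), ((Real.exp (-q * s) : ℝ) : ℂ) * inner ℂ a (compL 1 s b) := by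
  set H : ℝ → ℂ := fun ξ => fourierL b ξ * (starRingEnd ℂ) (fourierL a ξ) with hH
  have hHi : Integrable H := by
    have := L2.integrable_inner (𝕜 := ℂ) (fourierL a) (fourierL b)
    simpa only [RCLike.inner_apply] using this
  have hexp : Integrable (fun s : ℝ => ((Real.exp (-q * s) : ℝ) : ℂ))
      (volume.restrict (Ioi 0)) := by
    have := integrableOn_exp_mul_Ioi (a := -q) (by linarith) 0
    exact this.ofReal
  have e1 : inner ℂ (fourierL a) (mulL (resolventSymbol q) (fourierL b)) =
      ∫ ξ, ∫ s in Ioi (0 : ℝ), Complex.exp (Complex.I * (s * ξ : ℝ)) *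
        (((Real.exp (-q * s) : ℝ) : ℂ) * H ξ) := by
    rw [L2.inner_def]
    refine integral_congr_ae ?_
    filter_upwards [mulL_ae (bddMeas_resolventSymbol hq) (fourierL b)] with ξ hξ
    rw [RCLike.inner_apply, hξ, resolventSymbol_eq_integral hq, mul_assoc, ← integral_mul_const]
    refine integral_congr_ae (Eventually.of_forall fun s => ?_)
    simp only [hH]
    rw [show (-q + Complex.I * ξ) * s = Complex.I * (s * ξ : ℝ) + (-q * s : ℝ) by push_cast; ring,
      Complex.exp_add, Complex.ofReal_exp]
    ring
  have e2 : ∀ s, ((Real.exp (-q * s) : ℝ) : ℂ) * inner ℂ a (compL 1 s b) =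
      ∫ ξ, Complex.exp (Complex.I * (s * ξ : ℝ)) * (((Real.exp (-q * s) : ℝ) : ℂ) * H ξ) := by
    intro s
    rw [← inner_fourierL, fourierL_compL_one, L2.inner_def, ← integral_const_mul]
    refine integral_congr_ae ?_
    filter_upwards [mulL_ae (BddMeas.exp_I (θ := fun x => s * x) (by fun_prop)) (fourierL b)]
      with ξ hξ
    rw [RCLike.inner_apply, hξ]
    simp only [hH]
    ring
  simp only [e1, e2]
  rw [integral_integral_swap]
  have := (hHi.mul_prod hexp).bdd_mul (c := 1)
    (f := fun z : ℝ × ℝ => Complex.exp (Complex.I * (z.2 * z.1 : ℝ)))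
    (by fun_prop) (Eventually.of_forall fun z => by
      rw [mul_comm, Complex.norm_exp_ofReal_mul_I])
  refine this.congr (Eventually.of_forall fun z => ?_)
  simp only [Function.uncurry]
  ring

theorem conj_rho_eq_resolventSymbol (q ξ : ℝ) :
    (starRingEnd ℂ) (rho q ξ) = -q * resolventSymbol q ξ := by
  rw [conj_rho, rho, resolventSymbol]
  push_cast
  ring

theorem mulL_conj_rho {q : ℝ} (hq : 0 < q) (f : L2) :
    mulL (fun ξ => (starRingEnd ℂ) (rho q ξ)) f = (-q : ℂ) • mulL (resolventSymbol q) f := by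
  simp only [conj_rho_eq_resolventSymbol]
  rw [← mulL_mulL (BddMeas.const _) (bddMeas_resolventSymbol hq), mulL_const]

/-! ### Unitarity of the distorted Fourier transform -/

/-- The multiplier averages the translates g(· + s) with s > 0, which stay supported in the negative
half-line, whereas the reflection of g lives on the positive one. -/
theorem inner_reflL_conj_rho {q : ℝ} (hq : 0 ≤ q) {g : L2} (hg : halfL g = g) :
    inner ℂ (reflL (fourierL g)) (mulL (fun ξ => (starRingEnd ℂ) (rho q ξ)) (fourierL g)) = 0 := by
  rcases hq.eq_or_lt with rfl | hq
  · have : (fun ξ => (starRingEnd ℂ) (rho 0 ξ)) = fun _ => 0 := by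
      funext ξ; simp [rho]
    rw [this, mulL_const, zero_smul, inner_zero_right]
  rw [mulL_conj_rho hq, ← fourierL_reflL, inner_smul_right, inner_resolventSymbol hq,
    setIntegral_eq_zero_of_forall_eq_zero, mul_zero]
  intro s hs
  have hg' := halfL_ae g
  rw [hg] at hg'
  rw [L2.inner_def, integral_eq_zero_of_ae, mul_zero]
  filter_upwards [reflL_ae g, compL_ae one_ne_zero s g, ae_neg hg', ae_affine one_ne_zero s hg']
    with x h1 h2 h3 h4
  rw [RCLike.inner_apply, h1, h2, h3, h4, Pi.zero_apply]
  rw [mem_Ioi] at hs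
  by_cases hx : 0 < x
  · rw [indicator_of_notMem (a := 1 * x + s) (by simp only [mem_Iio]; linarith), zero_mul]
  · rw [indicator_of_notMem (a := -x) (by simp only [mem_Iio]; linarith), map_zero, mul_zero]

/-- With g the restriction of Eu to x < 0, v = Fg and Y = ρ̄₊v, the excess ‖Fu + EY‖² - ‖Fu‖² splits
into diagonal terms, cancelled by the unimodularity of 1 + 2ρ, and terms coupling v with its
reflection, cancelled by the disjoint supports of g and its reflection. -/
theorem norm_distL {q : ℝ} (hq : 0 ≤ q) (u : L2) : ‖distL q u‖ = ‖u‖ := by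
  set e := evenL u with he
  set g := halfL e with hg
  have heg : e = g + reflL g := by
    rw [hg, ← evenL_apply, evenL_halfL_of_reflL_eq]
    rw [he, reflL_evenL]
  set v := fourierL g with hv
  have hm := bddMeas_rhoPos q
  set Y := mulL (fun ξ => (starRingEnd ℂ) (rhoPos q ξ)) v with hY
  have hu : distL q u = fourierL u + evenL Y := distL_apply q u
  have c1 : inner ℂ (fourierL u) (evenL Y) = inner ℂ v Y + inner ℂ (reflL v) Y := by
    rw [← inner_evenL_left, evenL_apply, ← fourierL_reflL, ← map_add, ← evenL_apply, ← he, heg,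
      map_add, inner_add_left, fourierL_reflL]
  have c1' : inner ℂ (evenL Y) (fourierL u) = inner ℂ Y v + inner ℂ Y (reflL v) := by
    rw [← inner_conj_symm, c1, map_add, inner_conj_symm, inner_conj_symm]
  -- Y lives on positive frequencies, so it is orthogonal to its reflection.
  have hYr : inner ℂ (reflL Y) Y = 0 := by
    rw [L2.inner_def]
    refine integral_eq_zero_of_ae ?_
    filter_upwards [reflL_ae Y, mulL_ae hm.conj v, ae_neg (mulL_ae hm.conj v)] with x h1 h2 h3
    rw [RCLike.inner_apply, h1, h2, h3, Pi.zero_apply, rhoPos]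
    by_cases hx : 0 < x
    · rw [indicator_of_notMem (a := -x) (by simp only [mem_Ioi]; linarith)]
      simp
    · rw [indicator_of_notMem (a := x) (by simpa using hx)]
      simp
  have c2 : inner ℂ (evenL Y) (evenL Y) = 2 * inner ℂ Y Y := by
    rw [inner_evenL_left, evenL_apply (evenL Y), reflL_evenL, inner_add_right, evenL_apply,
      inner_add_right, ← inner_reflL_left, hYr]
    ring
  have c3 : inner ℂ v Y + inner ℂ Y v + 2 * inner ℂ Y Y = 0 := by
    rw [hY, inner_mulL hm.conj, inner_mulL hm.conj, mulL_mulL hm.conj.conj hm.conj, two_mul,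
      ← inner_add_right, ← inner_add_right, ← inner_add_right,
      mulL_add_left hm.conj hm.conj.conj, mulL_add_left (hm.conj.conj.mul hm.conj)
      (hm.conj.conj.mul hm.conj), mulL_add_left (hm.conj.add hm.conj.conj)
      ((hm.conj.conj.mul hm.conj).add (hm.conj.conj.mul hm.conj))]
    have : (fun x => (starRingEnd ℂ) (rhoPos q x) +
        (starRingEnd ℂ) ((starRingEnd ℂ) (rhoPos q x)) +
        ((starRingEnd ℂ) ((starRingEnd ℂ) (rhoPos q x)) * (starRingEnd ℂ) (rhoPos q x) +
        (starRingEnd ℂ) ((starRingEnd ℂ) (rhoPos q x)) * (starRingEnd ℂ) (rhoPos q x))) =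
        fun _ => 0 := by
      funext x
      by_cases hx : x ∈ Ioi (0 : ℝ)
      · rw [rhoPos, indicator_of_mem hx, Complex.conj_conj, ← two_mul, rho_add_conj]
      · rw [rhoPos, indicator_of_notMem hx]
        simp
    rw [this, mulL_const, zero_smul, inner_zero_right]
  -- Reflecting the second product turns its multiplier into ρ₊(-ξ), which equals ρ̄(ξ) for ξ < 0.
  -- Together with ρ̄₊ it makes up ρ̄ on the whole line, and `inner_reflL_conj_rho` applies.
  have c4 : inner ℂ (reflL v) Y + inner ℂ Y (reflL v) = 0 := by
    have hneg : BddMeas fun x => rhoPos q (-x) := hm.comp (by fun_prop)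
    rw [hY, inner_mulL hm.conj]
    simp only [Complex.conj_conj]
    have e1 : inner ℂ v (mulL (rhoPos q) (reflL v)) =
        inner ℂ (reflL v) (mulL (fun x => rhoPos q (-x)) v) := by
      conv_rhs => rw [inner_reflL_left, reflL_mulL hneg]
      simp only [neg_neg]
    rw [e1, ← inner_add_right, mulL_add_left hm.conj hneg,
      ← inner_reflL_conj_rho hq (g := g) (by rw [hg, halfL_halfL])]
    congr 1
    refine mulL_congr (hm.conj.add hneg) (bddMeas_rho q).conj ?_ v
    filter_upwards [ae_ne_zero] with x hx
    rcases lt_or_gt_of_ne hx with h | h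
    · rw [rhoPos, indicator_of_notMem (by simp only [mem_Ioi]; linarith),
        indicator_of_mem (by simp only [mem_Ioi]; linarith), map_zero, zero_add, conj_rho]
    · rw [rhoPos, indicator_of_mem (by exact h),
        indicator_of_notMem (by simp only [mem_Ioi]; linarith), add_zero]
  have key : inner ℂ (distL q u) (distL q u) = inner ℂ u u := by
    rw [hu, inner_add_left, inner_add_right, inner_add_right, c1, c1', c2, inner_fourierL]
    linear_combination c3 + c4
  have := congrArg Complex.re key
  rw [← L2_norm_sq, ← L2_norm_sq] at this
  exact (sq_eq_sq₀ (norm_nonneg _) (norm_nonneg _)).1 this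

/-- The adjoint of an isometry is a left inverse of it. -/
theorem distInvL_distL {q : ℝ} (hq : 0 ≤ q) (u : L2) : distInvL q (distL q u) = u := by
  let D : L2 →ₗᵢ[ℂ] L2 := ⟨(distL q).toLinearMap, norm_distL hq⟩
  refine ext_inner_left ℂ fun w => ?_
  rw [← inner_distL_left]
  exact D.inner_map_map w u

/-! ### Triviality of the kernel of the inverse distorted transform -/

theorem memLp_expHalf {q : ℝ} (hq : 0 < q) :
    MemLp ((Iio 0).indicator fun x : ℝ => ((Real.exp (q * x) : ℝ) : ℂ)) 2 := by
  have hmeas : AEStronglyMeasurable ((Iio 0).indicator fun x : ℝ => ((Real.exp (q * x) : ℝ) : ℂ))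
      (volume : Measure ℝ) := by
    refine AEStronglyMeasurable.indicator ?_ measurableSet_Iio
    fun_prop
  rw [memLp_two_iff_integrable_sq_norm hmeas]
  have h := (integrableOn_exp_mul_Iic (a := 2 * q) (by linarith) 0).mono_set
    (Iio_subset_Iic_self)
  rw [← integrable_indicator_iff measurableSet_Iio] at h
  refine h.congr (Eventually.of_forall fun x => ?_)
  by_cases hx : x ∈ Iio (0 : ℝ)
  · simp only [indicator_of_mem hx, Complex.norm_real, Real.norm_eq_abs, Real.abs_exp]
    rw [← Real.exp_nat_mul]
    congr 1
    push_cast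
    ring
  · simp [indicator_of_notMem hx]

/-- The function `e^{qx}` on the negative half-line, as an element of `L²`. -/
noncomputable def expHalf {q : ℝ} (hq : 0 < q) : L2 := (memLp_expHalf hq).toLp

theorem expHalf_ae {q : ℝ} (hq : 0 < q) : expHalf hq =ᵐ[volume]
    (Iio 0).indicator fun x : ℝ => ((Real.exp (q * x) : ℝ) : ℂ) :=
  (memLp_expHalf hq).coeFn_toLp

theorem halfL_expHalf {q : ℝ} (hq : 0 < q) : halfL (expHalf hq) = expHalf hq := by
  refine Lp.ext ?_
  filter_upwards [halfL_ae (expHalf hq), expHalf_ae hq] with x h1 h2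
  rw [h1]
  by_cases hx : x ∈ Iio (0 : ℝ)
  · rw [indicator_of_mem hx]
  · rw [indicator_of_notMem hx, h2, indicator_of_notMem hx]

theorem inner_expHalf_self {q : ℝ} (hq : 0 < q) :
    inner ℂ (expHalf hq) (expHalf hq) = ((2 * q : ℝ) : ℂ)⁻¹ := by
  have e : inner ℂ (expHalf hq) (expHalf hq) =
      ∫ x in Iio (0 : ℝ), ((Real.exp (2 * q * x) : ℝ) : ℂ) := by
    rw [L2.inner_def, ← integral_indicator measurableSet_Iio]
    refine integral_congr_ae ?_
    filter_upwards [expHalf_ae hq] with x hx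
    rw [RCLike.inner_apply, hx]
    by_cases h : x ∈ Iio (0 : ℝ)
    · rw [indicator_of_mem h, indicator_of_mem h, Complex.conj_ofReal, ← Complex.ofReal_mul,
        ← Real.exp_add]
      congr 2
      ring
    · rw [indicator_of_notMem h, indicator_of_notMem h, zero_mul]
  rw [e, ← integral_Iic_eq_integral_Iio, integral_complex_ofReal,
    integral_exp_mul_Iic (by linarith)]
  simp

/-- The bound |V(x+s) z(x)| ≤ |V(x+s)|² + |z(x)|² makes the integral in x bounded uniformly in s,
and e^{-qs} takes care of s. -/
theorem integrable_shift_prod {q : ℝ} (hq : 0 < q) (z V : L2) :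
    Integrable (fun p : ℝ × ℝ => ((Real.exp (-q * p.1) : ℝ) : ℂ) *
      (V (p.2 + p.1) * (starRingEnd ℂ) (z p.2))) ((volume.restrict (Ioi 0)).prod volume) := by
  have hmeas : StronglyMeasurable (fun p : ℝ × ℝ => ((Real.exp (-q * p.1) : ℝ) : ℂ) *
      (V (p.2 + p.1) * (starRingEnd ℂ) (z p.2))) := by
    have h1 : Measurable fun p : ℝ × ℝ => V (p.2 + p.1) :=
      (Lp.stronglyMeasurable V).measurable.comp (by fun_prop)
    have h2 : Measurable fun p : ℝ × ℝ => (starRingEnd ℂ) (z p.2) :=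
      Complex.continuous_conj.measurable.comp
        ((Lp.stronglyMeasurable z).measurable.comp (by fun_prop))
    exact (Measurable.mul (by fun_prop) (h1.mul h2)).stronglyMeasurable
  have hz : Integrable fun x => ‖z x‖ ^ 2 := (Lp.memLp z).norm.integrable_sq
  have hV : Integrable fun x => ‖V x‖ ^ 2 := (Lp.memLp V).norm.integrable_sq
  have hexp := integrableOn_exp_mul_Ioi (a := -q) (by linarith) 0
  have bound : ∀ s x : ℝ, ‖((Real.exp (-q * s) : ℝ) : ℂ) * (V (x + s) * (starRingEnd ℂ) (z x))‖ ≤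
      Real.exp (-q * s) * (‖V (x + s)‖ ^ 2 + ‖z x‖ ^ 2) := by
    intro s x
    rw [norm_mul, norm_mul, Complex.norm_real, Real.norm_eq_abs, Real.abs_exp, RCLike.norm_conj]
    refine mul_le_mul_of_nonneg_left ?_ (Real.exp_pos _).le
    nlinarith [sq_nonneg (‖V (x + s)‖ - ‖z x‖), sq_nonneg (‖V (x + s)‖), sq_nonneg (‖z x‖)]
  have hb : ∀ s : ℝ, Integrable fun x => Real.exp (-q * s) * (‖V (x + s)‖ ^ 2 + ‖z x‖ ^ 2) :=
    fun s => ((hV.comp_add_right s).add hz).const_mul _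
  rw [integrable_prod_iff hmeas.aestronglyMeasurable]
  constructor
  · refine Eventually.of_forall fun s => ?_
    exact (hb s).mono' (hmeas.comp_measurable (by fun_prop : Measurable fun x : ℝ => (s, x))
      ).aestronglyMeasurable (Eventually.of_forall fun x => bound s x)
  · refine (hexp.mul_const ((∫ x, ‖V x‖ ^ 2) + ∫ x, ‖z x‖ ^ 2)).mono'
      hmeas.norm.aestronglyMeasurable.integral_prod_right' (Eventually.of_forall fun s => ?_)
    rw [Real.norm_eq_abs, abs_of_nonneg (integral_nonneg fun x => norm_nonneg _)]
    refine (integral_mono_of_nonneg (Eventually.of_forall fun x => norm_nonneg _) (hb s)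
      (Eventually.of_forall fun x => bound s x)).trans ?_
    rw [integral_const_mul, integral_add (hV.comp_add_right s) hz,
      integral_add_right_eq_self (fun x => ‖V x‖ ^ 2)]

/-- On functions supported in opposite half-lines the operator with kernel
`e^{-q(y-x)} 1_{y>x}` has rank one. -/
theorem integral_exp_mul_inner_compL {q : ℝ} (hq : 0 < q) {z V : L2} (hz : halfL z = z)
    (hV : halfL V = 0) :
    ∫ s in Ioi (0 : ℝ), ((Real.exp (-q * s) : ℝ) : ℂ) * inner ℂ z (compL 1 s V) =
      inner ℂ z (expHalf hq) * inner ℂ (reflL (expHalf hq)) V := by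
  have hz' := halfL_ae z
  rw [hz] at hz'
  have hV' : ∀ᵐ x : ℝ, x < 0 → V x = 0 := by
    have h := halfL_ae V
    rw [hV] at h
    filter_upwards [h, Lp.coeFn_zero ℂ 2 (volume : Measure ℝ)] with x h1 h2 h3
    rw [h2, indicator_of_mem (by exact h3), Pi.zero_apply] at h1
    exact h1.symm
  have e1 : ∀ s, ((Real.exp (-q * s) : ℝ) : ℂ) * inner ℂ z (compL 1 s V) =
      ∫ x, ((Real.exp (-q * s) : ℝ) : ℂ) * (V (x + s) * (starRingEnd ℂ) (z x)) := by
    intro s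
    rw [L2.inner_def, ← integral_const_mul]
    refine integral_congr_ae ?_
    filter_upwards [compL_ae one_ne_zero s V] with x hx
    rw [RCLike.inner_apply, hx, one_mul]
  simp only [e1]
  rw [integral_integral_swap (integrable_shift_prod hq z V)]
  set m := inner ℂ (reflL (expHalf hq)) V with hm
  have hmi : m = ∫ y in Ioi (0 : ℝ), ((Real.exp (-q * y) : ℝ) : ℂ) * V y := by
    rw [hm, L2.inner_def, ← integral_indicator measurableSet_Ioi]
    refine integral_congr_ae ?_
    filter_upwards [reflL_ae (expHalf hq), ae_neg (expHalf_ae hq)] with y h1 h2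
    rw [RCLike.inner_apply, h1, h2]
    by_cases hy : 0 < y
    · rw [indicator_of_mem (by simpa using hy), indicator_of_mem (by exact hy),
        Complex.conj_ofReal, mul_comm, neg_mul, mul_neg]
    · rw [indicator_of_notMem (by simpa using hy), indicator_of_notMem (by exact hy), map_zero,
        mul_zero]
  rw [L2.inner_def, ← integral_mul_const]
  refine integral_congr_ae ?_
  filter_upwards [expHalf_ae hq, hz'] with x h1 h2
  rw [RCLike.inner_apply, h1]
  by_cases hx : x ∈ Iio (0 : ℝ)
  swap
  · rw [h2, indicator_of_notMem hx]
    simp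
  rw [indicator_of_mem hx]
  -- Put y = x + s with x < 0: V vanishes on (x, 0), so the range y > x shrinks to y > 0, which does
  -- not depend on x, and e^{-q(y-x)} factors.
  have e2 : ∫ s in Ioi (0 : ℝ), ((Real.exp (-q * s) : ℝ) : ℂ) * V (x + s) =
      ((Real.exp (q * x) : ℝ) : ℂ) * m := by
    rw [hmi, ← integral_const_mul, ← integral_indicator measurableSet_Ioi,
      ← integral_indicator measurableSet_Ioi, ← integral_add_right_eq_self _ (-x)]
    refine integral_congr_ae ?_
    filter_upwards [hV', ae_ne_zero] with y hy hy0
    rw [mem_Iio] at hx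
    by_cases h : 0 < y
    · rw [indicator_of_mem (by simp only [mem_Ioi]; linarith), indicator_of_mem (by exact h),
        ← mul_assoc, ← Complex.ofReal_mul, ← Real.exp_add]
      congr 2
      · congr 2; ring
      · ring
    · have h' : y < 0 := lt_of_le_of_ne (not_lt.1 h) hy0
      rw [indicator_of_notMem (a := y) (by exact h)]
      by_cases h3 : y + -x ∈ Ioi (0 : ℝ)
      · rw [indicator_of_mem h3, show x + (y + -x) = y by ring, hy h', mul_zero]
      · rw [indicator_of_notMem h3]
  simp only [← mul_assoc]
  rw [integral_mul_const, e2]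
  ring

/-- For φ in the kernel, V = F⁻¹((1 + 2ρ₊)φ) vanishes on x < 0, and its reflection is V plus an
average of translates of V. Between opposite half-lines that average has rank one, so the reflected
V is a multiple of e^{qx} on x < 0, and pairing with e^{qx} forces the multiple to vanish. -/
theorem distInvL_injective {q : ℝ} (hq : 0 ≤ q) {φ : L2} (h : distInvL q φ = 0) : φ = 0 := by
  rw [distInvL_apply] at h
  have hm := bddMeas_rhoPos q
  -- The correction term is even in x, so F⁻¹φ is even as well, and with it φ.
  have hodd : reflL φ = φ := by
    have h1 := congrArg reflL h
    rw [map_zero, map_add, reflL_evenL] at h1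
    have h2 : invFourierL φ = reflL (invFourierL φ) := by
      rw [← h] at h1
      exact (add_right_cancel h1).symm
    rw [← invFourierL_reflL] at h2
    have := congrArg fourierL h2
    rw [fourierL_invFourierL, fourierL_invFourierL] at this
    exact this.symm
  set Φ := φ + (2 : ℂ) • mulL (rhoPos q) φ with hΦ
  set V := invFourierL Φ with hVdef
  have he : evenL φ = (2 : ℂ) • φ := by
    rw [evenL_apply, hodd, two_smul]
  -- Since Eφ = 2φ, the restriction of the equation to x < 0 is that of F⁻¹(φ + 2ρ₊φ); the reflected
  -- half of the correction lives on x > 0.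
  have hV : halfL V = 0 := by
    have h1 := congrArg halfL h
    rw [map_zero, he, map_smul, map_smul, map_smul, evenL_apply, map_add, map_add, map_smul,
      map_smul, map_smul, halfL_halfL, halfL_reflL_halfL, smul_zero, add_zero] at h1
    rw [hVdef, hΦ, map_add, map_add, map_smul, map_smul]
    exact h1
  have hΦm : Φ = mulL (fun x => 1 + 2 * rhoPos q x) φ := by
    rw [hΦ, ← mulL_const, mulL_mulL (BddMeas.const _) hm]
    conv_lhs => rw [← one_smul ℂ φ, ← mulL_const, mulL_mulL ((BddMeas.const _).mul hm) (BddMeas.const _)]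
    rw [mulL_add_left (BddMeas.const _) (((BddMeas.const _).mul hm).mul (BddMeas.const _))]
    simp only [mul_one]
  have hb1 : BddMeas fun x => 1 + 2 * rhoPos q x := (BddMeas.const _).add ((BddMeas.const _).mul hm)
  have hb2 : BddMeas fun x => 1 + 2 * (starRingEnd ℂ) (rho q x) :=
    (BddMeas.const _).add ((BddMeas.const _).mul (bddMeas_rho q).conj)
  -- For ξ < 0 one has Φ = φ, and the reflection of Φ is (1 + 2ρ̄)φ. For ξ > 0 the reflection of Φ
  -- is φ itself, which equals (1 + 2ρ̄)(1 + 2ρ)φ by unimodularity.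
  have hRΦ : reflL Φ = Φ + (2 : ℂ) • mulL (fun x => (starRingEnd ℂ) (rho q x)) Φ := by
    have e1 : reflL Φ = mulL (fun x => 1 + 2 * rhoPos q (-x)) φ := by
      rw [hΦm, reflL_mulL hb1, hodd]
    have e2 : Φ + (2 : ℂ) • mulL (fun x => (starRingEnd ℂ) (rho q x)) Φ =
        mulL (fun x => 1 + 2 * (starRingEnd ℂ) (rho q x)) Φ := by
      refine Lp.ext ?_
      filter_upwards [Lp.coeFn_add Φ ((2 : ℂ) • mulL (fun x => (starRingEnd ℂ) (rho q x)) Φ),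
        Lp.coeFn_smul (2 : ℂ) (mulL (fun x => (starRingEnd ℂ) (rho q x)) Φ),
        mulL_ae (bddMeas_rho q).conj Φ, mulL_ae hb2 Φ] with x h1 h2 h3 h4
      rw [h1, Pi.add_apply, h2, Pi.smul_apply, h3, h4, smul_eq_mul]
      ring
    rw [e1, e2, hΦm, mulL_mulL hb2 hb1]
    refine mulL_congr (hb1.comp (σ := fun x => -x) (by fun_prop)) (hb2.mul hb1) ?_ φ
    filter_upwards [ae_ne_zero] with x hx
    rcases lt_or_gt_of_ne hx with h | h
    · rw [rhoPos, indicator_of_mem (by simp only [mem_Ioi]; linarith),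
        indicator_of_notMem (by simp only [mem_Ioi]; linarith), conj_rho]
      ring
    · rw [rhoPos, indicator_of_notMem (by simp only [mem_Ioi]; linarith),
        indicator_of_mem (by exact h)]
      linear_combination -2 * rho_add_conj q x
  -- Φ coincides with φ on negative frequencies and its reflection does so on positive ones.
  have hΦ0 : Φ = 0 → φ = 0 := by
    intro h0
    have h1 := hRΦ
    have e1 : reflL Φ = mulL (fun x => 1 + 2 * rhoPos q (-x)) φ := by
      rw [hΦm, reflL_mulL hb1, hodd]
    rw [h0, map_zero] at e1
    refine Lp.ext ?_
    have z1 := mulL_ae hb1 φ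
    have z2 := mulL_ae (hb1.comp (σ := fun x => -x) (by fun_prop)) φ
    rw [← hΦm, h0] at z1
    rw [← e1] at z2
    filter_upwards [z1, z2, Lp.coeFn_zero ℂ 2 (volume : Measure ℝ)] with x h1 h2 h3
    rw [h3] at h1 h2 ⊢
    rw [Pi.zero_apply] at h1 h2 ⊢
    by_cases hx : 0 < x
    · rw [rhoPos, indicator_of_notMem (by simp only [mem_Ioi]; linarith)] at h2
      simpa using h2.symm
    · rw [rhoPos, indicator_of_notMem (by exact hx)] at h1
      simpa using h1.symm
  refine hΦ0 ?_
  suffices hV0 : V = 0 by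
    rw [← fourierL_invFourierL Φ, ← hVdef, hV0, map_zero]
  have key : ∀ z, halfL z = z → inner ℂ z (reflL V) =
      2 * inner ℂ z (invFourierL (mulL (fun x => (starRingEnd ℂ) (rho q x)) Φ)) := by
    intro z hz
    rw [hVdef, ← invFourierL_reflL, hRΦ, map_add, map_smul, inner_add_right, inner_smul_right,
      ← hVdef, ← hz, inner_halfL_left, hV, inner_zero_right, zero_add, hz]
  have hRV : halfL (reflL V) = reflL V := by
    refine Lp.ext ?_
    have h := halfL_ae V
    rw [hV] at h
    filter_upwards [halfL_ae (reflL V), reflL_ae V, ae_neg h, ae_ne_zero,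
      ae_neg (Lp.coeFn_zero ℂ 2 (volume : Measure ℝ))] with x h1 h2 h3 h4 h5
    rw [h1]
    by_cases hx : x ∈ Iio (0 : ℝ)
    · rw [indicator_of_mem hx]
    · rw [indicator_of_notMem hx, h2]
      rw [mem_Iio, not_lt] at hx
      have hx' : 0 < x := lt_of_le_of_ne hx h4.symm
      rw [h5, indicator_of_mem (by simp only [mem_Iio]; linarith), Pi.zero_apply] at h3
      exact h3
  suffices hz : ∀ z, halfL z = z → inner ℂ z (reflL V) = 0 by
    have := hz _ hRV
    rw [inner_self_eq_zero] at this
    rw [← reflL_reflL V, this, map_zero]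
  rcases hq.eq_or_lt with rfl | hq
  · intro z hz
    have : (fun ξ => (starRingEnd ℂ) (rho 0 ξ)) = fun _ => 0 := by
      funext ξ; simp [rho]
    rw [key z hz, this, mulL_const, zero_smul, map_zero, inner_zero_right, mul_zero]
  set m := inner ℂ (reflL (expHalf hq)) V with hmdef
  have key2 : ∀ z, halfL z = z → inner ℂ z (reflL V) = -2 * q * (inner ℂ z (expHalf hq) * m) := by
    intro z hz
    rw [key z hz, mulL_conj_rho hq, ← inner_fourierL, fourierL_invFourierL, inner_smul_right,
      ← fourierL_invFourierL Φ, ← hVdef, inner_resolventSymbol hq,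
      integral_exp_mul_inner_compL hq hz hV]
    ring
  -- Taking z = e^{qx} on x < 0, whose squared norm is 1/(2q), gives m = -2q · (1/(2q)) · m = -m.
  have hm0 : m = 0 := by
    have := key2 _ (halfL_expHalf hq)
    rw [← inner_reflL_left, ← hmdef, inner_expHalf_self] at this
    have hq' : (q : ℂ) ≠ 0 := by exact_mod_cast hq.ne'
    push_cast at this
    field_simp at this
    have h2 : (2 : ℂ) * m = 0 := by linear_combination this
    simpa using h2
  intro z hz
  rw [key2 z hz, hm0]
  ring

/-- The left inverse already found is injective, hence a two-sided inverse. -/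
theorem distL_distInvL {q : ℝ} (hq : 0 ≤ q) (φ : L2) : distL q (distInvL q φ) = φ := by
  rw [← sub_eq_zero]
  refine distInvL_injective hq ?_
  rw [map_sub, distInvL_distL hq, sub_self]

theorem norm_distInvL {q : ℝ} (hq : 0 ≤ q) (φ : L2) : ‖distInvL q φ‖ = ‖φ‖ := by
  rw [← norm_distL hq, distL_distInvL hq]

/-! ### Regularity of inverse Fourier integrals -/

theorem norm_exp_I_mul (x ξ : ℝ) : ‖Complex.exp (Complex.I * x * ξ)‖ = 1 := by
  rw [mul_assoc, mul_comm, ← Complex.ofReal_mul, Complex.norm_exp_ofReal_mul_I]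

theorem integrable_exp_mul {f : ℝ → ℂ} (hf : Integrable f) (x : ℝ) :
    Integrable fun ξ : ℝ => Complex.exp (Complex.I * x * ξ) * f ξ :=
  hf.bdd_mul (c := 1) (by fun_prop) (Eventually.of_forall fun ξ => (norm_exp_I_mul x ξ).le)

theorem continuous_invF {f : ℝ → ℂ} (hf : Integrable f) : Continuous (invF f) := by
  unfold invF
  refine continuous_const.mul ?_
  refine continuous_of_dominated (bound := fun ξ => ‖f ξ‖)
    (fun x => (integrable_exp_mul hf x).aestronglyMeasurable) (fun x => ?_) hf.norm ?_
  · refine Eventually.of_forall fun ξ => ?_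
    rw [norm_mul, norm_exp_I_mul, one_mul]
  · exact Eventually.of_forall fun ξ => by fun_prop

/-- Multiplication by `iξ`. -/
noncomputable def mulI (f : ℝ → ℂ) (ξ : ℝ) : ℂ := Complex.I * ξ * f ξ

theorem hasDerivAt_invF {f : ℝ → ℂ} (hf : Integrable f) (hf' : Integrable (mulI f)) (x : ℝ) :
    HasDerivAt (invF f) (invF (mulI f) x) x := by
  have h := hasDerivAt_integral_of_dominated_loc_of_deriv_le
    (F := fun (x : ℝ) (ξ : ℝ) => Complex.exp (Complex.I * x * ξ) * f ξ)
    (F' := fun (x : ℝ) (ξ : ℝ) => Complex.exp (Complex.I * x * ξ) * mulI f ξ)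
    (μ := volume) (x₀ := x) (bound := fun ξ => ‖mulI f ξ‖) univ_mem
    (Eventually.of_forall fun x => (integrable_exp_mul hf x).aestronglyMeasurable)
    (integrable_exp_mul hf x) (integrable_exp_mul hf' x).aestronglyMeasurable
    (Eventually.of_forall fun ξ y _ => by rw [norm_mul, norm_exp_I_mul, one_mul])
    hf'.norm (Eventually.of_forall fun ξ y _ => ?_)
  · exact h.2.const_mul _
  · have h1 : HasDerivAt (fun y : ℝ => Complex.I * y * ξ) (Complex.I * 1 * ξ) y :=
      ((hasDerivAt_id y).ofReal_comp.const_mul _).mul_const _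
    have h2 := h1.cexp.mul_const (f ξ)
    refine h2.congr_deriv ?_
    simp only [mulI]
    ring

theorem contDiff_invF {f : ℝ → ℂ} (hf : ∀ n : ℕ, Integrable (mulI^[n] f)) :
    ContDiff ℝ ∞ (invF f) := by
  have key : ∀ (n : ℕ) (f : ℝ → ℂ), (∀ n : ℕ, Integrable (mulI^[n] f)) →
      ContDiff ℝ n (invF f) := by
    intro n
    induction n with
    | zero => exact fun f hf => contDiff_zero.2 (continuous_invF (hf 0))
    | succ n ih =>
      intro f hf
      have hd := fun x => hasDerivAt_invF (hf 0) (hf 1) x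
      have : ((n + 1 : ℕ) : WithTop ℕ∞) = (n : WithTop ℕ∞) + 1 := by push_cast; rfl
      rw [this, contDiff_succ_iff_deriv]
      refine ⟨fun x => (hd x).differentiableAt, by simp, ?_⟩
      have e : deriv (invF f) = invF (mulI f) := funext fun x => (hd x).deriv
      rw [e]
      exact ih _ fun k => hf (k + 1)
  exact contDiff_infty.2 fun n => key n f hf

/-! ### The distorted Fourier integrals and their derivatives -/

/-- The even superposition of reflected waves. -/
noncomputable def reflE (q : ℝ) (φ : ℝ → ℂ) (ξ : ℝ) : ℂ := rhoPos q ξ * (φ ξ + φ (-ξ))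

/-- The odd superposition of reflected waves. -/
noncomputable def reflO (q : ℝ) (φ : ℝ → ℂ) (ξ : ℝ) : ℂ := rhoPos q ξ * (φ ξ - φ (-ξ))

/-- The inverse distorted Fourier integral. -/
noncomputable def distE (q : ℝ) (φ : ℝ → ℂ) (x : ℝ) : ℂ := invF φ x + invF (reflE q φ) (-|x|)

/-- The derivative of an inverse distorted Fourier integral. -/
noncomputable def distO (q : ℝ) (φ : ℝ → ℂ) (x : ℝ) : ℂ :=
  invF φ x + (if x < 0 then 1 else -1) * invF (reflO q φ) (-|x|)

/-- The factor iξ is odd, so it exchanges the even and odd superpositions. Accordingly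
differentiation in x alternates between `distE` and `distO`. -/
theorem mulI_reflE (q : ℝ) (φ : ℝ → ℂ) : mulI (reflE q φ) = reflO q (mulI φ) := by
  funext ξ
  simp only [mulI, reflE, reflO]
  push_cast
  ring

theorem mulI_reflO (q : ℝ) (φ : ℝ → ℂ) : mulI (reflO q φ) = reflE q (mulI φ) := by
  funext ξ
  simp only [mulI, reflE, reflO]
  push_cast
  ring

theorem integrable_rhoPos_mul (q : ℝ) {f : ℝ → ℂ} (hf : Integrable f) :
    Integrable fun ξ => rhoPos q ξ * f ξ := by
  obtain ⟨C, hC⟩ := (bddMeas_rhoPos q).bdd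
  exact hf.bdd_mul (c := C) (bddMeas_rhoPos q).measurable.aestronglyMeasurable
    (Eventually.of_forall hC)

theorem integrable_reflE (q : ℝ) {φ : ℝ → ℂ} (hφ : Integrable φ) : Integrable (reflE q φ) :=
  integrable_rhoPos_mul q (hφ.add hφ.comp_neg)

theorem integrable_reflO (q : ℝ) {φ : ℝ → ℂ} (hφ : Integrable φ) : Integrable (reflO q φ) :=
  integrable_rhoPos_mul q (hφ.sub hφ.comp_neg)

theorem iterate_mulI_refl (q : ℝ) (n : ℕ) : ∀ φ : ℝ → ℂ, (∀ n : ℕ, Integrable (mulI^[n] φ)) →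
    Integrable (mulI^[n] (reflE q φ)) ∧ Integrable (mulI^[n] (reflO q φ)) := by
  induction n with
  | zero => exact fun φ hφ => ⟨integrable_reflE q (hφ 0), integrable_reflO q (hφ 0)⟩
  | succ n ih =>
    intro φ hφ
    rw [Function.iterate_succ_apply, Function.iterate_succ_apply, mulI_reflE, mulI_reflO]
    exact (ih (mulI φ) fun k => hφ (k + 1)).symm

theorem hasDerivAt_neg_abs {x : ℝ} (hx : x ≠ 0) :
    HasDerivAt (fun y : ℝ => -|y|) (if x < 0 then 1 else -1) x := by
  rcases lt_or_gt_of_ne hx with h | h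
  · rw [if_pos h]
    have h' := (hasDerivAt_abs_neg h).neg
    rw [neg_neg] at h'
    exact h'
  · rw [if_neg (not_lt.2 h.le)]
    exact (hasDerivAt_abs_pos h).neg

theorem hasDerivAt_distE (q : ℝ) {φ : ℝ → ℂ} (hφ : Integrable φ) (hφ' : Integrable (mulI φ))
    {x : ℝ} (hx : x ≠ 0) : HasDerivAt (distE q φ) (distO q (mulI φ) x) x := by
  have h1 := hasDerivAt_invF (integrable_reflE q hφ) (by
    rw [mulI_reflE]; exact integrable_reflO q hφ') (-|x|)
  have h2 := h1.scomp x (hasDerivAt_neg_abs hx)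
  rw [mulI_reflE] at h2
  have h3 := (hasDerivAt_invF hφ hφ' x).add h2
  refine h3.congr_deriv ?_
  unfold distO
  split_ifs <;> simp

theorem hasDerivAt_distO (q : ℝ) {φ : ℝ → ℂ} (hφ : Integrable φ) (hφ' : Integrable (mulI φ))
    {x : ℝ} (hx : x ≠ 0) : HasDerivAt (distO q φ) (distE q (mulI φ) x) x := by
  have h1 := hasDerivAt_invF (integrable_reflO q hφ) (by
    rw [mulI_reflO]; exact integrable_reflE q hφ') (-|x|)
  have h2 := h1.scomp x (hasDerivAt_neg_abs hx)
  rw [mulI_reflO] at h2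
  rcases lt_or_gt_of_ne hx with h | h
  · have h3 := (hasDerivAt_invF hφ hφ' x).add h2
    rw [if_pos h, one_smul] at h3
    refine h3.congr_of_eventuallyEq ?_
    filter_upwards [gt_mem_nhds h] with y hy
    rw [distO, if_pos hy, one_mul]
    rfl
  · have h3 := (hasDerivAt_invF hφ hφ' x).sub h2
    rw [if_neg (not_lt.2 h.le), neg_smul, one_smul, sub_neg_eq_add] at h3
    refine h3.congr_of_eventuallyEq ?_
    filter_upwards [lt_mem_nhds h] with y hy
    rw [distO, if_neg (not_lt.2 (le_of_lt hy)), neg_one_mul, ← sub_eq_add_neg]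
    rfl

theorem continuous_distE (q : ℝ) {φ : ℝ → ℂ} (hφ : Integrable φ) : Continuous (distE q φ) :=
  (continuous_invF hφ).add ((continuous_invF (integrable_reflE q hφ)).comp (by fun_prop))

theorem distO_of_neg (q : ℝ) (φ : ℝ → ℂ) {x : ℝ} (hx : x < 0) :
    distO q φ x = invF φ x + invF (reflO q φ) x := by
  rw [distO, if_pos hx, one_mul, abs_of_neg hx, neg_neg]

theorem distO_of_pos (q : ℝ) (φ : ℝ → ℂ) {x : ℝ} (hx : 0 < x) :
    distO q φ x = invF φ x - invF (reflO q φ) (-x) := by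
  rw [distO, if_neg (not_lt.2 hx.le), neg_one_mul, abs_of_pos hx, ← sub_eq_add_neg]

theorem continuousOn_distO (q : ℝ) {φ : ℝ → ℂ} (hφ : Integrable φ) :
    ContinuousOn (distO q φ) {0}ᶜ := by
  have c1 := continuous_invF hφ
  have c2 := continuous_invF (integrable_reflO q hφ)
  intro x hx
  refine ContinuousAt.continuousWithinAt ?_
  rcases lt_or_gt_of_ne (show x ≠ 0 from hx) with h | h
  · refine (c1.add c2).continuousAt.congr ?_
    filter_upwards [gt_mem_nhds h] with y hy
    exact (distO_of_neg q φ hy).symm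
  · refine (c1.sub (c2.comp continuous_neg)).continuousAt.congr ?_
    filter_upwards [lt_mem_nhds h] with y hy
    exact (distO_of_pos q φ hy).symm

theorem tendsto_distO_pos (q : ℝ) {φ : ℝ → ℂ} (hφ : Integrable φ) :
    Tendsto (distO q φ) (𝓝[>] 0) (𝓝 (invF φ 0 - invF (reflO q φ) 0)) := by
  have c1 := continuous_invF hφ
  have c2 := continuous_invF (integrable_reflO q hφ)
  have h : Tendsto (fun x => invF φ x - invF (reflO q φ) (-x)) (𝓝 0)
      (𝓝 (invF φ 0 - invF (reflO q φ) (-0))) := (c1.sub (c2.comp continuous_neg)).tendsto 0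
  rw [neg_zero] at h
  refine (h.mono_left nhdsWithin_le_nhds).congr' ?_
  filter_upwards [self_mem_nhdsWithin] with x hx
  exact (distO_of_pos q φ hx).symm

theorem tendsto_distO_neg (q : ℝ) {φ : ℝ → ℂ} (hφ : Integrable φ) :
    Tendsto (distO q φ) (𝓝[<] 0) (𝓝 (invF φ 0 + invF (reflO q φ) 0)) := by
  have c1 := continuous_invF hφ
  have c2 := continuous_invF (integrable_reflO q hφ)
  have h : Tendsto (fun x => invF φ x + invF (reflO q φ) x) (𝓝 0)
      (𝓝 (invF φ 0 + invF (reflO q φ) 0)) := (c1.add c2).tendsto 0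
  refine (h.mono_left nhdsWithin_le_nhds).congr' ?_
  filter_upwards [self_mem_nhdsWithin] with x hx
  exact (distO_of_neg q φ hx).symm

/-- The jump condition at the origin. -/
theorem jump_distE (q : ℝ) {φ : ℝ → ℂ} (hφ : Integrable φ) :
    (invF (mulI φ) 0 - invF (reflO q (mulI φ)) 0) - (invF (mulI φ) 0 + invF (reflO q (mulI φ)) 0) =
      2 * (q : ℂ) * distE q φ 0 := by
  have e0 : ∀ f : ℝ → ℂ, invF f 0 = (((√(2 * Real.pi))⁻¹ : ℝ) : ℂ) * ∫ ξ, f ξ := fun f => by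
    simp [invF]
  rw [distE, abs_zero, neg_zero, e0, e0, e0, e0]
  -- After folding the integral of φ onto ξ > 0, the identity holds pointwise: it is iξρ = -q(1 +
  -- ρ), another form of ρ(q + iξ) = -q.
  have key : ∫ ξ, reflO q (mulI φ) ξ = -q * ((∫ ξ, φ ξ) + ∫ ξ, reflE q φ ξ) := by
    have h1 : ∫ ξ, φ ξ = ∫ ξ, (Ioi (0 : ℝ)).indicator (fun ξ => φ ξ + φ (-ξ)) ξ := by
      rw [integral_indicator measurableSet_Ioi, integral_add hφ.integrableOn
        hφ.comp_neg.integrableOn, integral_comp_neg_Ioi, neg_zero, add_comm,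
        intervalIntegral.integral_Iic_add_Ioi hφ.integrableOn hφ.integrableOn]
    have hi : Integrable ((Ioi (0 : ℝ)).indicator (fun ξ => φ ξ + φ (-ξ))) :=
      (hφ.add hφ.comp_neg).indicator measurableSet_Ioi
    rw [h1, ← integral_add hi (integrable_reflE q hφ), ← integral_const_mul]
    refine integral_congr_ae (Eventually.of_forall fun ξ => ?_)
    simp only [reflO, reflE, mulI, rhoPos]
    by_cases hξ : ξ ∈ Ioi (0 : ℝ)
    · simp only [indicator_of_mem hξ]
      have hne : (q : ℂ) + Complex.I * ξ ≠ 0 := by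
        intro h
        have := congrArg Complex.im h
        simp at this
        exact (ne_of_gt hξ) this
      rw [rho]
      push_cast
      field_simp
      ring
    · simp only [indicator_of_notMem hξ]
      ring
  rw [key]
  ring

/-! ### Weak derivatives of distorted Fourier transforms -/

/-- `f ↦ f - f(-·)`. -/
noncomputable def oddL : L2 →L[ℂ] L2 := ContinuousLinearMap.id ℂ L2 - reflL

theorem oddL_apply (f : L2) : oddL f = f - reflL f := rfl

/-- The derivative of the inverse distorted Fourier transform, as a function of `iξ φ`. -/
noncomputable def distInvOddL (q : ℝ) : L2 →L[ℂ] L2 :=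
  invFourierL + oddL ∘L halfL ∘L invFourierL ∘L mulL (rhoPos q) ∘L oddL

theorem distInvOddL_apply (q : ℝ) (φ : L2) : distInvOddL q φ = invFourierL φ +
    oddL (halfL (invFourierL (mulL (rhoPos q) (oddL φ)))) := rfl

theorem distInvL_ae (q : ℝ) {φ : L2} (hφ : Integrable φ) :
    distInvL q φ =ᵐ[volume] distE q φ := by
  set a := mulL (rhoPos q) (evenL φ) with ha
  have hai : Integrable a := by
    refine integrable_mulL (bddMeas_rhoPos q) ?_
    exact (integrable_congr (Lp.coeFn_add _ _)).2 (hφ.add (integrable_reflL hφ))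
  have hae : a =ᵐ[volume] reflE q φ := by
    filter_upwards [mulL_ae (bddMeas_rhoPos q) (evenL φ), Lp.coeFn_add φ (reflL φ), reflL_ae φ]
      with ξ h1 h2 h3
    rw [ha, h1, evenL_apply, h2, Pi.add_apply, h3, reflE]
  have hinv := invFourierL_ae a hai
  filter_upwards [Lp.coeFn_add (invFourierL φ) (evenL (halfL (invFourierL a))),
    invFourierL_ae φ hφ, Lp.coeFn_add (halfL (invFourierL a)) (reflL (halfL (invFourierL a))),
    halfL_ae (invFourierL a), reflL_ae (halfL (invFourierL a)), ae_neg (halfL_ae (invFourierL a)),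
    hinv, ae_neg hinv, ae_ne_zero] with x h1 h2 h3 h4 h5 h6 h7 h8 h9
  rw [distInvL_apply, h1, Pi.add_apply, h2, evenL_apply, h3, Pi.add_apply, h4, h5, h6, distE,
    ← invF_congr hae]
  congr 1
  rcases lt_or_gt_of_ne h9 with h | h
  · rw [indicator_of_mem (by exact h), indicator_of_notMem (by simp only [mem_Iio]; linarith),
      add_zero, h7, abs_of_neg h, neg_neg]
  · rw [indicator_of_notMem (by simp only [mem_Iio]; linarith),
      indicator_of_mem (by simp only [mem_Iio]; linarith), zero_add, h8, abs_of_pos h]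

theorem distInvOddL_ae (q : ℝ) {φ : L2} (hφ : Integrable φ) :
    distInvOddL q φ =ᵐ[volume] distO q φ := by
  set a := mulL (rhoPos q) (oddL φ) with ha
  have hai : Integrable a := by
    refine integrable_mulL (bddMeas_rhoPos q) ?_
    exact (integrable_congr (Lp.coeFn_sub _ _)).2 (hφ.sub (integrable_reflL hφ))
  have hae : a =ᵐ[volume] reflO q φ := by
    filter_upwards [mulL_ae (bddMeas_rhoPos q) (oddL φ), Lp.coeFn_sub φ (reflL φ), reflL_ae φ]
      with ξ h1 h2 h3
    rw [ha, h1, oddL_apply, h2, Pi.sub_apply, h3, reflO]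
  have hinv := invFourierL_ae a hai
  filter_upwards [Lp.coeFn_add (invFourierL φ) (oddL (halfL (invFourierL a))),
    invFourierL_ae φ hφ, Lp.coeFn_sub (halfL (invFourierL a)) (reflL (halfL (invFourierL a))),
    halfL_ae (invFourierL a), reflL_ae (halfL (invFourierL a)), ae_neg (halfL_ae (invFourierL a)),
    hinv, ae_neg hinv, ae_ne_zero] with x h1 h2 h3 h4 h5 h6 h7 h8 h9
  rw [distInvOddL_apply, h1, Pi.add_apply, h2, oddL_apply, h3, Pi.sub_apply, h4, h5, h6]
  rcases lt_or_gt_of_ne h9 with h | h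
  · rw [indicator_of_mem (by exact h), indicator_of_notMem (by simp only [mem_Iio]; linarith),
      sub_zero, h7, distO_of_neg q _ h, ← invF_congr hae]
  · rw [indicator_of_notMem (by simp only [mem_Iio]; linarith),
      indicator_of_mem (by simp only [mem_Iio]; linarith), zero_sub, h8, distO_of_pos q _ h,
      ← invF_congr hae, sub_eq_add_neg]

theorem distE_congr (q : ℝ) {φ ψ : ℝ → ℂ} (h : φ =ᵐ[volume] ψ) (x : ℝ) :
    distE q φ x = distE q ψ x := by
  rw [distE, distE, invF_congr h, invF_congr (f := reflE q φ) (g := reflE q ψ)]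
  filter_upwards [h, ae_neg h] with ξ h1 h2
  rw [reflE, reflE, h1, h2]

theorem distO_congr (q : ℝ) {φ ψ : ℝ → ℂ} (h : φ =ᵐ[volume] ψ) (x : ℝ) :
    distO q φ x = distO q ψ x := by
  rw [distO, distO, invF_congr h, invF_congr (f := reflO q φ) (g := reflO q ψ)]
  filter_upwards [h, ae_neg h] with ξ h1 h2
  rw [reflO, reflO, h1, h2]

theorem locallyIntegrable_distInvOddL (q : ℝ) {φ : L2} (hφ : Integrable φ) :
    LocallyIntegrable (distO q φ) := fun x =>
  (L2_locallyIntegrable (distInvOddL q φ) x).congr (distInvOddL_ae q hφ)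

theorem cutL_mulI {φ φ' : L2} (h : φ' =ᵐ[volume] mulI φ) (N : ℝ) :
    cutL N φ' =ᵐ[volume] mulI (cutL N φ) := by
  filter_upwards [cutL_ae N φ, cutL_ae N φ', h] with ξ h1 h2 h3
  rw [h2, mulI, h1]
  by_cases hξ : ξ ∈ Icc (-N) N
  · rw [indicator_of_mem hξ, indicator_of_mem hξ, h3, mulI]
  · rw [indicator_of_notMem hξ, indicator_of_notMem hξ, mul_zero]

/-- For φ truncated to bounded frequencies the derivative is classical away from the origin, and the
function is continuous there. Weak differentiation is closed in L², so the truncation can be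
removed. -/
theorem hasWeakDerivOn_distInvL (q : ℝ) {φ φ' : L2} (h : φ' =ᵐ[volume] mulI φ) :
    HasWeakDerivOn univ (distInvL q φ) (distInvOddL q φ') := by
  refine hasWeakDerivOn_of_tendsto (l := atTop) (f := fun N : ℝ => distInvL q (cutL N φ))
    (g := fun N : ℝ => distInvOddL q (cutL N φ'))
    (((distInvL q).continuous.tendsto φ).comp (tendsto_cutL φ))
    (((distInvOddL q).continuous.tendsto φ').comp (tendsto_cutL φ')) fun N => ?_
  have i1 := integrable_cutL N φ
  have i2 := integrable_cutL N φ'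
  have hc := cutL_mulI h N
  have i3 : Integrable (mulI (cutL N φ)) := (integrable_congr hc).1 i2
  refine HasWeakDerivOn.congr_ae (f := distE q (cutL N φ)) (g := distO q (cutL N φ')) ?_
    (distInvL_ae q i1).symm (distInvOddL_ae q i2).symm
  refine hasWeakDerivOn_of_hasDerivAt isOpen_univ (continuous_distE q i1).continuousOn
    (fun x _ hx => ?_) ((locallyIntegrable_distInvOddL q i2).locallyIntegrableOn _)
  rw [distO_congr q hc]
  exact hasDerivAt_distE q i1 i3 hx

theorem hasWeakDerivOn_distInvOddL (q : ℝ) {φ φ' : L2} (h : φ' =ᵐ[volume] mulI φ) :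
    HasWeakDerivOn {0}ᶜ (distInvOddL q φ) (distInvL q φ') := by
  refine hasWeakDerivOn_of_tendsto (l := atTop) (f := fun N : ℝ => distInvOddL q (cutL N φ))
    (g := fun N : ℝ => distInvL q (cutL N φ'))
    (((distInvOddL q).continuous.tendsto φ).comp (tendsto_cutL φ))
    (((distInvL q).continuous.tendsto φ').comp (tendsto_cutL φ')) fun N => ?_
  have i1 := integrable_cutL N φ
  have i2 := integrable_cutL N φ'
  have hc := cutL_mulI h N
  have i3 : Integrable (mulI (cutL N φ)) := (integrable_congr hc).1 i2
  refine HasWeakDerivOn.congr_ae (f := distO q (cutL N φ)) (g := distE q (cutL N φ')) ?_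
    (distInvOddL_ae q i1).symm (distInvL_ae q i2).symm
  refine hasWeakDerivOn_of_hasDerivAt isOpen_compl_singleton (continuousOn_distO q i1)
    (fun x _ hx => ?_) ((continuous_distE q i2).locallyIntegrable.locallyIntegrableOn _)
  rw [distE_congr q hc]
  exact hasDerivAt_distO q i1 i3 hx

/-! ### The domain of the Hamiltonian in the distorted Fourier representation -/

theorem memLp_inv_sqrt : MemLp (fun ξ : ℝ => (√(1 + ξ ^ 2))⁻¹) 2 := by
  rw [memLp_two_iff_integrable_sq (by fun_prop)]
  refine integrable_inv_one_add_sq.congr (Eventually.of_forall fun ξ => ?_)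
  simp only
  rw [inv_pow, Real.sq_sqrt (by positivity)]

/-- Here (1 + ξ²)φ is square integrable, and so is (1 + ξ²)^{-1/2}. Their product dominates both φ
and ξφ, which are therefore integrable. -/
theorem integrable_of_sq_mul {φ : L2} {χ : L2}
    (h : χ =ᵐ[volume] fun ξ => ((ξ ^ 2 / 2 : ℝ) : ℂ) * φ ξ) :
    Integrable φ ∧ Integrable (mulI φ) ∧ MemLp (mulI φ) 2 := by
  have hb : MemLp (fun ξ => ‖φ ξ‖ + 2 * ‖χ ξ‖) 2 :=
    (Lp.memLp φ).norm.add ((Lp.memLp χ).norm.const_mul 2)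
  have hb' : Integrable fun ξ : ℝ => (√(1 + ξ ^ 2))⁻¹ * (‖φ ξ‖ + 2 * ‖χ ξ‖) :=
    memLp_inv_sqrt.integrable_mul hb
  have hm : AEStronglyMeasurable (mulI φ) volume := by
    unfold mulI
    exact (Continuous.aestronglyMeasurable (by fun_prop)).mul (Lp.aestronglyMeasurable φ)
  have hn : ∀ ξ, ‖mulI φ ξ‖ = |ξ| * ‖φ ξ‖ := fun ξ => by
    rw [mulI, norm_mul, norm_mul, Complex.norm_I, one_mul, Complex.norm_real, Real.norm_eq_abs]
  have key : ∀ᵐ ξ, ‖φ ξ‖ + 2 * ‖χ ξ‖ = √(1 + ξ ^ 2) * (√(1 + ξ ^ 2) * ‖φ ξ‖) := by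
    filter_upwards [h] with ξ hξ
    rw [hξ, norm_mul, Complex.norm_real, Real.norm_eq_abs, abs_of_nonneg (by positivity),
      ← mul_assoc √(1 + ξ ^ 2), Real.mul_self_sqrt (by positivity)]
    ring
  have hs : ∀ ξ : ℝ, 0 < √(1 + ξ ^ 2) := fun ξ => by positivity
  have h1 : ∀ ξ : ℝ, 1 ≤ √(1 + ξ ^ 2) := fun ξ => by
    rw [Real.one_le_sqrt]; nlinarith [sq_nonneg ξ]
  have h2 : ∀ ξ : ℝ, |ξ| ≤ √(1 + ξ ^ 2) := fun ξ => Real.abs_le_sqrt (by linarith)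
  refine ⟨hb'.mono' (Lp.aestronglyMeasurable φ) ?_, hb'.mono' hm ?_, hb.of_le hm ?_⟩
  · filter_upwards [key] with ξ hξ
    rw [hξ, inv_mul_cancel_left₀ (hs ξ).ne']
    exact le_mul_of_one_le_left (norm_nonneg _) (h1 ξ)
  · filter_upwards [key] with ξ hξ
    rw [hξ, inv_mul_cancel_left₀ (hs ξ).ne', hn]
    exact mul_le_mul_of_nonneg_right (h2 ξ) (norm_nonneg _)
  · filter_upwards [key] with ξ hξ
    rw [hξ, hn, Real.norm_of_nonneg (by positivity)]
    refine (mul_le_mul_of_nonneg_right (h2 ξ) (norm_nonneg _)).trans ?_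
    exact le_mul_of_one_le_left (by positivity) (h1 ξ)

/-- Two derivatives multiply the profile by (iξ)² = -ξ², so the second derivative of `distInvL q φ`
away from the origin has profile -2χ. Integrability of φ and ξφ supplies the continuous
representatives needed in the jump condition. -/
theorem distInvL_mem_hamiltonianGraph (q : ℝ) {φ χ : L2}
    (h : χ =ᵐ[volume] fun ξ => ((ξ ^ 2 / 2 : ℝ) : ℂ) * φ ξ) :
    (distInvL q φ, distInvL q χ) ∈ hamiltonianGraph q := by
  obtain ⟨i0, i1, i2⟩ := integrable_of_sq_mul h
  set φ₁ := i2.toLp with hφ₁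
  have e1 : φ₁ =ᵐ[volume] mulI φ := i2.coeFn_toLp
  have j1 : Integrable φ₁ := (integrable_congr e1).2 i1
  have e2 : ((-2 : ℂ) • χ : L2) =ᵐ[volume] mulI φ₁ := by
    filter_upwards [Lp.coeFn_smul (-2 : ℂ) χ, h, e1] with ξ h1 h2 h3
    rw [h1, Pi.smul_apply, h2, mulI, h3, mulI, smul_eq_mul]
    push_cast
    linear_combination (-(ξ : ℂ) ^ 2 * φ ξ) * Complex.I_sq
  refine ⟨distInvOddL q φ₁, distInvL q ((-2 : ℂ) • χ), ⟨hasWeakDerivOn_distInvL q e1,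
    hasWeakDerivOn_distInvOddL q e2, distE q φ, distO q φ₁, distInvL_ae q i0,
    continuous_distE q i0, distInvOddL_ae q j1, continuousOn_distO q j1, _, _,
    tendsto_distO_pos q j1, tendsto_distO_neg q j1, ?_⟩, ?_⟩
  · have e3 : reflO q φ₁ =ᵐ[volume] reflO q (mulI φ) := by
      filter_upwards [e1, ae_neg e1] with ξ h1 h2
      rw [reflO, reflO, h1, h2]
    rw [invF_congr e1, invF_congr e3]
    exact jump_distE q i0
  · rw [map_smul, smul_smul]
    norm_num

theorem HasWeakDerivOn.mono {Ω Ω' : Set ℝ} {f g : ℝ → ℂ} (h : HasWeakDerivOn Ω f g)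
    (hs : Ω' ⊆ Ω) : HasWeakDerivOn Ω' f g :=
  ⟨h.1.mono_set hs, h.2.1.mono_set hs, fun η h1 h2 h3 => h.2.2 η h1 h2 (h3.trans hs)⟩

theorem eq_zero_of_tendsto_atTop_of_integrable {Z : ℝ → ℂ} (hZ : Integrable Z) {L : ℂ}
    (h : Tendsto Z atTop (𝓝 L)) : L = 0 := by
  refine IntegrableAtFilter.eq_zero_of_tendsto (hZ.integrableAtFilter atTop) (fun s hs => ?_) h
  obtain ⟨a, ha⟩ := mem_atTop_sets.1 hs
  have : volume (Ici a) ≤ volume s := measure_mono fun x hx => ha x hx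
  rw [Real.volume_Ici, top_le_iff] at this
  exact this

theorem eq_zero_of_tendsto_atBot_of_integrable {Z : ℝ → ℂ} (hZ : Integrable Z) {L : ℂ}
    (h : Tendsto Z atBot (𝓝 L)) : L = 0 := by
  refine eq_zero_of_tendsto_atTop_of_integrable hZ.comp_neg ?_
  exact h.comp tendsto_neg_atTop_atBot

/-- The integral of the derivative of an integrable function with a jump at the origin. -/
theorem HasWeakDerivOn.integral_eq_of_jump {Z Z' : ℝ → ℂ} (h : HasWeakDerivOn {0}ᶜ Z Z')
    (hc : ContinuousOn Z {0}ᶜ) (hZ : Integrable Z) (hZ' : Integrable Z') {Zp Zm : ℂ}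
    (hp : Tendsto Z (𝓝[>] 0) (𝓝 Zp)) (hm : Tendsto Z (𝓝[<] 0) (𝓝 Zm)) :
    ∫ x, Z' x = Zm - Zp := by
  have ii : ∀ a b, IntervalIntegrable Z' volume a b := fun a b => hZ'.intervalIntegrable
  have cont : ∀ c : ℝ, Continuous fun a => ∫ x in a..c, Z' x := fun c =>
    intervalIntegral.continuous_primitive ii c |>.neg.congr fun a => by
      rw [intervalIntegral.integral_symm]
      simp
  have cont' : ∀ c : ℝ, Continuous fun b => ∫ x in c..b, Z' x := fun c =>
    intervalIntegral.continuous_primitive ii c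
  have right : ∀ b : ℝ, 0 < b → ∫ x in (0 : ℝ)..b, Z' x = Z b - Zp := by
    intro b hb
    refine tendsto_nhds_unique
      (((cont b).tendsto 0).mono_left (nhdsWithin_le_nhds (s := Ioi 0))) ?_
    refine (tendsto_const_nhds.sub hp).congr' ?_
    filter_upwards [self_mem_nhdsWithin, (gt_mem_nhds hb).filter_mono nhdsWithin_le_nhds]
      with a ha hab
    rw [mem_Ioi] at ha
    exact (h.integral_eq_sub hc hab.le fun x hx => (lt_of_lt_of_le ha hx.1).ne').symm
  have left : ∀ a : ℝ, a < 0 → ∫ x in a..(0 : ℝ), Z' x = Zm - Z a := by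
    intro a ha
    refine tendsto_nhds_unique
      (((cont' a).tendsto 0).mono_left (nhdsWithin_le_nhds (s := Iio 0))) ?_
    refine (hm.sub tendsto_const_nhds).congr' ?_
    filter_upwards [self_mem_nhdsWithin, (lt_mem_nhds ha).filter_mono nhdsWithin_le_nhds]
      with b hb hab
    rw [mem_Iio] at hb
    exact (h.integral_eq_sub hc hab.le fun x hx => (lt_of_le_of_lt hx.2 hb).ne).symm
  have r2 := intervalIntegral_tendsto_integral_Ioi 0 hZ'.integrableOn tendsto_id
  have l2 := intervalIntegral_tendsto_integral_Iic 0 hZ'.integrableOn tendsto_id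
  -- Z has limits at ±∞ because its derivative is integrable, and since Z is itself integrable these
  -- limits are 0.
  have r3 : Tendsto Z atTop (𝓝 ((∫ x in Ioi 0, Z' x) + Zp)) := by
    refine (r2.add_const Zp).congr' ?_
    filter_upwards [eventually_gt_atTop 0] with b hb
    rw [id, right b hb, sub_add_cancel]
  have l3 : Tendsto Z atBot (𝓝 (Zm - ∫ x in Iic 0, Z' x)) := by
    refine (l2.const_sub Zm).congr' ?_
    filter_upwards [eventually_lt_atBot 0] with a ha
    rw [id, left a ha, sub_sub_cancel]
  have r4 := eq_zero_of_tendsto_atTop_of_integrable hZ r3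
  have l4 := eq_zero_of_tendsto_atBot_of_integrable hZ l3
  rw [← intervalIntegral.integral_Iic_add_Ioi hZ'.integrableOn hZ'.integrableOn]
  linear_combination r4 - l4

theorem integrable_iterate_mulI_of_bounded_support {φ : ℝ → ℂ} (hφ : Integrable φ) {N : ℝ}
    (h0 : ∀ᵐ ξ, ξ ∉ Icc (-N) N → φ ξ = 0) (n : ℕ) : Integrable (mulI^[n] φ) := by
  induction n generalizing φ with
  | zero => exact hφ
  | succ n ih =>
    rw [Function.iterate_succ_apply]
    refine ih ?_ (h0.mono fun ξ hξ h' => by rw [mulI, hξ h', mul_zero])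
    have hm : AEStronglyMeasurable (mulI φ) volume := by
      unfold mulI
      exact (Continuous.aestronglyMeasurable (by fun_prop)).mul hφ.1
    refine (hφ.norm.const_mul N).mono' hm ?_
    filter_upwards [h0] with ξ hξ
    by_cases h : ξ ∈ Icc (-N) N
    · rw [mulI, norm_mul, norm_mul, Complex.norm_I, one_mul, Complex.norm_real, Real.norm_eq_abs]
      exact mul_le_mul_of_nonneg_right (abs_le.2 h) (norm_nonneg _)
    · rw [mulI, hξ h]; simp

theorem contDiffOn_comp_neg_abs {f : ℝ → ℂ} (hf : ContDiff ℝ ∞ f) :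
    ContDiffOn ℝ ∞ (fun x => f (-|x|)) {0}ᶜ := by
  intro x hx
  exact (hf.contDiffAt.comp x (contDiffAt_abs hx).neg).contDiffWithinAt

theorem contDiffOn_distE (q : ℝ) {φ : ℝ → ℂ} (hφ : ∀ n : ℕ, Integrable (mulI^[n] φ)) :
    ContDiffOn ℝ ∞ (distE q φ) {0}ᶜ :=
  (contDiff_invF hφ).contDiffOn.add
    (contDiffOn_comp_neg_abs (contDiff_invF fun n => (iterate_mulI_refl q n φ hφ).1))

theorem contDiffOn_distO (q : ℝ) {φ : ℝ → ℂ} (hφ : ∀ n : ℕ, Integrable (mulI^[n] φ)) :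
    ContDiffOn ℝ ∞ (distO q φ) {0}ᶜ := by
  have h1 : ContDiff ℝ ∞ (invF φ) := contDiff_invF hφ
  have h2 : ContDiff ℝ ∞ (invF (reflO q φ)) :=
    contDiff_invF fun n => (iterate_mulI_refl q n φ hφ).2
  intro x hx
  refine ContDiffAt.contDiffWithinAt ?_
  rcases lt_or_gt_of_ne (show x ≠ 0 from hx) with h | h
  · refine (h1.add h2).contDiffAt.congr_of_eventuallyEq ?_
    filter_upwards [gt_mem_nhds h] with y hy
    exact distO_of_neg q φ hy
  · refine (h1.sub (h2.comp contDiff_neg)).contDiffAt.congr_of_eventuallyEq ?_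
    filter_upwards [lt_mem_nhds h] with y hy
    exact distO_of_pos q φ hy

/-- `H_q` is symmetric against distorted wave packets of bounded frequency. -/
theorem inner_distInvL_of_inDomain {q : ℝ} {u u₁ u₂ : L2} (hu : InDomain q u u₁ u₂)
    {ψ ψ₂ : L2} {N : ℝ} (h0 : ∀ᵐ ξ, ξ ∉ Icc (-N) N → ψ ξ = 0) (hψ : Integrable ψ)
    (h2 : ψ₂ =ᵐ[volume] mulI (mulI ψ)) :
    inner ℂ (distInvL q ψ) u₂ = inner ℂ (distInvL q ψ₂) u := by
  obtain ⟨d1, d2, f, g, hf, hfc, hg, hgc, dp, dm, hdp, hdm, hjump⟩ := hu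
  have hit := integrable_iterate_mulI_of_bounded_support hψ h0
  have hψ1 : Integrable (mulI ψ) := hit 1
  have hψ2 : Integrable (mulI (mulI ψ)) := hit 2
  have hψ₂ : Integrable ψ₂ := (integrable_congr h2).2 hψ2
  have m1 : MemLp (mulI ψ) 2 := by
    have hm : AEStronglyMeasurable (mulI ψ) volume := hψ1.1
    refine (Lp.memLp ψ).of_le_mul (c := N) hm ?_
    filter_upwards [h0] with ξ hξ
    by_cases h : ξ ∈ Icc (-N) N
    · rw [mulI, norm_mul, norm_mul, Complex.norm_I, one_mul, Complex.norm_real, Real.norm_eq_abs]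
      exact mul_le_mul_of_nonneg_right (abs_le.2 h) (norm_nonneg _)
    · rw [mulI, hξ h]; simp
  have e1 : m1.toLp =ᵐ[volume] mulI ψ := m1.coeFn_toLp
  have j1 : Integrable m1.toLp := (integrable_congr e1).2 hψ1
  set w := distE q ψ with hw
  set w1 := distO q (mulI ψ) with hw1
  set w2 := distE q (mulI (mulI ψ)) with hw2
  have aw : distInvL q ψ =ᵐ[volume] w := distInvL_ae q hψ
  have aw1 : distInvOddL q m1.toLp =ᵐ[volume] w1 :=
    (distInvOddL_ae q j1).trans (Eventually.of_forall fun x => distO_congr q e1 x)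
  have aw2 : distInvL q ψ₂ =ᵐ[volume] w2 :=
    (distInvL_ae q hψ₂).trans (Eventually.of_forall fun x => distE_congr q h2 x)
  have hΩ : IsOpen ({0}ᶜ : Set ℝ) := isOpen_compl_singleton
  have conjD : ∀ {k : ℝ → ℂ} {k' : ℂ} {x : ℝ}, HasDerivAt k k' x →
      HasDerivAt (fun y => (starRingEnd ℂ) (k y)) ((starRingEnd ℂ) k') x := fun h =>
    (Complex.conjCLE : ℂ →L[ℝ] ℂ).hasFDerivAt.comp_hasDerivAt _ h
  have s0 : ContDiffOn ℝ ∞ (fun x => (starRingEnd ℂ) (w x)) {0}ᶜ :=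
    (Complex.conjCLE : ℂ →L[ℝ] ℂ).contDiff.comp_contDiffOn (contDiffOn_distE q hit)
  have s1 : ContDiffOn ℝ ∞ (fun x => (starRingEnd ℂ) (w1 x)) {0}ᶜ :=
    (Complex.conjCLE : ℂ →L[ℝ] ℂ).contDiff.comp_contDiffOn
      (contDiffOn_distO q fun n => hit (n + 1))
  have p1 := ((d2.congr_ae hg (ae_eq_refl _)).mul_left hΩ s0)
  have p2 := (((d1.mono (subset_univ {0}ᶜ)).congr_ae hf hg).mul_left hΩ s1)
  -- This is the Wronskian w̄u' - w̄'u; the first-order cross terms in its derivative cancel. The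
  -- bounded frequency support of ψ makes w smooth off the origin, as the product rule requires.
  have p3 := (p1.add (p2.const_smul (-1))).congr_ae (f' := fun x =>
      (starRingEnd ℂ) (w x) * g x - (starRingEnd ℂ) (w1 x) * f x)
    (g' := fun x => (starRingEnd ℂ) (w x) * u₂ x - (starRingEnd ℂ) (w2 x) * u x)
    (Eventually.of_forall fun x => by simp [sub_eq_add_neg]) (by
      filter_upwards [ae_ne_zero, hf] with x hx hfx
      have D0 := (conjD (hasDerivAt_distE q hψ hψ1 hx)).deriv
      have D1 := (conjD (hasDerivAt_distO q hψ1 hψ2 hx)).deriv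
      simp only [Pi.add_apply, Pi.smul_apply, smul_eq_mul, D0, D1, hfx, hw, hw1, hw2]
      ring)
  have prodI : ∀ (a b : L2) {a' b' : ℝ → ℂ}, a =ᵐ[volume] a' → b =ᵐ[volume] b' →
      Integrable (fun x => (starRingEnd ℂ) (a' x) * b' x) ∧
      ∫ x, (starRingEnd ℂ) (a' x) * b' x = inner ℂ a b := by
    intro a b a' b' ha hb
    have e : (fun x => inner ℂ (a x) (b x)) =ᵐ[volume] fun x => (starRingEnd ℂ) (a' x) * b' x := by
      filter_upwards [ha, hb] with x h1 h2
      rw [RCLike.inner_apply, h1, h2, mul_comm]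
    refine ⟨(L2.integrable_inner (𝕜 := ℂ) a b).congr e, ?_⟩
    rw [L2.inner_def]
    exact (integral_congr_ae e).symm
  obtain ⟨I1, J1⟩ := prodI _ _ aw (ae_eq_refl (u₂ : ℝ → ℂ))
  obtain ⟨I2, J2⟩ := prodI _ _ aw2 (ae_eq_refl (u : ℝ → ℂ))
  obtain ⟨I3, -⟩ := prodI _ _ aw hg
  obtain ⟨I4, -⟩ := prodI _ _ aw1 hf
  have cw : Continuous w := continuous_distE q hψ
  have tw : ∀ s : Set ℝ, Tendsto (fun x => (starRingEnd ℂ) (w x)) (𝓝[s] 0)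
      (𝓝 ((starRingEnd ℂ) (w 0))) := fun s =>
    ((Complex.continuous_conj.comp cw).tendsto 0).mono_left nhdsWithin_le_nhds
  have tf : ∀ s : Set ℝ, Tendsto f (𝓝[s] 0) (𝓝 (f 0)) := fun s =>
    (hfc.tendsto 0).mono_left nhdsWithin_le_nhds
  have key := p3.integral_eq_of_jump
    (((Complex.continuous_conj.comp cw).continuousOn.mul hgc).sub
      ((Complex.continuous_conj.comp_continuousOn (continuousOn_distO q hψ1)).mul
        hfc.continuousOn)) (I3.sub I4) (I1.sub I2)
    (((tw _).mul hdp).sub (((Complex.continuous_conj.tendsto _).comp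
      (tendsto_distO_pos q hψ1)).mul (tf _)))
    (((tw _).mul hdm).sub (((Complex.continuous_conj.tendsto _).comp
      (tendsto_distO_neg q hψ1)).mul (tf _)))
  rw [integral_sub I1 I2, J1, J2] at key
  have hj := congrArg (starRingEnd ℂ) (jump_distE q hψ)
  rw [map_sub, map_mul, map_mul, Complex.conj_ofReal, map_ofNat, ← hw] at hj
  -- Both u and w obey the jump condition with the same real q, so the Wronskian does not jump at
  -- the origin and the integral of its derivative vanishes.
  linear_combination key - (starRingEnd ℂ) (w 0) * hjump + f 0 * hj

/-- The symmetry of H_q against wave packets with |ξ| ≤ N gives the identity on [-N, N], without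
knowing in advance that ξ² times the transform of u is square integrable. Integer N exhaust the line
up to a null set. -/
theorem distL_of_mem_hamiltonianGraph {q : ℝ} {u v : L2}
    (h : (u, v) ∈ hamiltonianGraph q) :
    distL q v =ᵐ[volume] fun ξ => ((ξ ^ 2 / 2 : ℝ) : ℂ) * distL q u ξ := by
  obtain ⟨u₁, u₂, hu, hv⟩ := h
  replace hv : v = (-(1 / 2) : ℂ) • u₂ := hv
  set φ := distL q u with hφ
  have key : ∀ N : ℕ, cutL N (distL q v) =
      mulL ((Icc (-(N : ℝ)) N).indicator fun ξ => ((ξ ^ 2 / 2 : ℝ) : ℂ)) φ := by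
    intro N
    have hm : BddMeas ((Icc (-(N : ℝ)) N).indicator fun ξ : ℝ => ((ξ ^ 2 / 2 : ℝ) : ℂ)) := by
      refine ⟨Measurable.indicator (by fun_prop) measurableSet_Icc, (N : ℝ) ^ 2 / 2, fun ξ => ?_⟩
      by_cases hξ : ξ ∈ Icc (-(N : ℝ)) N
      · rw [indicator_of_mem hξ, Complex.norm_real, Real.norm_eq_abs,
          abs_of_nonneg (by positivity)]
        have := sq_le_sq' hξ.1 hξ.2
        linarith
      · rw [indicator_of_notMem hξ, norm_zero]
        positivity
    set m := (Icc (-(N : ℝ)) N).indicator fun ξ : ℝ => ((ξ ^ 2 / 2 : ℝ) : ℂ) with hmdef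
    have hconj : (fun x => (starRingEnd ℂ) (m x)) = m := by
      funext x
      by_cases hx : x ∈ Icc (-(N : ℝ)) N
      · rw [hmdef, indicator_of_mem hx, Complex.conj_ofReal]
      · rw [hmdef, indicator_of_notMem hx, map_zero]
    have hcut : ∀ a b : L2, inner ℂ (cutL N a) b = inner ℂ a (cutL N b) := by
      intro a b
      rw [cutL, inner_mulL (bddMeas_cut N)]
      congr 3
      funext x
      by_cases hx : x ∈ Icc (-(N : ℝ)) N <;> simp [hx]
    refine ext_inner_left ℂ fun θ => ?_
    have e2 : ((-2 : ℂ) • mulL m θ : L2) =ᵐ[volume] mulI (mulI (cutL N θ)) := by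
      filter_upwards [Lp.coeFn_smul (-2 : ℂ) (mulL m θ), mulL_ae hm θ, cutL_ae N θ]
        with ξ h1 h2 h3
      rw [h1, Pi.smul_apply, h2, mulI, mulI, h3, smul_eq_mul, hmdef]
      by_cases hξ : ξ ∈ Icc (-(N : ℝ)) N
      · rw [indicator_of_mem hξ, indicator_of_mem hξ]
        push_cast
        linear_combination (-(ξ : ℂ) ^ 2 * θ ξ) * Complex.I_sq
      · rw [indicator_of_notMem hξ, indicator_of_notMem hξ]
        ring
    have h0 : ∀ᵐ ξ, ξ ∉ Icc (-(N : ℝ)) N → cutL N θ ξ = 0 := by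
      filter_upwards [cutL_ae N θ] with ξ h1 h2
      rw [h1, indicator_of_notMem h2]
    have := inner_distInvL_of_inDomain hu h0 (integrable_cutL N θ) e2
    rw [map_smul, inner_smul_left, inner_distInvL_left, inner_distInvL_left, inner_mulL hm,
      hconj, hcut, ← hφ] at this
    rw [hv, map_smul, map_smul, inner_smul_right, this, map_neg, map_ofNat]
    ring
  have key2 : ∀ᵐ ξ, ∀ N : ℕ, cutL N (distL q v) ξ =
      (Icc (-(N : ℝ)) N).indicator (fun ξ => ((ξ ^ 2 / 2 : ℝ) : ℂ)) ξ * φ ξ := by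
    rw [ae_all_iff]
    intro N
    rw [key N]
    refine mulL_ae ⟨Measurable.indicator (by fun_prop) measurableSet_Icc, (N : ℝ) ^ 2 / 2,
      fun ξ => ?_⟩ φ
    by_cases hξ : ξ ∈ Icc (-(N : ℝ)) N
    · rw [indicator_of_mem hξ, Complex.norm_real, Real.norm_eq_abs,
        abs_of_nonneg (by positivity)]
      have := sq_le_sq' hξ.1 hξ.2
      linarith
    · rw [indicator_of_notMem hξ, norm_zero]
      positivity
  have key3 : ∀ᵐ ξ, ∀ N : ℕ, cutL N (distL q v) ξ =
      (Icc (-(N : ℝ)) N).indicator (distL q v) ξ :=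
    ae_all_iff.2 fun N => cutL_ae N _
  filter_upwards [key2, key3] with ξ h1 h2
  obtain ⟨N, hN⟩ := exists_nat_ge |ξ|
  have hξ : ξ ∈ Icc (-(N : ℝ)) N := abs_le.1 hN
  have := (h2 N).symm.trans (h1 N)
  rwa [indicator_of_mem hξ, indicator_of_mem hξ] at this

/-! ### Uniqueness of the group generated by an operator -/

section Uniqueness

variable {E : Type*} [NormedAddCommGroup E] [InnerProductSpace ℂ E] {A : E →ₗ.[ℂ] E}
  {U V : ℝ → E →L[ℂ] E}

theorem IsUnitaryGroupOf.mem_graph (hU : IsUnitaryGroupOf A U) {u v : E} (h : (u, v) ∈ A.graph)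
    (s : ℝ) : (U s u, U s v) ∈ A.graph := by
  rw [hU.generator] at h ⊢
  have := ((U s).continuous.tendsto _).comp h
  rw [map_smul] at this
  refine this.congr fun t => ?_
  have e : U t (U s u) = U s (U t u) := by
    have h1 := hU.add t s
    rw [add_comm, hU.add s t] at h1
    exact (congrArg (fun T => T u) h1).symm
  simp only [Function.comp_apply]
  rw [map_smul, map_sub, e]

theorem IsUnitaryGroupOf.hasDerivAt (hU : IsUnitaryGroupOf A U) {u v : E}
    (h : (u, v) ∈ A.graph) (s : ℝ) :
    HasDerivAt (fun s => U s u) (-Complex.I • U s v) s := by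
  rw [hasDerivAt_iff_tendsto_slope_zero]
  refine ((hU.generator _ _).1 (hU.mem_graph h s)).congr fun t => ?_
  rw [add_comm, hU.add t s, ContinuousLinearMap.comp_apply, ← Complex.ofReal_inv, Complex.coe_smul]

/-- Differentiating the conserved norm at time 0 shows that the generator is skew-symmetric. -/
theorem IsUnitaryGroupOf.inner_add_inner (hU : IsUnitaryGroupOf A U) {u v : E}
    (h : (u, v) ∈ A.graph) :
    inner ℂ u (-Complex.I • v) + inner ℂ (-Complex.I • v) u = 0 := by
  have h1 := (hU.hasDerivAt h 0).inner ℂ (hU.hasDerivAt h 0)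
  have h2 : (fun s => inner ℂ (U s u) (U s u)) = fun _ : ℝ => inner ℂ u u := by
    funext s
    rw [inner_self_eq_norm_sq_to_K, inner_self_eq_norm_sq_to_K, hU.isometry]
  rw [h2] at h1
  have h3 := h1.unique (hasDerivAt_const (0 : ℝ) _)
  simpa only [hU.zero, ContinuousLinearMap.id_apply] using h3

/-- The difference of the two orbits stays in the domain and solves the same equation, so by
skew-symmetry its norm is constant; it vanishes at time 0. -/
theorem IsUnitaryGroupOf.eq_of_mem_graph (hU : IsUnitaryGroupOf A U) (hV : IsUnitaryGroupOf A V)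
    {u v : E} (h : (u, v) ∈ A.graph) (t : ℝ) : U t u = V t u := by
  have hd : ∀ s, HasDerivAt (fun s => inner ℂ (U s u - V s u) (U s u - V s u)) 0 s := by
    intro s
    have d1 := (hU.hasDerivAt h s).sub (hV.hasDerivAt h s)
    have d2 := d1.inner ℂ d1
    rw [← smul_sub] at d2
    have hm := A.graph.sub_mem (hU.mem_graph h s) (hV.mem_graph h s)
    have := hU.inner_add_inner hm
    exact d2.congr_deriv this
  have hc := is_const_of_deriv_eq_zero (fun s => (hd s).differentiableAt)
    (fun s => (hd s).deriv) t 0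
  rw [hU.zero, hV.zero, sub_self, inner_zero_left, inner_self_eq_zero, sub_eq_zero] at hc
  exact hc

end Uniqueness

/-! ### The Schrödinger group in the distorted Fourier representation -/

/-- The free propagator `e^{-itξ²/2}` in frequency space. -/
noncomputable def phase (t ξ : ℝ) : ℂ := Complex.exp (Complex.I * (-(t * (ξ ^ 2 / 2)) : ℝ))

theorem bddMeas_phase (t : ℝ) : BddMeas (phase t) := BddMeas.exp_I (by fun_prop)

theorem norm_phase (t ξ : ℝ) : ‖phase t ξ‖ = 1 := by
  rw [phase, mul_comm, Complex.norm_exp_ofReal_mul_I]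

theorem phase_zero (ξ : ℝ) : phase 0 ξ = 1 := by simp [phase]

theorem phase_add (s t ξ : ℝ) : phase (s + t) ξ = phase s ξ * phase t ξ := by
  rw [phase, phase, phase, ← Complex.exp_add]
  congr 1
  push_cast
  ring

theorem hasDerivAt_phase (ξ : ℝ) :
    HasDerivAt (fun t => phase t ξ) (-Complex.I * ((ξ ^ 2 / 2 : ℝ) : ℂ)) 0 := by
  have h1 : HasDerivAt (fun t : ℝ => Complex.I * (-(t * (ξ ^ 2 / 2)) : ℝ))
      (Complex.I * (-(1 * (ξ ^ 2 / 2)) : ℝ)) 0 :=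
    (((hasDerivAt_id (0 : ℝ)).mul_const (ξ ^ 2 / 2)).neg.ofReal_comp).const_mul _
  refine h1.cexp.congr_deriv ?_
  push_cast
  simp

theorem continuous_phase (ξ : ℝ) : Continuous fun t => phase t ξ := by
  unfold phase
  fun_prop

theorem norm_phase_sub_one_le (t ξ : ℝ) : ‖phase t ξ - 1‖ ≤ |t| * (ξ ^ 2 / 2) := by
  refine (Real.norm_exp_I_mul_ofReal_sub_one_le).trans ?_
  rw [Real.norm_eq_abs, abs_neg, abs_mul, abs_of_nonneg (by positivity : 0 ≤ ξ ^ 2 / 2)]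

/-- The group `e^{-itH_q}`. -/
noncomputable def schrodL (q t : ℝ) : L2 →L[ℂ] L2 := distInvL q ∘L mulL (phase t) ∘L distL q

theorem schrodL_apply (q t : ℝ) (u : L2) :
    schrodL q t u = distInvL q (mulL (phase t) (distL q u)) := rfl

theorem differenceQuotient_ae (φ : L2) (t : ℝ) :
    ((t : ℂ)⁻¹ • (mulL (phase t) φ - φ) : L2) =ᵐ[volume]
      fun ξ => (t : ℂ)⁻¹ * ((phase t ξ - 1) * φ ξ) := by
  filter_upwards [Lp.coeFn_smul (t : ℂ)⁻¹ (mulL (phase t) φ - φ),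
    Lp.coeFn_sub (mulL (phase t) φ) φ, mulL_ae (bddMeas_phase t) φ] with ξ h1 h2 h3
  rw [h1, Pi.smul_apply, h2, Pi.sub_apply, h3, smul_eq_mul]
  ring

theorem tendsto_differenceQuotient (φ : ℝ → ℂ) (ξ : ℝ) :
    Tendsto (fun t : ℝ => (t : ℂ)⁻¹ * ((phase t ξ - 1) * φ ξ)) (𝓝[≠] 0)
      (𝓝 (-Complex.I * (((ξ ^ 2 / 2 : ℝ) : ℂ) * φ ξ))) := by
  have h := (hasDerivAt_phase ξ).tendsto_slope_zero.mul_const (φ ξ)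
  simp only [zero_add, phase_zero, mul_assoc] at h
  refine (h.congr fun t => ?_)
  rw [← Complex.ofReal_inv, Complex.real_smul, mul_assoc]

theorem norm_differenceQuotient_le (φ : ℝ → ℂ) {t : ℝ} (ht : t ≠ 0) (ξ : ℝ) :
    ‖(t : ℂ)⁻¹ * ((phase t ξ - 1) * φ ξ)‖ ≤ ‖((ξ ^ 2 / 2 : ℝ) : ℂ) * φ ξ‖ := by
  rw [norm_mul, norm_mul, norm_mul, norm_inv, Complex.norm_real, Complex.norm_real,
    Real.norm_eq_abs, Real.norm_eq_abs, ← mul_assoc,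
    abs_of_nonneg (by positivity : 0 ≤ ξ ^ 2 / 2)]
  refine mul_le_mul_of_nonneg_right ?_ (norm_nonneg _)
  rw [inv_mul_le_iff₀ (abs_pos.2 ht)]
  exact norm_phase_sub_one_le t ξ

theorem schrodL_sub {q : ℝ} (hq : 0 ≤ q) (u : L2) (t : ℝ) :
    (t : ℂ)⁻¹ • (schrodL q t u - u) =
      distInvL q ((t : ℂ)⁻¹ • (mulL (phase t) (distL q u) - distL q u)) := by
  rw [map_smul, map_sub, distInvL_distL hq, schrodL_apply]

/-- After conjugation by the unitary transform this is the group of multiplications by e^{-itξ²/2}.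
For elements of the graph the difference quotient is dominated thanks to |e^{-itξ²/2} - 1| ≤
|t|ξ²/2. -/
theorem isUnitaryGroupOf_schrodL {q : ℝ} (hq : 0 ≤ q) :
    IsUnitaryGroupOf (hamiltonian q) (schrodL q) where
  zero := by
    ext1 u
    have : phase 0 = fun _ => 1 := funext phase_zero
    rw [schrodL_apply, this, mulL_const, one_smul, distInvL_distL hq,
      ContinuousLinearMap.id_apply]
  add := fun s t => by
    ext1 u
    have : phase (s + t) = fun ξ => phase s ξ * phase t ξ := funext (phase_add s t)
    rw [ContinuousLinearMap.comp_apply, schrodL_apply, schrodL_apply, schrodL_apply,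
      distL_distInvL hq, mulL_mulL (bddMeas_phase s) (bddMeas_phase t), this]
  isometry := fun t u => by
    rw [schrodL_apply, norm_distInvL hq, norm_mulL_of_norm_eq_one (bddMeas_phase t) (norm_phase t),
      norm_distL hq]
  cont := fun u => by
    simp only [schrodL_apply]
    refine (distInvL q).continuous.comp (continuous_iff_continuousAt.2 fun t => ?_)
    refine tendsto_L2_of_dominated (fun s => mulL_ae (bddMeas_phase s) (distL q u))
      (Lp.memLp (distL q u)).norm (Eventually.of_forall fun s => Eventually.of_forall fun ξ => ?_) ?_
    · rw [norm_mul, norm_phase, one_mul]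
    · filter_upwards [mulL_ae (bddMeas_phase t) (distL q u)] with ξ hξ
      rw [hξ]
      exact ((continuous_phase ξ).tendsto t).mul_const _
  generator := fun u v => by
    rw [hamiltonian_graph]
    constructor
    · intro h
      have hv := distL_of_mem_hamiltonianGraph h
      have key : Tendsto (fun t : ℝ => (t : ℂ)⁻¹ • (mulL (phase t) (distL q u) - distL q u))
          (𝓝[≠] 0) (𝓝 (-Complex.I • distL q v)) := by
        refine tendsto_L2_of_dominated (differenceQuotient_ae (distL q u))
          (Lp.memLp (distL q v)).norm ?_ ?_
        · filter_upwards [self_mem_nhdsWithin] with t ht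
          filter_upwards [hv] with ξ hξ
          rw [hξ]
          exact norm_differenceQuotient_le _ ht ξ
        · filter_upwards [hv, Lp.coeFn_smul (-Complex.I) (distL q v)] with ξ h1 h2
          rw [h2, Pi.smul_apply, h1, smul_eq_mul]
          exact tendsto_differenceQuotient _ ξ
      have := ((distInvL q).continuous.tendsto _).comp key
      rw [map_smul, distInvL_distL hq] at this
      exact this.congr fun t => (schrodL_sub hq u t).symm
    · intro h
      set φ := distL q u with hφ
      set χ := distL q v with hχ
      have h1 : Tendsto (fun t : ℝ => (t : ℂ)⁻¹ • (mulL (phase t) φ - φ)) (𝓝[≠] 0)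
          (𝓝 (-Complex.I • χ)) := by
        have := ((distL q).continuous.tendsto _).comp h
        rw [map_smul] at this
        refine this.congr fun t => ?_
        rw [Function.comp_apply, schrodL_sub hq, distL_distInvL hq]
      -- That ξ²φ is square integrable is what has to be proved. On [-N, N] it is automatic, and
      -- there dominated convergence identifies the limit of the difference quotients.
      have key : ∀ᵐ ξ, ∀ N : ℕ, ξ ∈ Icc (-(N : ℝ)) N → χ ξ = ((ξ ^ 2 / 2 : ℝ) : ℂ) * φ ξ := by
        rw [ae_all_iff]
        intro N
        have hm : MemLp ((Icc (-(N : ℝ)) N).indicator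
            fun ξ => -Complex.I * (((ξ ^ 2 / 2 : ℝ) : ℂ) * φ ξ)) 2 := by
          refine (Lp.memLp φ).of_le_mul (c := (N : ℝ) ^ 2 / 2)
            (AEStronglyMeasurable.indicator (AEStronglyMeasurable.const_mul
              (AEStronglyMeasurable.mul (Continuous.aestronglyMeasurable (by fun_prop))
                (Lp.aestronglyMeasurable φ)) _) measurableSet_Icc)
            (Eventually.of_forall fun ξ => ?_)
          by_cases hξ : ξ ∈ Icc (-(N : ℝ)) N
          · rw [indicator_of_mem hξ, norm_mul, norm_neg, Complex.norm_I, one_mul, norm_mul,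
              Complex.norm_real, Real.norm_of_nonneg (by positivity)]
            refine mul_le_mul_of_nonneg_right ?_ (norm_nonneg _)
            have := sq_le_sq' hξ.1 hξ.2
            linarith
          · rw [indicator_of_notMem hξ, norm_zero]
            positivity
        have h2 : Tendsto (fun t : ℝ => cutL N ((t : ℂ)⁻¹ • (mulL (phase t) φ - φ))) (𝓝[≠] 0)
            (𝓝 hm.toLp) := by
          refine tendsto_L2_of_dominated (G := fun t => (Icc (-(N : ℝ)) N).indicator
            fun ξ => (t : ℂ)⁻¹ * ((phase t ξ - 1) * φ ξ)) (fun t => ?_) hm.norm ?_ ?_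
          · filter_upwards [cutL_ae N ((t : ℂ)⁻¹ • (mulL (phase t) φ - φ)),
              differenceQuotient_ae φ t] with ξ h3 h4
            rw [h3]
            by_cases hξ : ξ ∈ Icc (-(N : ℝ)) N
            · rw [indicator_of_mem hξ, indicator_of_mem hξ, h4]
            · rw [indicator_of_notMem hξ, indicator_of_notMem hξ]
          · filter_upwards [self_mem_nhdsWithin] with t ht
            refine Eventually.of_forall fun ξ => ?_
            by_cases hξ : ξ ∈ Icc (-(N : ℝ)) N
            · rw [indicator_of_mem hξ, indicator_of_mem hξ, norm_mul (-Complex.I), norm_neg,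
                Complex.norm_I, one_mul]
              exact norm_differenceQuotient_le _ ht ξ
            · rw [indicator_of_notMem hξ, indicator_of_notMem hξ]
          · filter_upwards [hm.coeFn_toLp] with ξ h3
            rw [h3]
            by_cases hξ : ξ ∈ Icc (-(N : ℝ)) N
            · simp only [indicator_of_mem hξ]
              exact tendsto_differenceQuotient _ ξ
            · simp only [indicator_of_notMem hξ]
              exact tendsto_const_nhds
        have h3 := tendsto_nhds_unique (((cutL N).continuous.tendsto _).comp h1) h2
        have h4 := hm.coeFn_toLp
        rw [← h3] at h4
        filter_upwards [h4, cutL_ae N (-Complex.I • χ), Lp.coeFn_smul (-Complex.I) χ]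
          with ξ h5 h6 h7 hξ
        rw [h6, indicator_of_mem hξ, indicator_of_mem hξ, h7, Pi.smul_apply, smul_eq_mul] at h5
        exact mul_left_cancel₀ (neg_ne_zero.2 Complex.I_ne_zero) h5
      have hae : χ =ᵐ[volume] fun ξ => ((ξ ^ 2 / 2 : ℝ) : ℂ) * φ ξ := by
        filter_upwards [key] with ξ hξ
        obtain ⟨N, hN⟩ := exists_nat_ge |ξ|
        exact hξ N (abs_le.1 hN)
      have := distInvL_mem_hamiltonianGraph q hae
      rwa [hφ, hχ, distInvL_distL hq, distInvL_distL hq] at this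

/-- The group in `expNegI` is obtained by choice. It agrees with `schrodL` on vectors of bounded
distorted frequency, which belong to the domain, and these are dense. -/
theorem expNegI_hamiltonian {q : ℝ} (hq : 0 ≤ q) (t : ℝ) :
    expNegI (hamiltonian q) t = schrodL q t := by
  have hS := isUnitaryGroupOf_schrodL hq
  have hex : ∃ U : ℝ → L2 →L[ℂ] L2, IsUnitaryGroupOf (hamiltonian q) U := ⟨_, hS⟩
  rw [expNegI, dif_pos hex]
  set U := hex.choose with hU
  have hUg : IsUnitaryGroupOf (hamiltonian q) U := hex.choose_spec
  have key : ∀ (φ : L2) (N : ℝ), U t (distInvL q (cutL N φ)) =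
      schrodL q t (distInvL q (cutL N φ)) := by
    intro φ N
    have hm : MemLp (fun ξ : ℝ => ((ξ ^ 2 / 2 : ℝ) : ℂ) * cutL N φ ξ) 2 := by
      refine (Lp.memLp φ).of_le_mul (c := N ^ 2 / 2)
        (AEStronglyMeasurable.mul (Continuous.aestronglyMeasurable (by fun_prop))
          (Lp.aestronglyMeasurable _)) ?_
      filter_upwards [cutL_ae N φ] with ξ h
      rw [h]
      by_cases hξ : ξ ∈ Icc (-N) N
      · rw [indicator_of_mem hξ, norm_mul, Complex.norm_real, Real.norm_of_nonneg (by positivity)]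
        refine mul_le_mul_of_nonneg_right ?_ (norm_nonneg _)
        have := sq_le_sq' hξ.1 hξ.2
        linarith
      · rw [indicator_of_notMem hξ, mul_zero, norm_zero]
        positivity
    have := distInvL_mem_hamiltonianGraph q hm.coeFn_toLp
    rw [← hamiltonian_graph] at this
    exact hUg.eq_of_mem_graph hS this t
  ext1 u
  have h1 : Tendsto (fun N => distInvL q (cutL N (distL q u))) atTop (𝓝 u) := by
    have := ((distInvL q).continuous.tendsto _).comp (tendsto_cutL (distL q u))
    rwa [distInvL_distL hq] at this
  refine tendsto_nhds_unique (((U t).continuous.tendsto u).comp h1) ?_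
  refine (((schrodL q t).continuous.tendsto u).comp h1).congr fun N => ?_
  exact (key _ N).symm

/-! ### The inverse distorted Fourier transform as a limit of truncated integrals -/

/-- On the incoming side the factor t_q cancels and the wave is incident plus reflected; on the
outgoing side the conjugate of t_q is 1 + ρ, so the transmitted wave is again incident plus ρ times
an exponential in -|x|. The frequency 0 is excluded because t_q vanishes there. -/
theorem conj_distortedWave (q x : ℝ) {ξ : ℝ} (hξ : ξ ≠ 0) :
    (starRingEnd ℂ) (distortedWave q x (-ξ)) = Complex.exp (Complex.I * x * ξ) +
      (rhoPos q ξ * Complex.exp (Complex.I * (-|x| : ℝ) * ξ) +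
        rhoPos q (-ξ) * Complex.exp (Complex.I * (-|x| : ℝ) * (-ξ : ℝ))) := by
  have hne : ∀ k : ℝ, k ≠ 0 → (q : ℂ) + Complex.I * k ≠ 0 := fun k hk h => by
    have := congrArg Complex.im h
    simp at this
    exact hk this
  have hne' : ∀ k : ℝ, k ≠ 0 → Complex.I * k - (q : ℂ) ≠ 0 := fun k hk h => by
    have := congrArg Complex.im h
    simp at this
    exact hk this
  have ht0 : ∀ k : ℝ, k ≠ 0 → transmission q k ≠ 0 := fun k hk =>
    div_ne_zero (mul_ne_zero Complex.I_ne_zero (by exact_mod_cast hk)) (hne' k hk)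
  have hconj : ∀ k : ℝ, (starRingEnd ℂ) (Complex.I * k - q) = -(q + Complex.I * k) := fun k => by
    simp only [map_sub, map_mul, Complex.conj_I, Complex.conj_ofReal]
    ring
  have ht : ∀ k : ℝ, k ≠ 0 → (starRingEnd ℂ) (transmission q k) = 1 + rho q k := fun k hk => by
    have := hne k hk
    rw [transmission, map_div₀, hconj, map_mul, Complex.conj_I, Complex.conj_ofReal, rho]
    field_simp
    ring
  have hr : ∀ k : ℝ, (starRingEnd ℂ) (reflection q k) = rho q k := fun k => by
    rw [reflection, map_div₀, hconj, Complex.conj_ofReal, rho, div_neg, neg_div]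
  have hexp : ∀ z : ℂ, (starRingEnd ℂ) (Complex.exp z) = Complex.exp ((starRingEnd ℂ) z) :=
    fun z => (Complex.exp_conj z).symm
  have two : ∀ k : ℝ, k ≠ 0 → ∀ a b : ℂ, transmission q k *
      (1 / transmission q k * a + reflection q k / transmission q k * b) =
      a + reflection q k * b := fun k hk a b => by
    have := ht0 k hk
    field_simp
  rcases lt_or_gt_of_ne hξ with h | h
  · have hk : (-ξ) ≠ 0 := neg_ne_zero.2 hξ
    rw [distortedWave, if_pos (by linarith), rhoPos,
      indicator_of_notMem (by simp only [mem_Ioi]; linarith),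
      indicator_of_mem (by simp only [mem_Ioi]; linarith), zero_mul, zero_add, jostPlus]
    split_ifs with hx
    · rw [map_mul, ht _ hk, hexp, abs_of_nonneg hx, add_mul, one_mul]
      simp only [map_mul, Complex.conj_I, Complex.conj_ofReal]
      push_cast
      ring_nf
    · rw [two _ hk, map_add, map_mul, hr, hexp, hexp, abs_of_neg (not_le.1 hx)]
      simp only [map_mul, map_neg, Complex.conj_I, Complex.conj_ofReal]
      push_cast
      ring_nf
  · rw [distortedWave, if_neg (by linarith), neg_neg, rhoPos,
      indicator_of_mem (by exact h), indicator_of_notMem (by simp only [mem_Ioi]; linarith),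
      zero_mul, add_zero, jostMinus]
    split_ifs with hx
    · rw [two _ hξ, map_add, map_mul, hr, hexp, hexp, abs_of_nonneg hx]
      simp only [map_mul, map_neg, Complex.conj_I, Complex.conj_ofReal]
      congr 3 <;> · push_cast; ring
    · rw [map_mul, ht _ hξ, hexp, abs_of_neg (not_le.1 hx), add_mul, one_mul]
      simp only [map_mul, map_neg, Complex.conj_I, Complex.conj_ofReal]
      congr 3 <;> · push_cast; ring

theorem distE_eq_integral (q : ℝ) {φ : ℝ → ℂ} (hφ : Integrable φ) (x : ℝ) :
    distE q φ x = ((1 / √(2 * Real.pi) : ℝ) : ℂ) *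
      ∫ ξ, (starRingEnd ℂ) (distortedWave q x (-ξ)) * φ ξ := by
  have i1 := integrable_exp_mul hφ x
  have i2 : Integrable fun ξ : ℝ => Complex.exp (Complex.I * (-|x| : ℝ) * ξ) *
      (rhoPos q ξ * φ ξ) := integrable_exp_mul (integrable_rhoPos_mul q hφ) _
  have i3 : Integrable fun ξ : ℝ => Complex.exp (Complex.I * (-|x| : ℝ) * ξ) *
      (rhoPos q ξ * φ (-ξ)) := integrable_exp_mul (integrable_rhoPos_mul q hφ.comp_neg) _
  have e3 : ∫ ξ : ℝ, Complex.exp (Complex.I * (-|x| : ℝ) * ξ) * (rhoPos q ξ * φ (-ξ)) =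
      ∫ ξ : ℝ, Complex.exp (Complex.I * (-|x| : ℝ) * (-ξ : ℝ)) * (rhoPos q (-ξ) * φ ξ) := by
    rw [← integral_neg_eq_self]
    simp only [neg_neg]
  have e4 : ∫ ξ : ℝ, Complex.exp (Complex.I * (-|x| : ℝ) * ξ) * reflE q φ ξ =
      (∫ ξ : ℝ, Complex.exp (Complex.I * (-|x| : ℝ) * ξ) * (rhoPos q ξ * φ ξ)) +
      ∫ ξ : ℝ, Complex.exp (Complex.I * (-|x| : ℝ) * (-ξ : ℝ)) * (rhoPos q (-ξ) * φ ξ) := by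
    rw [← e3, ← integral_add i2 i3]
    refine integral_congr_ae (Eventually.of_forall fun ξ => ?_)
    simp only [reflE]
    ring
  have i4 : Integrable fun ξ : ℝ =>
      Complex.exp (Complex.I * (-|x| : ℝ) * (-ξ : ℝ)) * (rhoPos q (-ξ) * φ ξ) := by
    have := i3.comp_neg
    simpa only [neg_neg] using this
  have i5 : Integrable fun ξ : ℝ => Complex.exp (Complex.I * (-|x| : ℝ) * ξ) *
      (rhoPos q ξ * φ ξ) +
      Complex.exp (Complex.I * (-|x| : ℝ) * (-ξ : ℝ)) * (rhoPos q (-ξ) * φ ξ) := i2.add i4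
  rw [distE, invF, invF, e4, ← mul_add, one_div, ← integral_add i2 i4, ← integral_add i1 i5]
  congr 1
  refine integral_congr_ae ?_
  filter_upwards [ae_ne_zero] with ξ hξ
  rw [conj_distortedWave q x hξ]
  ring

theorem truncatedInvFourier_ae (q : ℝ) {φ : ℝ → ℂ} (hφ : MemLp φ 2) {N : ℝ} (hN : 0 ≤ N) :
    distInvL q (cutL N hφ.toLp) =ᵐ[volume] truncatedInvFourier q φ N := by
  refine (distInvL_ae q (integrable_cutL N _)).trans (Eventually.of_forall fun x => ?_)
  rw [distE_eq_integral q (integrable_cutL N _), truncatedInvFourier,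
    intervalIntegral.integral_of_le (by linarith), ← integral_Icc_eq_integral_Ioc,
    ← integral_indicator measurableSet_Icc]
  congr 1
  refine integral_congr_ae ?_
  filter_upwards [cutL_ae N hφ.toLp, hφ.coeFn_toLp] with ξ h1 h2
  rw [h1]
  by_cases hξ : ξ ∈ Icc (-N) N
  · rw [indicator_of_mem hξ, indicator_of_mem hξ, h2]
  · rw [indicator_of_notMem hξ, indicator_of_notMem hξ, mul_zero]

/-- For N ≥ 0 the truncated integrals are `distInvL` of the truncated profile, hence converge.
Uniqueness of limits in L² determines the chosen value. -/
theorem distortedInvFourier_eq (q : ℝ) {φ : ℝ → ℂ} (hφ : MemLp φ 2) :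
    distortedInvFourier q φ = distInvL q hφ.toLp := by
  have key : ∀ ψ : L2, Tendsto
      (fun N : ℝ => eLpNorm (fun x => ψ x - truncatedInvFourier q φ N x) 2 volume) atTop (𝓝 0) ↔
      Tendsto (fun N : ℝ => distInvL q (cutL N hφ.toLp)) atTop (𝓝 ψ) := by
    intro ψ
    rw [Lp.tendsto_Lp_iff_tendsto_eLpNorm']
    refine tendsto_congr' ?_
    filter_upwards [eventually_ge_atTop 0] with N hN
    rw [← eLpNorm_norm, ← eLpNorm_norm (_ - _)]
    refine eLpNorm_congr_ae ?_
    filter_upwards [truncatedInvFourier_ae q hφ hN] with x hx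
    rw [Pi.sub_apply, hx, norm_sub_rev]
  have hlim : Tendsto (fun N : ℝ => distInvL q (cutL N hφ.toLp)) atTop
      (𝓝 (distInvL q hφ.toLp)) :=
    ((distInvL q).continuous.tendsto _).comp (tendsto_cutL _)
  have hex : ∃ ψ : L2, Tendsto
      (fun N : ℝ => eLpNorm (fun x => ψ x - truncatedInvFourier q φ N x) 2 volume) atTop (𝓝 0) :=
    ⟨_, (key _).2 hlim⟩
  rw [distortedInvFourier, dif_pos hex]
  exact tendsto_nhds_unique ((key _).1 hex.choose_spec) hlim

/-! ### Differentiability under translations in `L²` -/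

theorem eLpNorm_L2 (f : L2) : eLpNorm f 2 volume = ENNReal.ofReal ‖f‖ := by
  rw [Lp.norm_def, ENNReal.ofReal_toReal (Lp.eLpNorm_ne_top f)]

theorem bddMeas_exp_neg_mul (h : ℝ) : BddMeas fun x : ℝ => Complex.exp (Complex.I * (-(h * x) : ℝ)) :=
  BddMeas.exp_I (by fun_prop)

/-- If `a` is Lipschitz as a map from translations to `L²`, its Fourier transform has a finite first
moment in `L²`. -/
theorem eLpNorm_mul_invFourierL_le {a : L2} {K : ℝ}
    (hK : ∀ h : ℝ, 0 < h → ‖compL 1 h a - a‖ ≤ K * h) :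
    eLpNorm (fun y : ℝ => (y : ℂ) * invFourierL a y) 2 volume ≤ ENNReal.ofReal K := by
  set f := invFourierL a with hf
  let h : ℕ → ℝ := fun n => 1 / ((n : ℝ) + 1)
  have hpos : ∀ n, 0 < h n := fun n => by positivity
  let D : ℕ → ℝ → ℂ := fun n y =>
    ((h n)⁻¹ : ℝ) * ((Complex.exp (Complex.I * (-(h n * y) : ℝ)) - 1) * f y)
  have hfm : AEStronglyMeasurable f volume := Lp.aestronglyMeasurable f
  have hD : ∀ n, eLpNorm (D n) 2 volume ≤ ENNReal.ofReal K := by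
    intro n
    have e : invFourierL (compL 1 (h n) a - a) =ᵐ[volume] fun y =>
        (Complex.exp (Complex.I * (-(h n * y) : ℝ)) - 1) * f y := by
      rw [map_sub, invFourierL_compL_one]
      filter_upwards [Lp.coeFn_sub (mulL (fun x : ℝ => Complex.exp (Complex.I * (-(h n * x) : ℝ)))
        (invFourierL a)) (invFourierL a), mulL_ae (bddMeas_exp_neg_mul (h n)) (invFourierL a)]
        with y h1 h2
      rw [h1, Pi.sub_apply, h2, sub_mul, one_mul]
    have e2 : eLpNorm (D n) 2 volume = ENNReal.ofReal (h n)⁻¹ *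
        ENNReal.ofReal ‖compL 1 (h n) a - a‖ := by
      rw [← norm_invFourierL, ← eLpNorm_L2, eLpNorm_congr_ae e]
      change eLpNorm ((((h n)⁻¹ : ℝ) : ℂ) • fun y : ℝ =>
        (Complex.exp (Complex.I * (-(h n * y) : ℝ)) - 1) * f y) 2 volume = _
      rw [eLpNorm_const_smul]
      congr 1
      rw [← ofReal_norm, Complex.norm_real, Real.norm_of_nonneg (inv_nonneg.2 (hpos n).le)]
    rw [e2, ← ENNReal.ofReal_mul (inv_nonneg.2 (hpos n).le)]
    apply ENNReal.ofReal_le_ofReal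
    rw [inv_mul_le_iff₀ (hpos n), mul_comm]
    exact hK _ (hpos n)
  have hlim : ∀ y : ℝ, Tendsto (fun n => D n y) atTop (𝓝 (-Complex.I * y * f y)) := by
    intro y
    have hd : HasDerivAt (fun s : ℝ => Complex.exp (Complex.I * (-(s * y) : ℝ)))
        (-Complex.I * y) 0 := by
      have h1 : HasDerivAt (fun s : ℝ => Complex.I * (-(s * y) : ℝ)) (-Complex.I * y) 0 := by
        have := ((Complex.ofRealCLM.hasDerivAt (x := (0 : ℝ))).mul_const (-Complex.I * y : ℂ))
        simp only [Complex.ofRealCLM_apply, Complex.ofReal_one, one_mul] at this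
        refine this.congr_of_eventuallyEq (Eventually.of_forall fun s => ?_)
        push_cast
        ring
      simpa using h1.cexp
    have hs : Tendsto h atTop (𝓝[≠] 0) := by
      refine tendsto_nhdsWithin_iff.2 ⟨tendsto_one_div_add_atTop_nhds_zero_nat,
        Eventually.of_forall fun n => (hpos n).ne'⟩
    have := (hd.tendsto_slope_zero.comp hs).mul_const (f y)
    refine this.congr fun n => ?_
    simp only [Function.comp, D, zero_add, zero_mul, neg_zero, Complex.ofReal_zero, mul_zero,
      Complex.exp_zero, Complex.real_smul]
    ring
  -- Fatou: the modulation quotients (e^{-ihy} - 1)/h tend to -iy, and their products with f have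
  -- norm at most K by Plancherel.
  have := Lp.eLpNorm_lim_le_liminf_eLpNorm (p := 2) (μ := volume) (f := D) (fun n => by
    have : Continuous fun y : ℝ => Complex.exp (Complex.I * (-(h n * y) : ℝ)) - 1 := by fun_prop
    exact (this.aestronglyMeasurable.mul hfm).const_mul _) _ (Eventually.of_forall hlim)
  have h3 : eLpNorm (fun y : ℝ => (y : ℂ) * f y) 2 volume =
      eLpNorm (fun y : ℝ => -Complex.I * y * f y) 2 volume := by
    refine eLpNorm_congr_norm_ae (Eventually.of_forall fun y => ?_)
    simp
  rw [h3]
  refine this.trans (liminf_le_of_le (by isBoundedDefault) fun b hb => ?_)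
  obtain ⟨n, hn⟩ := hb.exists
  exact hn.trans (hD n)

/-- The sliding integral over windows of length `h` has norm at most `h` on `L²`. -/
theorem eLpNorm_integral_window_le {g : ℝ → ℂ} (hg : MemLp g 2) {h : ℝ} (hh : 0 < h) :
    eLpNorm (fun x => ∫ y in x..(x + h), ‖g y‖) 2 volume ≤ ENNReal.ofReal h * eLpNorm g 2 volume := by
  have hgm : AEMeasurable (fun y => ‖g y‖ₑ) volume := hg.1.enorm
  -- Cauchy–Schwarz on a window of length h gives one factor h; integrating in x and exchanging the
  -- order gives the other.
  have key : ∀ x, ‖∫ y in x..(x + h), ‖g y‖‖ₑ ^ (2 : ℝ) ≤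
      ENNReal.ofReal h * ∫⁻ s in Ioc 0 h, ‖g (x + s)‖ₑ ^ (2 : ℝ) := by
    intro x
    have hgx : AEMeasurable (fun s => ‖g (x + s)‖ₑ) volume :=
      hgm.comp_quasiMeasurePreserving (measurePreserving_add_left volume x).quasiMeasurePreserving
    have e1 : ‖∫ y in x..(x + h), ‖g y‖‖ₑ ≤ ∫⁻ s in Ioc 0 h, ‖g (x + s)‖ₑ := by
      have : ∫ y in x..(x + h), ‖g y‖ = ∫ s in (0)..h, ‖g (x + s)‖ := by
        rw [intervalIntegral.integral_comp_add_left (fun y => ‖g y‖), add_zero]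
      rw [this, intervalIntegral.integral_of_le hh.le]
      refine (enorm_integral_le_lintegral_enorm _).trans (le_of_eq ?_)
      simp
    have e2 := ENNReal.lintegral_mul_le_Lp_mul_Lq (volume.restrict (Ioc 0 h))
      Real.HolderConjugate.two_two (f := fun s => ‖g (x + s)‖ₑ) (g := fun _ => 1)
      hgx.restrict aemeasurable_const
    simp only [Pi.mul_apply, mul_one, ENNReal.one_rpow, lintegral_const,
      Measure.restrict_apply MeasurableSet.univ, univ_inter, Real.volume_Ioc, sub_zero, one_mul]
      at e2
    refine (ENNReal.rpow_le_rpow (e1.trans e2) zero_le_two).trans (le_of_eq ?_)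
    rw [ENNReal.mul_rpow_of_nonneg _ _ zero_le_two, ← ENNReal.rpow_mul, ← ENNReal.rpow_mul]
    norm_num
    rw [mul_comm]
  rw [eLpNorm_eq_lintegral_rpow_enorm_toReal two_ne_zero ENNReal.ofNat_ne_top,
    eLpNorm_eq_lintegral_rpow_enorm_toReal two_ne_zero ENNReal.ofNat_ne_top, ENNReal.toReal_ofNat]
  have tot : ∫⁻ x, ‖∫ y in x..(x + h), ‖g y‖‖ₑ ^ (2 : ℝ) ≤
      ENNReal.ofReal h ^ (2 : ℝ) * ∫⁻ x, ‖g x‖ₑ ^ (2 : ℝ) := by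
    refine (lintegral_mono key).trans ?_
    rw [lintegral_const_mul' _ _ ENNReal.ofReal_ne_top, lintegral_lintegral_swap]
    · have : ∀ s : ℝ, ∫⁻ x, ‖g (x + s)‖ₑ ^ (2 : ℝ) = ∫⁻ x, ‖g x‖ₑ ^ (2 : ℝ) := fun s =>
        lintegral_add_right_eq_self (fun x => ‖g x‖ₑ ^ (2 : ℝ)) s
      simp only [this, lintegral_const, Measure.restrict_apply MeasurableSet.univ, univ_inter,
        Real.volume_Ioc, sub_zero]
      rw [show (2 : ℝ) = 1 + 1 by norm_num, ENNReal.rpow_add_of_nonneg _ _ zero_le_one zero_le_one,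
        ENNReal.rpow_one, mul_assoc, mul_comm (∫⁻ x, _)]
    · have hq : Measure.QuasiMeasurePreserving (fun z : ℝ × ℝ => z.1 + z.2)
          (volume.prod (volume.restrict (Ioc 0 h))) volume :=
        (quasiMeasurePreserving_add (volume : Measure ℝ) volume).mono_left
          (Measure.AbsolutelyContinuous.rfl.prod
            (Measure.absolutelyContinuous_of_le Measure.restrict_le_self))
      exact (hgm.comp_quasiMeasurePreserving hq).pow_const _
  refine (ENNReal.rpow_le_rpow tot (by norm_num)).trans (le_of_eq ?_)
  rw [ENNReal.mul_rpow_of_nonneg _ _ (by norm_num), ← ENNReal.rpow_mul]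
  norm_num

/-- A pointwise modulus of continuity becomes an L² Lipschitz bound for translations. The term with
b accommodates products, where one factor is Lipschitz and the other is left undifferentiated. -/
theorem norm_compL_sub_le {f : ℝ → ℂ} (hf : MemLp f 2 volume) {g b : ℝ → ℂ}
    (hg : MemLp g 2 volume) (hb : MemLp b 2 volume) {h : ℝ} (hh : 0 < h) {c : ℝ} (hc : 0 ≤ c)
    (hd : ∀ x, ‖f (x + h) - f x‖ ≤ (∫ y in x..(x + h), ‖g y‖) + c * h * ‖b x‖) :
    ‖compL 1 h hf.toLp - hf.toLp‖ ≤ (‖hg.toLp‖ + c * ‖hb.toLp‖) * h := by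
  have hgl : ∀ a b, IntervalIntegrable (fun y => ‖g y‖) volume a b := fun a b =>
    ((hg.norm.locallyIntegrable one_le_two).integrableOn_isCompact isCompact_uIcc).intervalIntegrable
  have hcont : Continuous fun x => ∫ y in x..(x + h), ‖g y‖ := by
    have h0 := intervalIntegral.continuous_primitive hgl 0
    have : ∀ x, ∫ y in x..(x + h), ‖g y‖ = (∫ y in (0)..(x + h), ‖g y‖) - ∫ y in (0)..x, ‖g y‖ :=
      fun x => (intervalIntegral.integral_interval_sub_left (hgl _ _) (hgl _ _)).symm
    simp only [this]
    exact (h0.comp (continuous_add_const h)).sub h0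
  have e : (compL 1 h hf.toLp - hf.toLp : L2) =ᵐ[volume] fun x => f (x + h) - f x := by
    have h1 := ae_affine one_ne_zero h hf.coeFn_toLp
    filter_upwards [Lp.coeFn_sub (compL 1 h hf.toLp) hf.toLp, compL_ae one_ne_zero h hf.toLp, h1,
      hf.coeFn_toLp] with x h2 h3 h4 h5
    rw [h2, Pi.sub_apply, h3, h4, h5, one_mul]
  rw [Lp.norm_def]
  refine ENNReal.toReal_le_of_le_ofReal (by positivity) ?_
  rw [eLpNorm_congr_ae e]
  calc eLpNorm (fun x => f (x + h) - f x) 2 volume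
      ≤ eLpNorm ((fun x => ∫ y in x..(x + h), ‖g y‖) + (c * h) • fun x => ‖b x‖) 2 volume :=
        eLpNorm_mono_real fun x => by simpa using hd x
    _ ≤ ENNReal.ofReal h * eLpNorm g 2 volume + ENNReal.ofReal (c * h) * eLpNorm b 2 volume := by
        refine (eLpNorm_add_le hcont.aestronglyMeasurable (hb.1.norm.const_smul _)
          one_le_two).trans (add_le_add (eLpNorm_integral_window_le hg hh) (le_of_eq ?_))
        rw [eLpNorm_const_smul, eLpNorm_norm, Real.enorm_of_nonneg (by positivity)]
    _ = ENNReal.ofReal ((‖hg.toLp‖ + c * ‖hb.toLp‖) * h) := by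
        rw [← eLpNorm_congr_ae hg.coeFn_toLp, ← eLpNorm_congr_ae hb.coeFn_toLp, eLpNorm_L2,
          eLpNorm_L2, ← ENNReal.ofReal_mul hh.le, ← ENNReal.ofReal_mul (by positivity),
          ← ENNReal.ofReal_add (by positivity) (by positivity)]
        congr 1
        ring

/-! ### The free propagator -/

/-- The regularized propagator symbol `e^{-(ε + it)ξ²/2}`. -/
noncomputable def heatPhase (ε t ξ : ℝ) : ℂ := Complex.exp (-((ε + Complex.I * t) / 2) * (ξ : ℂ) ^ 2)

theorem heatPhase_re (ε t : ℝ) : ((ε + Complex.I * t : ℂ) / 2).re = ε / 2 := by simp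

theorem norm_heatPhase_le {ε : ℝ} (hε : 0 ≤ ε) (t ξ : ℝ) : ‖heatPhase ε t ξ‖ ≤ 1 := by
  rw [heatPhase, norm_cexp_neg_mul_sq, heatPhase_re, Real.exp_le_one_iff]
  have := mul_nonneg (div_nonneg hε zero_le_two) (sq_nonneg ξ)
  linarith

theorem continuous_heatPhase (ε t : ℝ) : Continuous (heatPhase ε t) := by
  unfold heatPhase
  fun_prop

theorem bddMeas_heatPhase {ε : ℝ} (hε : 0 ≤ ε) (t : ℝ) : BddMeas (heatPhase ε t) :=
  ⟨(continuous_heatPhase ε t).measurable, 1, norm_heatPhase_le hε t⟩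

theorem integrable_heatPhase {ε : ℝ} (hε : 0 < ε) (t : ℝ) : Integrable (heatPhase ε t) :=
  integrable_cexp_neg_mul_sq (by rw [heatPhase_re]; positivity)

theorem memLp_heatPhase {ε : ℝ} (hε : 0 < ε) (t : ℝ) : MemLp (heatPhase ε t) 2 := by
  rw [memLp_two_iff_integrable_sq_norm (continuous_heatPhase ε t).aestronglyMeasurable]
  refine ((integrable_heatPhase hε t).norm).mono'
    (((continuous_heatPhase ε t).norm.pow 2).aestronglyMeasurable) (Eventually.of_forall fun ξ => ?_)
  rw [Real.norm_of_nonneg (by positivity)]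
  exact pow_le_of_le_one (norm_nonneg _) (norm_heatPhase_le hε.le t ξ) two_ne_zero

/-- The kernel of the free propagator, regularized for `ε > 0`, up to the factor `1 / (2π)`. -/
noncomputable def heatKernel (ε t z : ℝ) : ℂ :=
  (Real.pi / ((ε + Complex.I * t) / 2)) ^ (1 / 2 : ℂ) *
    Complex.exp (-(z : ℂ) ^ 2 / (4 * ((ε + Complex.I * t) / 2)))

theorem integral_heatPhase {ε : ℝ} (hε : 0 < ε) (t z : ℝ) :
    ∫ ξ : ℝ, Complex.exp (Complex.I * z * ξ) * heatPhase ε t ξ = heatKernel ε t z :=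
  fourierIntegral_gaussian (by rw [heatPhase_re]; positivity) _

/-- Fubini. The damping ε > 0 is what makes the double integral absolutely convergent. -/
theorem invF_heatPhase_mul {ε : ℝ} (hε : 0 < ε) (t : ℝ) {f : ℝ → ℂ} (hf : Integrable f) (x : ℝ) :
    invF (fun ξ => heatPhase ε t ξ * invF f (-ξ)) x =
      ((2 * Real.pi)⁻¹ : ℝ) * ∫ y, heatKernel ε t (x - y) * f y := by
  have hm := integrable_heatPhase hε t
  have hprod : Integrable (Function.uncurry fun ξ y : ℝ =>
      Complex.exp (Complex.I * (x - y : ℝ) * ξ) * heatPhase ε t ξ * f y)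
      (volume.prod volume) := by
    have h1 : Integrable (fun z : ℝ × ℝ => heatPhase ε t z.1 * f z.2) (volume.prod volume) :=
      hm.mul_prod hf
    have hc : Continuous fun z : ℝ × ℝ => Complex.exp (Complex.I * (x - z.2 : ℝ) * z.1) := by
      fun_prop
    have h2 := h1.bdd_mul (c := 1) hc.aestronglyMeasurable
      (Eventually.of_forall fun z => (norm_exp_I_mul _ _).le)
    refine h2.congr (Eventually.of_forall fun z => ?_)
    simp only [Function.uncurry]
    ring
  have e1 : ∀ ξ : ℝ, Complex.exp (Complex.I * x * ξ) * (heatPhase ε t ξ * invF f (-ξ)) =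
      ((√(2 * Real.pi))⁻¹ : ℝ) *
        ∫ y : ℝ, Complex.exp (Complex.I * (x - y : ℝ) * ξ) * heatPhase ε t ξ * f y := by
    intro ξ
    rw [invF, mul_left_comm (heatPhase ε t ξ), mul_left_comm, ← integral_const_mul,
      ← integral_const_mul]
    congr 1
    refine integral_congr_ae (Eventually.of_forall fun y => ?_)
    simp only
    rw [show Complex.I * (x - y : ℝ) * ξ = Complex.I * x * ξ + Complex.I * (-ξ : ℝ) * y by
      push_cast; ring, Complex.exp_add]
    ring
  rw [invF]
  simp only [e1]
  rw [integral_const_mul, integral_integral_swap hprod, ← mul_assoc, ← Complex.ofReal_mul,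
    ← mul_inv, Real.mul_self_sqrt (by positivity)]
  congr 1
  refine integral_congr_ae (Eventually.of_forall fun y => ?_)
  simp only
  rw [integral_mul_const, integral_heatPhase hε]

/-- The chirp `e^{iy²/(2t)}`. -/
noncomputable def chirp (t y : ℝ) : ℂ := Complex.exp (Complex.I * (y ^ 2 / (2 * t) : ℝ))

theorem bddMeas_chirp (t : ℝ) : BddMeas (chirp t) := BddMeas.exp_I (by fun_prop)

theorem norm_chirp (t y : ℝ) : ‖chirp t y‖ = 1 := by
  rw [chirp, mul_comm, Complex.norm_exp_ofReal_mul_I]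

/-- The base of the power is -2πi/t, whose principal square root carries the phase e^{-iπ/4}. -/
theorem heatKernel_zero {t : ℝ} (ht : 0 < t) (z : ℝ) : heatKernel 0 t z =
    ((√(2 * Real.pi) * t ^ (-(1 / 2) : ℝ) : ℝ) : ℂ) *
      Complex.exp (-(Complex.I * Real.pi / 4)) * chirp t z := by
  have htc : (t : ℂ) ≠ 0 := by exact_mod_cast ht.ne'
  have e1 : (Real.pi / (((0 : ℝ) + Complex.I * t) / 2) : ℂ) =
      ((2 * Real.pi / t : ℝ) : ℂ) * -Complex.I := by
    push_cast
    rw [zero_add]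
    field_simp
    rw [Complex.I_sq, neg_neg]
  have hpos : 0 < 2 * Real.pi / t := by positivity
  have e2 : √(2 * Real.pi) * t ^ (-(1 / 2) : ℝ) = Real.exp (Real.log (2 * Real.pi / t) * (1 / 2)) := by
    rw [← Real.rpow_def_of_pos hpos, Real.div_rpow (by positivity) ht.le, Real.sqrt_eq_rpow,
      Real.rpow_neg ht.le]
    rfl
  have e3 : (((2 * Real.pi / t : ℝ) : ℂ) * -Complex.I) ^ (1 / 2 : ℂ) =
      ((√(2 * Real.pi) * t ^ (-(1 / 2) : ℝ) : ℝ) : ℂ) * Complex.exp (-(Complex.I * Real.pi / 4)) := by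
    rw [Complex.cpow_def_of_ne_zero (mul_ne_zero (by exact_mod_cast hpos.ne')
        (neg_ne_zero.2 Complex.I_ne_zero)), Complex.log_ofReal_mul hpos
        (neg_ne_zero.2 Complex.I_ne_zero), Complex.log_neg_I, e2, Complex.ofReal_exp,
        ← Complex.exp_add]
    congr 1
    push_cast
    ring
  rw [heatKernel, e1, e3, chirp]
  congr 2
  push_cast
  rw [zero_add]
  field_simp
  rw [Complex.I_sq]
  ring

theorem heatPhase_zero (t ξ : ℝ) : heatPhase 0 t ξ = phase t ξ := by
  rw [heatPhase, phase]
  congr 1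
  push_cast
  ring

theorem tendsto_heatPhase (t ξ : ℝ) :
    Tendsto (fun n : ℕ => heatPhase (1 / ((n : ℝ) + 1)) t ξ) atTop (𝓝 (phase t ξ)) := by
  have hc : Continuous fun ε : ℝ => heatPhase ε t ξ := by
    unfold heatPhase
    fun_prop
  rw [← heatPhase_zero]
  exact (hc.tendsto 0).comp tendsto_one_div_add_atTop_nhds_zero_nat

theorem continuous_heatKernel (ε t : ℝ) : Continuous (heatKernel ε t) := by
  unfold heatKernel
  fun_prop

theorem tendsto_heatKernel {t : ℝ} (ht : 0 < t) (z : ℝ) :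
    Tendsto (fun n : ℕ => heatKernel (1 / ((n : ℝ) + 1)) t z) atTop (𝓝 (heatKernel 0 t z)) := by
  have htc : (t : ℂ) ≠ 0 := by exact_mod_cast ht.ne'
  have h0 : (((0 : ℝ) : ℂ) + Complex.I * t) / 2 ≠ 0 := by simp [htc]
  have h1 : ContinuousAt (fun ε : ℝ => ((ε : ℂ) + Complex.I * t) / 2) 0 := by fun_prop
  have h2 : ContinuousAt (fun ε : ℝ => (Real.pi : ℂ) / (((ε : ℂ) + Complex.I * t) / 2)) 0 :=
    continuousAt_const.div h1 h0
  have hc : ContinuousAt (fun ε : ℝ => heatKernel ε t z) 0 := by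
    refine (h2.cpow continuousAt_const ?_).mul (ContinuousAt.cexp (continuousAt_const.div
      (continuousAt_const.mul h1) (mul_ne_zero (by norm_num) h0)))
    -- The base of the power stays off the branch cut, since at ε = 0 its imaginary part is -2π/t.
    right
    have : (Real.pi / (((0 : ℝ) + Complex.I * t) / 2) : ℂ).im = -(2 * Real.pi / t) := by
      have e : (Real.pi / (((0 : ℝ) + Complex.I * t) / 2) : ℂ) =
          ((-(2 * Real.pi / t) : ℝ) : ℂ) * Complex.I := by
        push_cast
        rw [zero_add]
        field_simp
        rw [Complex.I_sq, neg_neg]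
      rw [e, Complex.im_ofReal_mul, Complex.I_im, mul_one]
    rw [this]
    have : 0 < 2 * Real.pi / t := by positivity
    linarith
  exact hc.tendsto.comp tendsto_one_div_add_atTop_nhds_zero_nat

/-- Uniform in ε, since |ε + it| ≥ t and the Gaussian exponent has nonpositive real part. This is
the majorant for letting ε tend to 0. -/
theorem norm_heatKernel_le {ε : ℝ} (hε : 0 ≤ ε) {t : ℝ} (ht : 0 < t) (z : ℝ) :
    ‖heatKernel ε t z‖ ≤ √(2 * Real.pi / t) := by
  have htc : (t : ℂ) ≠ 0 := by exact_mod_cast ht.ne'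
  have h0 : ((ε : ℂ) + Complex.I * t) / 2 ≠ 0 := fun h => by
    have := congrArg Complex.im h
    simp at this
    exact ht.ne' this
  have h1 : t / 2 ≤ ‖((ε : ℂ) + Complex.I * t) / 2‖ := by
    refine le_trans (le_of_eq ?_) (Complex.abs_im_le_norm _)
    rw [show (((ε : ℂ) + Complex.I * t) / 2).im = t / 2 by simp, abs_of_pos (by positivity)]
  have h2 : ‖Complex.exp (-(z : ℂ) ^ 2 / (4 * ((ε + Complex.I * t) / 2)))‖ ≤ 1 := by
    rw [Complex.norm_exp, Real.exp_le_one_iff]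
    have e : (-(z : ℂ) ^ 2 / (4 * ((ε + Complex.I * t) / 2))) =
        ((-(z ^ 2 / 2) : ℝ) : ℂ) * ((ε : ℂ) + Complex.I * t)⁻¹ := by
      push_cast
      rw [div_eq_mul_inv, show (4 : ℂ) * ((ε + Complex.I * t) / 2) = 2 * (ε + Complex.I * t) by ring,
        mul_inv]
      ring
    rw [e, Complex.re_ofReal_mul, Complex.inv_re]
    refine mul_nonpos_of_nonpos_of_nonneg (by nlinarith [sq_nonneg z]) (div_nonneg ?_
      (Complex.normSq_nonneg _))
    simpa using hε
  have h3 : ‖(Real.pi / ((ε + Complex.I * t) / 2) : ℂ) ^ (1 / 2 : ℂ)‖ ≤ √(2 * Real.pi / t) := by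
    rw [show (1 / 2 : ℂ) = ((1 / 2 : ℝ) : ℂ) by push_cast; ring,
      Complex.norm_cpow_real, ← Real.sqrt_eq_rpow]
    apply Real.sqrt_le_sqrt
    rw [norm_div, Complex.norm_real, Real.norm_of_nonneg Real.pi_pos.le]
    calc Real.pi / ‖((ε : ℂ) + Complex.I * t) / 2‖ ≤ Real.pi / (t / 2) := by gcongr
      _ = 2 * Real.pi / t := by field_simp
  rw [heatKernel, norm_mul]
  exact (mul_le_mul h3 h2 (norm_nonneg _) (Real.sqrt_nonneg _)).trans_eq (mul_one _)

/-- Take ε = 1/(n+1). The left-hand sides converge in L², hence almost everywhere along a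
subsequence, and the kernel integrals converge by domination. -/
theorem invFourierL_phase_fourierL_ae {t : ℝ} (ht : 0 < t) (f : L2) (hf : Integrable f) :
    invFourierL (mulL (phase t) (fourierL f)) =ᵐ[volume] fun x =>
      ((2 * Real.pi)⁻¹ : ℝ) * ∫ y, heatKernel 0 t (x - y) * f y := by
  have hpos : ∀ n : ℕ, 0 < 1 / ((n : ℝ) + 1) := fun n => by positivity
  let F : ℕ → L2 := fun n => mulL (heatPhase (1 / ((n : ℝ) + 1)) t) (fourierL f)
  have hF : Tendsto F atTop (𝓝 (mulL (phase t) (fourierL f))) := by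
    refine tendsto_L2_of_dominated (fun n => mulL_ae (bddMeas_heatPhase (hpos n).le t) _)
      (b := fun ξ => ‖fourierL f ξ‖) (Lp.memLp _).norm
      (Eventually.of_forall fun n => Eventually.of_forall fun ξ => ?_) ?_
    · rw [norm_mul]
      exact mul_le_of_le_one_left (norm_nonneg _) (norm_heatPhase_le (hpos n).le t ξ)
    · filter_upwards [mulL_ae (bddMeas_phase t) (fourierL f)] with ξ h
      rw [h]
      exact (tendsto_heatPhase t ξ).mul_const _
  have hG := (invFourierL.continuous.tendsto _).comp hF
  obtain ⟨ns, hns, hlim⟩ := (tendstoInMeasure_of_tendsto_Lp hG).exists_seq_tendsto_ae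
  have hval : ∀ n, invFourierL (F n) =ᵐ[volume] fun x =>
      ((2 * Real.pi)⁻¹ : ℝ) * ∫ y, heatKernel (1 / ((n : ℝ) + 1)) t (x - y) * f y := by
    intro n
    have hae : F n =ᵐ[volume] fun ξ => heatPhase (1 / ((n : ℝ) + 1)) t ξ * invF f (-ξ) := by
      filter_upwards [mulL_ae (bddMeas_heatPhase (hpos n).le t) (fourierL f), fourierL_ae f hf]
        with ξ h1 h2
      rw [h1, h2]
    have hint : Integrable (F n) :=
      ((memLp_heatPhase (hpos n) t).integrable_mul (Lp.memLp (fourierL f))).congr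
        (mulL_ae (bddMeas_heatPhase (hpos n).le t) (fourierL f)).symm
    refine (invFourierL_ae _ hint).trans (Eventually.of_forall fun x => ?_)
    rw [invF_congr hae, invF_heatPhase_mul (hpos n) t hf]
  filter_upwards [hlim, ae_all_iff.2 hval] with x h1 h2
  refine tendsto_nhds_unique h1 ?_
  have h3 : Tendsto (fun n : ℕ => ∫ y, heatKernel (1 / ((n : ℝ) + 1)) t (x - y) * f y) atTop
      (𝓝 (∫ y, heatKernel 0 t (x - y) * f y)) := by
    refine tendsto_integral_of_dominated_convergence (fun y => √(2 * Real.pi / t) * ‖f y‖)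
      (fun n => ((continuous_heatKernel _ t).comp (continuous_const.sub
        continuous_id)).aestronglyMeasurable.mul hf.1) (hf.norm.const_mul _)
      (fun n => Eventually.of_forall fun y => ?_) (Eventually.of_forall fun y => ?_)
    · rw [norm_mul]
      exact mul_le_mul_of_nonneg_right (norm_heatKernel_le (hpos n).le ht _) (norm_nonneg _)
    · exact (tendsto_heatKernel ht _).mul_const _
  refine ((h3.const_mul _).comp hns.tendsto_atTop).congr fun n => ?_
  exact (h2 (ns n)).symm

/-- The factor `(it)^{-1/2} = t^{-1/2} e^{-iπ/4}`. -/
noncomputable def freeConst (t : ℝ) : ℂ :=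
  ((t ^ (-(1 / 2) : ℝ) : ℝ) : ℂ) * Complex.exp (-(Complex.I * Real.pi / 4))

theorem norm_freeConst {t : ℝ} (ht : 0 < t) : ‖freeConst t‖ = t ^ (-(1 / 2) : ℝ) := by
  rw [freeConst, norm_mul, Complex.norm_real, Real.norm_of_nonneg (by positivity),
    show -(Complex.I * Real.pi / 4) = ((-(Real.pi / 4) : ℝ) : ℂ) * Complex.I by push_cast; ring,
    Complex.norm_exp_ofReal_mul_I, mul_one]

/-- The factorization of the free propagator. -/
theorem invFourierL_phase_fourierL {t : ℝ} (ht : 0 < t) (f : L2) :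
    invFourierL (mulL (phase t) (fourierL f)) =
      freeConst t • mulL (chirp t) (compL t⁻¹ 0 (fourierL (mulL (chirp t) f))) := by
  have key : ∀ f : L2, Integrable f → (invFourierL ∘L mulL (phase t) ∘L fourierL) f =
      (freeConst t • (mulL (chirp t) ∘L compL t⁻¹ 0 ∘L fourierL ∘L mulL (chirp t))) f := by
    intro f hf
    apply Lp.ext
    have htc : (t : ℂ) ≠ 0 := by exact_mod_cast ht.ne'
    have hi : Integrable (mulL (chirp t) f) := integrable_mulL (bddMeas_chirp t) hf
    filter_upwards [invFourierL_phase_fourierL_ae ht f hf,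
      Lp.coeFn_smul (freeConst t) (mulL (chirp t) (compL t⁻¹ 0 (fourierL (mulL (chirp t) f)))),
      mulL_ae (bddMeas_chirp t) (compL t⁻¹ 0 (fourierL (mulL (chirp t) f))),
      compL_ae (inv_ne_zero ht.ne') 0 (fourierL (mulL (chirp t) f)),
      ae_affine (inv_ne_zero ht.ne') 0 (fourierL_ae _ hi)] with x h1 h2 h3 h4 h5
    simp only [ContinuousLinearMap.comp_apply, smul_apply]
    rw [h1, h2, Pi.smul_apply, h3, h4, h5, smul_eq_mul, invF_congr (mulL_ae (bddMeas_chirp t) f),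
      invF, add_zero]
    -- Expanding (x - y)²/(2t) leaves one chirp in x, one in y, and the Fourier kernel at frequency
    -- x/t.
    have e : ∀ y, heatKernel 0 t (x - y) * f y =
        (((√(2 * Real.pi) : ℝ) : ℂ) * freeConst t * chirp t x) *
        (Complex.exp (Complex.I * (-(t⁻¹ * x) : ℝ) * y) * (chirp t y * f y)) := by
      intro y
      have hc : chirp t (x - y) = chirp t x * (Complex.exp (Complex.I * (-(t⁻¹ * x) : ℝ) * y) *
          chirp t y) := by
        rw [chirp, chirp, chirp, ← Complex.exp_add, ← Complex.exp_add]
        congr 1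
        push_cast
        field_simp
        ring
      rw [heatKernel_zero ht, hc, freeConst]
      push_cast
      ring
    simp only [e]
    rw [integral_const_mul, ← mul_assoc, ← mul_assoc]
    have hs : (((2 * Real.pi)⁻¹ : ℝ) : ℂ) * ((√(2 * Real.pi) : ℝ) : ℂ) =
        (((√(2 * Real.pi))⁻¹ : ℝ) : ℂ) := by
      rw [← Complex.ofReal_mul]
      congr 1
      have h0 := sqrt_two_pi_pos
      have h6 : √(2 * Real.pi) * √(2 * Real.pi) = 2 * Real.pi := Real.mul_self_sqrt (by positivity)
      nth_rw 1 [← h6]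
      field_simp
    rw [← mul_assoc, ← mul_assoc, hs]
    ring
  exact clm_ext_integrable key f

/-! ### Asymptotics of the free propagator -/

/-- The error in the large-time asymptotics of the free propagator. -/
noncomputable def freeRem (t : ℝ) (a : L2) : L2 :=
  invFourierL (mulL (phase t) a) - freeConst t • mulL (chirp t) (compL t⁻¹ 0 a)

/-- The leading term is the factorization of the propagator with the inner chirp replaced by 1, so
the error contains chirp minus 1. -/
theorem freeRem_eq {t : ℝ} (ht : 0 < t) (a : L2) : freeRem t a = freeConst t •
    mulL (chirp t) (compL t⁻¹ 0 (fourierL (mulL (chirp t) (invFourierL a) - invFourierL a))) := by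
  have h := invFourierL_phase_fourierL ht (invFourierL a)
  rw [fourierL_invFourierL] at h
  rw [freeRem, h, map_sub, map_sub, map_sub, fourierL_invFourierL, smul_sub]

/-- All outer factors together are unitary: the dilation contributes √t and the constant t^{-1/2}.
-/
theorem norm_freeRem {t : ℝ} (ht : 0 < t) (a : L2) :
    ‖freeRem t a‖ = ‖mulL (chirp t) (invFourierL a) - invFourierL a‖ := by
  rw [freeRem_eq ht, norm_smul, norm_freeConst ht, norm_mulL_of_norm_eq_one (bddMeas_chirp t)
    (norm_chirp t), norm_compL (inv_ne_zero ht.ne'), norm_fourierL, inv_inv, abs_of_pos ht,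
    Real.sqrt_eq_rpow, ← mul_assoc, ← Real.rpow_add ht]
  norm_num

theorem norm_invF_le (f : ℝ → ℂ) (x : ℝ) : ‖invF f x‖ ≤ ∫ y, ‖f y‖ := by
  have h1 : (√(2 * Real.pi))⁻¹ ≤ 1 := by
    apply inv_le_one_of_one_le₀
    rw [Real.one_le_sqrt]
    linarith [Real.pi_gt_three]
  rw [invF, norm_mul, Complex.norm_real, Real.norm_of_nonneg (by positivity)]
  refine (mul_le_of_le_one_left (norm_nonneg _) h1).trans
    ((norm_integral_le_integral_norm _).trans (le_of_eq ?_))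
  simp only [norm_mul, norm_exp_I_mul, one_mul]

theorem norm_freeRem_apply_le {t : ℝ} (ht : 0 < t) (a : L2)
    (hi : Integrable (fun y => (chirp t y - 1) * invFourierL a y)) :
    ∀ᵐ x, ‖freeRem t a x‖ ≤ t ^ (-(1 / 2) : ℝ) * ∫ y, ‖(chirp t y - 1) * invFourierL a y‖ := by
  have hg : (mulL (chirp t) (invFourierL a) - invFourierL a : L2) =ᵐ[volume]
      fun y => (chirp t y - 1) * invFourierL a y := by
    filter_upwards [Lp.coeFn_sub (mulL (chirp t) (invFourierL a)) (invFourierL a),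
      mulL_ae (bddMeas_chirp t) (invFourierL a)] with y h1 h2
    rw [h1, Pi.sub_apply, h2, sub_mul, one_mul]
  have hgi : Integrable (mulL (chirp t) (invFourierL a) - invFourierL a : L2) := hi.congr hg.symm
  rw [freeRem_eq ht]
  set g := mulL (chirp t) (invFourierL a) - invFourierL a
  filter_upwards [Lp.coeFn_smul (freeConst t) (mulL (chirp t) (compL t⁻¹ 0 (fourierL g))),
      mulL_ae (bddMeas_chirp t) (compL t⁻¹ 0 (fourierL g)),
      compL_ae (inv_ne_zero ht.ne') 0 (fourierL g),
      ae_affine (inv_ne_zero ht.ne') 0 (fourierL_ae _ hgi)] with x h1 h2 h3 h4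
  rw [h1, Pi.smul_apply, h2, h3, h4, smul_eq_mul, norm_mul, norm_mul, norm_freeConst ht, norm_chirp,
    one_mul, invF_congr hg]
  exact mul_le_mul_of_nonneg_left (norm_invF_le _ _) (by positivity)

theorem norm_chirp_sub_one_le_two (t y : ℝ) : ‖chirp t y - 1‖ ≤ 2 := by
  refine (norm_sub_le _ _).trans ?_
  rw [norm_chirp, norm_one]
  norm_num

/-- The product of the two bounds 2 and y²/(2t). -/
theorem norm_chirp_sub_one_sq_le {t : ℝ} (ht : 0 < t) (y : ℝ) : ‖chirp t y - 1‖ ^ 2 ≤ y ^ 2 / t := by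
  have h1 : ‖chirp t y - 1‖ ≤ y ^ 2 / (2 * t) := by
    refine Real.norm_exp_I_mul_ofReal_sub_one_le.trans (le_of_eq ?_)
    rw [Real.norm_of_nonneg (by positivity)]
  calc ‖chirp t y - 1‖ ^ 2 = ‖chirp t y - 1‖ * ‖chirp t y - 1‖ := sq _
    _ ≤ 2 * (y ^ 2 / (2 * t)) := mul_le_mul (norm_chirp_sub_one_le_two t y) h1 (norm_nonneg _)
        zero_le_two
    _ = y ^ 2 / t := by field_simp

theorem rpow_neg_half_sq {t : ℝ} (ht : 0 < t) : (t ^ (-(1 / 2) : ℝ)) ^ 2 = t⁻¹ := by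
  rw [← Real.rpow_natCast, ← Real.rpow_mul ht.le, ← Real.rpow_neg_one]
  norm_num

theorem norm_chirp_sub_one_le {t : ℝ} (ht : 0 < t) (y : ℝ) :
    ‖chirp t y - 1‖ ≤ t ^ (-(1 / 2) : ℝ) * |y| := by
  refine abs_le_of_sq_le_sq' ?_ (by positivity) |>.2
  rw [mul_pow, rpow_neg_half_sq ht, sq_abs, ← div_eq_inv_mul]
  exact norm_chirp_sub_one_sq_le ht y

/-- The weight `(1 + y²)^{-1/2}`. -/
noncomputable def weight (y : ℝ) : ℂ := ((√(1 + y ^ 2))⁻¹ : ℝ)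

theorem memLp_weight : MemLp weight 2 := memLp_inv_sqrt.ofReal

theorem norm_weight_sq (y : ℝ) : ‖weight y‖ ^ 2 = (1 + y ^ 2)⁻¹ := by
  rw [weight, Complex.norm_real, Real.norm_of_nonneg (by positivity), inv_pow, Real.sq_sqrt
    (by positivity)]

/-- From |e^{iy²/(2t)} - 1|² ≤ min(4, y²/t) one gets |e^{iy²/(2t)} - 1|²(1 + y²/t) ≤ 5y²/t, which is
below 9(1 + y²)/t. The weight reappears at scale √t, where its L² norm is t^{1/4} times larger, so
the prefactor t^{-1/2} becomes t^{-1/4}. -/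
theorem norm_chirp_sub_one_mul_weight_le {t : ℝ} (ht : 0 < t) (y : ℝ) :
    ‖(chirp t y - 1) * weight y‖ ≤ 3 * t ^ (-(1 / 2) : ℝ) * ‖weight (t ^ (-(1 / 2) : ℝ) * y + 0)‖ := by
  refine abs_le_of_sq_le_sq' ?_ (by positivity) |>.2
  rw [norm_mul, mul_pow, mul_pow, mul_pow, norm_weight_sq, norm_weight_sq, add_zero, mul_pow,
    rpow_neg_half_sq ht, ← div_eq_mul_inv, ← div_eq_mul_inv, div_le_div_iff₀ (by positivity)
    (by positivity)]
  have h1 := norm_chirp_sub_one_sq_le ht y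
  have h2 : ‖chirp t y - 1‖ ^ 2 ≤ 2 ^ 2 :=
    pow_le_pow_left₀ (norm_nonneg _) (norm_chirp_sub_one_le_two t y) 2
  have h3 : 0 ≤ t⁻¹ * y ^ 2 := by positivity
  rw [div_eq_inv_mul] at h1
  have h4 : 0 ≤ t⁻¹ := by positivity
  nlinarith [mul_le_mul_of_nonneg_right h2 h3]

theorem eLpNorm_weight : eLpNorm weight 2 volume = ENNReal.ofReal ‖memLp_weight.toLp‖ := by
  rw [← eLpNorm_L2, eLpNorm_congr_ae memLp_weight.coeFn_toLp]

theorem eLpNorm_chirp_sub_one_mul_weight_le {t : ℝ} (ht : 0 < t) :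
    eLpNorm (fun y => (chirp t y - 1) * weight y) 2 volume ≤
      ENNReal.ofReal (3 * ‖memLp_weight.toLp‖ * t ^ (-(1 / 4) : ℝ)) := by
  have hc : t ^ (-(1 / 2) : ℝ) ≠ 0 := (Real.rpow_pos_of_pos ht _).ne'
  calc eLpNorm (fun y => (chirp t y - 1) * weight y) 2 volume
      ≤ eLpNorm (((3 * t ^ (-(1 / 2) : ℝ) : ℝ) : ℂ) •
          fun y => weight (t ^ (-(1 / 2) : ℝ) * y + 0)) 2 volume := by
        refine eLpNorm_mono fun y => (norm_chirp_sub_one_mul_weight_le ht y).trans (le_of_eq ?_)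
        rw [Pi.smul_apply, norm_smul, Complex.norm_real, Real.norm_of_nonneg (by positivity)]
    _ = ENNReal.ofReal (3 * ‖memLp_weight.toLp‖ * t ^ (-(1 / 4) : ℝ)) := by
        rw [eLpNorm_const_smul, eLpNorm_comp_affine hc 0 memLp_weight.1, eLpNorm_weight,
          ← ofReal_norm, Complex.norm_real, Real.norm_of_nonneg (by positivity),
          ENNReal.ofReal_rpow_of_pos (by positivity), ← ENNReal.ofReal_mul (by positivity),
          ← ENNReal.ofReal_mul (by positivity)]
        congr 1
        rw [abs_of_pos (by positivity), ← Real.rpow_neg ht.le, ← Real.rpow_mul ht.le]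
        have : t ^ (-(1 / 2) : ℝ) * t ^ (- -(1 / 2) * ((1 : ℝ≥0∞) / 2).toReal) =
            t ^ (-(1 / 4) : ℝ) := by
          rw [← Real.rpow_add ht]
          norm_num
        rw [← this]
        ring

theorem eLpNorm_chirp_sub_one_mul_weight_le' (t : ℝ) :
    eLpNorm (fun y => (chirp t y - 1) * weight y) 2 volume ≤
      ENNReal.ofReal (3 * ‖memLp_weight.toLp‖) := by
  calc eLpNorm (fun y => (chirp t y - 1) * weight y) 2 volume
      ≤ eLpNorm ((3 : ℂ) • weight) 2 volume := by
        refine eLpNorm_mono fun y => ?_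
        rw [Pi.smul_apply, norm_smul, norm_mul]
        refine mul_le_mul_of_nonneg_right ((norm_chirp_sub_one_le_two t y).trans ?_) (norm_nonneg _)
        norm_num
    _ = ENNReal.ofReal (3 * ‖memLp_weight.toLp‖) := by
        rw [eLpNorm_const_smul, eLpNorm_weight, ENNReal.ofReal_mul (by norm_num), ← ofReal_norm]
        norm_num

/-- Cauchy–Schwarz for mf = (mw)(w⁻¹f), with w⁻¹ = √(1 + y²) ≤ 1 + |y|. This turns control of yf in
L² into an L¹ bound, hence into a uniform bound after the Fourier transform. -/
theorem integrable_mul_of_weight {m : ℝ → ℂ} (hm : Continuous m) {B : ℝ} (hB : 0 ≤ B)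
    (hmw : eLpNorm (fun y => m y * weight y) 2 volume ≤ ENNReal.ofReal B) (f : L2) {K : ℝ}
    (hK : 0 ≤ K) (hf : eLpNorm (fun y : ℝ => (y : ℂ) * f y) 2 volume ≤ ENNReal.ofReal K) :
    Integrable (fun y => m y * f y) ∧ ∫ y, ‖m y * f y‖ ≤ B * (‖f‖ + K) := by
  have hwc : Continuous weight := by
    unfold weight
    refine Complex.continuous_ofReal.comp (Continuous.inv₀ (by fun_prop) fun y => ?_)
    positivity
  have hw0 : ∀ y, weight y ≠ 0 := fun y => by
    rw [weight]
    have : (√(1 + y ^ 2))⁻¹ ≠ 0 := by positivity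
    exact_mod_cast this
  have hfm : AEStronglyMeasurable f volume := Lp.aestronglyMeasurable f
  have hdm : AEStronglyMeasurable (fun y => (weight y)⁻¹ * f y) volume :=
    (hwc.inv₀ hw0).aestronglyMeasurable.mul hfm
  have hd : eLpNorm (fun y => (weight y)⁻¹ * f y) 2 volume ≤ ENNReal.ofReal (‖f‖ + K) := by
    have hy : AEStronglyMeasurable (fun y : ℝ => (y : ℂ) * f y) volume :=
      Complex.continuous_ofReal.aestronglyMeasurable.mul hfm
    calc eLpNorm (fun y => (weight y)⁻¹ * f y) 2 volume
        ≤ eLpNorm ((fun y => ‖f y‖) + fun y : ℝ => ‖(y : ℂ) * f y‖) 2 volume := by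
          refine eLpNorm_mono_real fun y => ?_
          rw [norm_mul, norm_inv, weight, Complex.norm_real, Real.norm_of_nonneg (by positivity),
            inv_inv, Pi.add_apply, norm_mul, Complex.norm_real, Real.norm_eq_abs, ← one_add_mul]
          refine mul_le_mul_of_nonneg_right (Real.sqrt_le_iff.2 ⟨by positivity, ?_⟩) (norm_nonneg _)
          nlinarith [abs_nonneg y, sq_abs y]
      _ ≤ eLpNorm f 2 volume + eLpNorm (fun y : ℝ => (y : ℂ) * f y) 2 volume := by
          refine (eLpNorm_add_le hfm.norm hy.norm one_le_two).trans (le_of_eq ?_)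
          rw [eLpNorm_norm, eLpNorm_norm]
      _ ≤ ENNReal.ofReal (‖f‖ + K) := by
          rw [ENNReal.ofReal_add (norm_nonneg _) hK, eLpNorm_L2]
          gcongr
  have h1 : eLpNorm (fun y => m y * f y) 1 volume ≤ ENNReal.ofReal (B * (‖f‖ + K)) := by
    have e : (fun y => m y * f y) = (fun y => m y * weight y) • fun y => (weight y)⁻¹ * f y := by
      funext y
      have := hw0 y
      simp only [Pi.smul_apply', smul_eq_mul]
      field_simp
    rw [e, ENNReal.ofReal_mul hB]
    exact (eLpNorm_smul_le_mul_eLpNorm (p := 2) (q := 2) hdm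
      (hm.mul hwc).aestronglyMeasurable).trans (mul_le_mul' hmw hd)
  have hi : Integrable (fun y => m y * f y) :=
    memLp_one_iff_integrable.1 ⟨hm.aestronglyMeasurable.mul hfm, h1.trans_lt ENNReal.ofReal_lt_top⟩
  refine ⟨hi, ?_⟩
  rw [integral_norm_eq_lintegral_enorm hi.1, ← eLpNorm_one_eq_lintegral_enorm]
  exact ENNReal.toReal_le_of_le_ofReal (by positivity) h1

/-- Bounds for the error in the large-time asymptotics of the free propagator. -/
theorem freeRem_bounds {a : L2} {K : ℝ} (hK0 : 0 ≤ K)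
    (hK : ∀ h : ℝ, 0 < h → ‖compL 1 h a - a‖ ≤ K * h) {t : ℝ} (ht : 0 < t) :
    ‖freeRem t a‖ ≤ 2 * ‖a‖ ∧ ‖freeRem t a‖ ≤ K * t ^ (-(1 / 2) : ℝ) ∧
    (∀ᵐ x, ‖freeRem t a x‖ ≤ 3 * ‖memLp_weight.toLp‖ * (‖a‖ + K) * t ^ (-(1 / 2) : ℝ)) ∧
    ∀ᵐ x, ‖freeRem t a x‖ ≤ 3 * ‖memLp_weight.toLp‖ * (‖a‖ + K) * t ^ (-(3 / 4) : ℝ) := by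
  have hf := eLpNorm_mul_invFourierL_le hK
  have hcc : Continuous fun y => chirp t y - 1 := by
    unfold chirp
    fun_prop
  obtain ⟨i1, b1⟩ := integrable_mul_of_weight hcc (by positivity)
    (eLpNorm_chirp_sub_one_mul_weight_le' t) _ hK0 hf
  obtain ⟨-, b2⟩ := integrable_mul_of_weight hcc (by positivity)
    (eLpNorm_chirp_sub_one_mul_weight_le ht) _ hK0 hf
  rw [norm_invFourierL] at b1 b2
  refine ⟨?_, ?_, ?_, ?_⟩
  · rw [norm_freeRem ht]
    refine (norm_sub_le _ _).trans (le_of_eq ?_)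
    rw [norm_mulL_of_norm_eq_one (bddMeas_chirp t) (norm_chirp t), norm_invFourierL]
    ring
  · rw [norm_freeRem ht, Lp.norm_def]
    refine ENNReal.toReal_le_of_le_ofReal (by positivity) ?_
    calc eLpNorm (mulL (chirp t) (invFourierL a) - invFourierL a : L2) 2 volume
        ≤ eLpNorm (((t ^ (-(1 / 2) : ℝ) : ℝ) : ℂ) • fun y : ℝ => (y : ℂ) * invFourierL a y)
            2 volume := by
          refine eLpNorm_mono_ae ?_
          filter_upwards [Lp.coeFn_sub (mulL (chirp t) (invFourierL a)) (invFourierL a),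
            mulL_ae (bddMeas_chirp t) (invFourierL a)] with y h1 h2
          rw [h1, Pi.sub_apply, h2, ← sub_one_mul, norm_mul, Pi.smul_apply, norm_smul, norm_mul,
            Complex.norm_real, Complex.norm_real, Real.norm_of_nonneg (by positivity),
            Real.norm_eq_abs, ← mul_assoc]
          exact mul_le_mul_of_nonneg_right (norm_chirp_sub_one_le ht y) (norm_nonneg _)
      _ ≤ ENNReal.ofReal (K * t ^ (-(1 / 2) : ℝ)) := by
          rw [eLpNorm_const_smul, ← ofReal_norm, Complex.norm_real,
            Real.norm_of_nonneg (by positivity), mul_comm K, ENNReal.ofReal_mul (by positivity)]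
          gcongr
  · filter_upwards [norm_freeRem_apply_le ht a i1] with x hx
    refine hx.trans ?_
    rw [mul_comm]
    exact mul_le_mul_of_nonneg_right b1 (by positivity)
  · filter_upwards [norm_freeRem_apply_le ht a i1] with x hx
    refine hx.trans ((mul_le_mul_of_nonneg_left b2 (by positivity)).trans (le_of_eq ?_))
    have : t ^ (-(1 / 2) : ℝ) * t ^ (-(1 / 4) : ℝ) = t ^ (-(3 / 4) : ℝ) := by
      rw [← Real.rpow_add ht]
      norm_num
    rw [← this]
    ring

/-! ### Asymptotics of the perturbed group -/

/-- Interpolation between `L²` and a uniform bound. -/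
theorem eLpNorm_le_of_norm_le_of_ae_le {p : ℝ≥0∞} (hp : 2 ≤ p) (f : L2) {A M : ℝ} (hA : ‖f‖ ≤ A)
    (hM0 : 0 ≤ M) (hM : ∀ᵐ x, ‖f x‖ ≤ M) :
    eLpNorm f p volume ≤
      ENNReal.ofReal (A ^ (2 * (p⁻¹).toReal) * M ^ (1 - 2 * (p⁻¹).toReal)) := by
  have hA0 : 0 ≤ A := (norm_nonneg _).trans hA
  rcases eq_or_ne p ⊤ with rfl | htop
  · simp only [ENNReal.inv_top, ENNReal.toReal_zero, mul_zero, Real.rpow_zero, sub_zero,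
      Real.rpow_one, one_mul]
    rw [eLpNorm_exponent_top]
    exact eLpNormEssSup_le_of_ae_bound hM
  have hp0 : p ≠ 0 := (two_pos.trans_le hp).ne'
  set r := p.toReal with hr
  have hr2 : 2 ≤ r := by
    have := ENNReal.toReal_mono htop hp
    simpa using this
  have hr0 : 0 < r := by linarith
  have h2 : ∫⁻ x, ‖f x‖ₑ ^ (2 : ℝ) ≤ ENNReal.ofReal A ^ (2 : ℝ) := by
    have h := eLpNorm_L2 f
    rw [eLpNorm_eq_lintegral_rpow_enorm_toReal two_ne_zero ENNReal.ofNat_ne_top,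
      ENNReal.toReal_ofNat] at h
    have h' := congrArg (fun z : ℝ≥0∞ => z ^ (2 : ℝ)) h
    simp only [← ENNReal.rpow_mul] at h'
    norm_num at h'
    norm_num
    rw [h', ← ofReal_norm]
    gcongr
  -- Of the r powers of |f|, r - 2 are bounded uniformly and two are integrated.
  have h3 : ∫⁻ x, ‖f x‖ₑ ^ r ≤ ENNReal.ofReal M ^ (r - 2) * ENNReal.ofReal A ^ (2 : ℝ) := by
    calc ∫⁻ x, ‖f x‖ₑ ^ r ≤ ∫⁻ x, ENNReal.ofReal M ^ (r - 2) * ‖f x‖ₑ ^ (2 : ℝ) := by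
          refine lintegral_mono_ae ?_
          filter_upwards [hM] with x hx
          rw [show ‖f x‖ₑ ^ r = ‖f x‖ₑ ^ ((r - 2) + 2) by ring_nf,
            ENNReal.rpow_add_of_nonneg _ _ (by linarith) zero_le_two]
          gcongr
          rw [← ofReal_norm]
          exact ENNReal.ofReal_le_ofReal hx
      _ = ENNReal.ofReal M ^ (r - 2) * ∫⁻ x, ‖f x‖ₑ ^ (2 : ℝ) :=
          lintegral_const_mul' _ _ (ENNReal.rpow_ne_top_of_nonneg (by linarith)
            ENNReal.ofReal_ne_top)
      _ ≤ _ := by gcongr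
  rw [eLpNorm_eq_lintegral_rpow_enorm_toReal hp0 htop, ENNReal.toReal_inv, ← hr]
  refine (ENNReal.rpow_le_rpow h3 (by positivity)).trans (le_of_eq ?_)
  rw [ENNReal.mul_rpow_of_nonneg _ _ (by positivity), ← ENNReal.rpow_mul, ← ENNReal.rpow_mul,
    ENNReal.ofReal_rpow_of_nonneg hM0 (mul_nonneg (by linarith) (by positivity)),
    ENNReal.ofReal_rpow_of_nonneg hA0 (by positivity), mul_comm,
    ← ENNReal.ofReal_mul (by positivity)]
  congr 3
  · rw [one_div]
  · field_simp

theorem norm_evenL_le (f : L2) : ‖evenL f‖ ≤ 2 * ‖f‖ := by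
  rw [evenL_apply]
  refine (norm_add_le _ _).trans (le_of_eq ?_)
  rw [reflL, norm_compL (by norm_num)]
  norm_num
  ring

theorem norm_halfL_le (f : L2) : ‖halfL f‖ ≤ ‖f‖ := by
  refine (norm_mulL_le bddMeas_half (C := 1) (fun x => ?_) f).trans_eq (one_mul _)
  refine (norm_indicator_le_norm_self _ _).trans ?_
  simp

theorem evenL_mulL_phase (t : ℝ) (f : L2) : evenL (mulL (phase t) f) = mulL (phase t) (evenL f) := by
  have h : (fun ξ => phase t (-ξ)) = phase t := by
    funext ξ
    rw [phase, neg_sq, phase]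
  rw [evenL_apply, evenL_apply, map_add, reflL_mulL (bddMeas_phase t), h]

/-- The part of the distorted transform that is reflected or transmitted by the delta. -/
noncomputable def scatL (q : ℝ) (φ : L2) : L2 := mulL (rhoPos q) (evenL φ)

theorem norm_rhoPos_le (q ξ : ℝ) : ‖rhoPos q ξ‖ ≤ 1 :=
  (norm_indicator_le_norm_self _ _).trans (norm_rho_le q ξ)

theorem norm_scatL_le (q : ℝ) (φ : L2) : ‖scatL q φ‖ ≤ 2 * ‖φ‖ :=
  ((norm_mulL_le (bddMeas_rhoPos q) (norm_rhoPos_le q) _).trans_eq (one_mul _)).trans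
    (norm_evenL_le φ)

/-- The error term for the perturbed group. -/
noncomputable def scatRem (q t : ℝ) (φ : L2) : L2 :=
  freeRem t φ + evenL (halfL (freeRem t (scatL q φ)))

/-- The profile a = ρ₊Eφ vanishes for ξ ≤ 0, so a(x/t) vanishes for x < 0. At leading order the
reflected waves contribute nothing where the cutoff retains them. -/
theorem halfL_leading_scatL (q : ℝ) {t : ℝ} (ht : 0 < t) (φ : L2) :
    halfL (freeConst t • mulL (chirp t) (compL t⁻¹ 0 (scatL q φ))) = 0 := by
  rw [Lp.eq_zero_iff_ae_eq_zero]
  filter_upwards [halfL_ae (freeConst t • mulL (chirp t) (compL t⁻¹ 0 (scatL q φ))),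
    Lp.coeFn_smul (freeConst t) (mulL (chirp t) (compL t⁻¹ 0 (scatL q φ))),
    mulL_ae (bddMeas_chirp t) (compL t⁻¹ 0 (scatL q φ)),
    compL_ae (inv_ne_zero ht.ne') 0 (scatL q φ),
    ae_affine (inv_ne_zero ht.ne') 0 (mulL_ae (bddMeas_rhoPos q) (evenL φ))] with x h1 h2 h3 h4 h5
  rw [h1]
  by_cases hx : x < 0
  · have h6 : rhoPos q (t⁻¹ * x + 0) = 0 := by
      refine indicator_of_notMem ?_ _
      rw [mem_Ioi, not_lt, add_zero]
      exact (mul_neg_of_pos_of_neg (inv_pos.2 ht) hx).le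
    have h7 : (scatL q φ : L2) (t⁻¹ * x + 0) = 0 := by
      rw [scatL, h5, h6, zero_mul]
    rw [indicator_of_mem (mem_Iio.2 hx), h2, Pi.smul_apply, h3, h4, h7, mul_zero, smul_zero]
    rfl
  · rw [indicator_of_notMem (mt mem_Iio.1 hx)]
    rfl

/-- The phase e^{-itξ²/2} is even, so it passes through the symmetrization and both parts evolve
freely. -/
theorem expNegI_distInvL {q : ℝ} (hq : 0 ≤ q) {t : ℝ} (ht : 0 < t) (φ : L2) :
    expNegI (hamiltonian q) t (distInvL q φ) =
      freeConst t • mulL (chirp t) (compL t⁻¹ 0 φ) + scatRem q t φ := by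
  have e : mulL (rhoPos q) (evenL (mulL (phase t) φ)) = mulL (phase t) (scatL q φ) := by
    rw [evenL_mulL_phase, scatL, mulL_mulL (bddMeas_rhoPos q) (bddMeas_phase t),
      mulL_mulL (bddMeas_phase t) (bddMeas_rhoPos q)]
    simp only [mul_comm]
  have hs : ∀ a, invFourierL (mulL (phase t) a) =
      freeConst t • mulL (chirp t) (compL t⁻¹ 0 a) + freeRem t a := fun a => by
    rw [freeRem, add_sub_cancel]
  rw [expNegI_hamiltonian hq, schrodL_apply, distL_distInvL hq, distInvL_apply, e, hs, hs, map_add,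
    halfL_leading_scatL q ht, zero_add, scatRem, add_assoc]

/-! ### Translation moduli of the profile and of its scattered part -/

theorem norm_rho_sub_le {q : ℝ} (hq : 0 ≤ q) (x h : ℝ) : ‖rho q (x + h) - rho q x‖ ≤ q⁻¹ * |h| := by
  -- For q = 0 the coefficient vanishes, and both sides are 0 by the convention 0⁻¹ = 0.
  rcases hq.eq_or_lt with rfl | hq
  · simp [rho]
  have h1 := add_I_mul_ne_zero hq.ne' x
  have h2 := add_I_mul_ne_zero hq.ne' (x + h)
  have e : rho q (x + h) - rho q x =
      q * Complex.I * h / ((q + Complex.I * (x + h : ℝ)) * (q + Complex.I * x)) := by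
    rw [rho, rho, div_sub_div _ _ h2 h1]
    congr 1
    push_cast
    ring
  have h3 := abs_le_norm_add_I_mul q x
  have h4 := abs_le_norm_add_I_mul q (x + h)
  rw [abs_of_pos hq] at h3 h4
  rw [e, norm_div, norm_mul, norm_mul, norm_mul, Complex.norm_I, Complex.norm_real,
    Complex.norm_real, Real.norm_of_nonneg hq.le, Real.norm_eq_abs, mul_one]
  calc q * |h| / (‖(q : ℂ) + Complex.I * (x + h : ℝ)‖ * ‖(q : ℂ) + Complex.I * x‖)
      ≤ q * |h| / (q * q) := by gcongr
    _ = q⁻¹ * |h| := by field_simp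

theorem intervalIntegrable_norm {g : ℝ → ℂ} (hg : MemLp g 2 volume) (a b : ℝ) :
    IntervalIntegrable (fun y => ‖g y‖) volume a b :=
  ((hg.norm.locallyIntegrable one_le_two).integrableOn_isCompact isCompact_uIcc).intervalIntegrable

theorem memLp_comp_neg {g : ℝ → ℂ} (hg : MemLp g 2 volume) : MemLp (fun x => g (-x)) 2 volume := by
  simpa using memLp_comp_affine (c := -1) (by norm_num) 0 hg

section Modulus

variable {φ φ' : ℝ → ℂ}

theorem norm_sub_le_integral (h : HasWeakDerivOn univ φ φ') (hc : Continuous φ) {a b : ℝ}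
    (hab : a ≤ b) : ‖φ b - φ a‖ ≤ ∫ y in a..b, ‖φ' y‖ := by
  rw [← h.integral_eq_sub hc.continuousOn hab (subset_univ _)]
  exact intervalIntegral.norm_integral_le_integral_norm hab

theorem norm_even_sub_le_integral (h : HasWeakDerivOn univ φ φ') (hc : Continuous φ)
    (hφ' : MemLp φ' 2 volume) {a b : ℝ} (hab : a ≤ b) :
    ‖(φ b + φ (-b)) - (φ a + φ (-a))‖ ≤ ∫ y in a..b, (‖φ' y‖ + ‖φ' (-y)‖) := by
  have h1 := norm_sub_le_integral h hc hab
  have h2 := norm_sub_le_integral h hc (neg_le_neg hab)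
  rw [intervalIntegral.integral_add (intervalIntegrable_norm hφ' a b)
    (intervalIntegrable_norm (memLp_comp_neg hφ') a b),
    intervalIntegral.integral_comp_neg (fun y => ‖φ' y‖)]
  calc ‖(φ b + φ (-b)) - (φ a + φ (-a))‖ = ‖(φ b - φ a) - (φ (-a) - φ (-b))‖ := by
        congr 1
        ring
    _ ≤ _ := (norm_sub_le _ _).trans (add_le_add h1 h2)

theorem norm_compL_toLp_sub_le (h : HasWeakDerivOn univ φ φ') (hc : Continuous φ)
    (hφ : MemLp φ 2 volume) (hφ' : MemLp φ' 2 volume) {s : ℝ} (hs : 0 < s) :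
    ‖compL 1 s hφ.toLp - hφ.toLp‖ ≤ ‖hφ'.toLp‖ * s := by
  have := norm_compL_sub_le hφ hφ' hφ hs le_rfl fun x => by
    rw [zero_mul, zero_mul, add_zero]
    exact norm_sub_le_integral h hc (by linarith)
  simpa using this

/-- ρ₊ is Lipschitz on ξ > 0 but jumps at 0 when q > 0. The condition φ(0) = 0 makes φ + φ(-·)
vanish there, so the product behaves as if there were no jump. -/
theorem norm_rhoPos_mul_sub_le {q : ℝ} (hq : 0 ≤ q) (h : HasWeakDerivOn univ φ φ')
    (hc : Continuous φ) (h0 : φ 0 = 0) (hφ' : MemLp φ' 2 volume) {s : ℝ} (hs : 0 < s) (x : ℝ) :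
    ‖rhoPos q (x + s) * (φ (x + s) + φ (-(x + s))) - rhoPos q x * (φ x + φ (-x))‖ ≤
      (∫ y in x..(x + s), (‖φ' y‖ + ‖φ' (-y)‖)) + q⁻¹ * s * ‖φ x + φ (-x)‖ := by
  have hnn : 0 ≤ q⁻¹ * s * ‖φ x + φ (-x)‖ := by positivity
  have hint : ∀ {a b : ℝ}, a ≤ b → 0 ≤ ∫ y in a..b, (‖φ' y‖ + ‖φ' (-y)‖) := fun hab =>
    intervalIntegral.integral_nonneg hab fun y _ => by positivity
  rcases lt_or_ge 0 x with hx | hx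
  · rw [rhoPos, indicator_of_mem (mem_Ioi.2 (by linarith)), indicator_of_mem (mem_Ioi.2 hx)]
    have e : rho q (x + s) * (φ (x + s) + φ (-(x + s))) - rho q x * (φ x + φ (-x)) =
        rho q (x + s) * ((φ (x + s) + φ (-(x + s))) - (φ x + φ (-x))) +
          (rho q (x + s) - rho q x) * (φ x + φ (-x)) := by ring
    rw [e]
    refine (norm_add_le _ _).trans (add_le_add ?_ ?_)
    · rw [norm_mul]
      exact (mul_le_of_le_one_left (norm_nonneg _) (norm_rho_le _ _)).trans
        (norm_even_sub_le_integral h hc hφ' (by linarith))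
    · rw [norm_mul]
      refine mul_le_mul_of_nonneg_right ((norm_rho_sub_le hq x s).trans_eq ?_) (norm_nonneg _)
      rw [abs_of_pos hs]
  · rw [show rhoPos q x = 0 from indicator_of_notMem (by simpa using hx) _, zero_mul, sub_zero]
    rcases lt_or_ge 0 (x + s) with hxs | hxs
    -- The window straddles 0: the increment is measured from 0, where the even part vanishes, and
    -- only (0, x + s) contributes.
    · refine le_add_of_le_of_nonneg ?_ hnn
      rw [norm_mul]
      have h1 := norm_even_sub_le_integral h hc hφ' hxs.le
      rw [neg_zero, h0, add_zero, sub_zero] at h1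
      refine (mul_le_of_le_one_left (norm_nonneg _) (norm_rhoPos_le _ _)).trans (h1.trans ?_)
      have hi : ∀ a b, IntervalIntegrable (fun y => ‖φ' y‖ + ‖φ' (-y)‖) volume a b := fun a b =>
        (intervalIntegrable_norm hφ' a b).add (intervalIntegrable_norm (memLp_comp_neg hφ') a b)
      rw [← intervalIntegral.integral_add_adjacent_intervals (hi x 0) (hi 0 (x + s))]
      exact le_add_of_nonneg_left (hint hx)
    · rw [show rhoPos q (x + s) = 0 from indicator_of_notMem (by simpa using hxs) _, zero_mul,
        norm_zero]
      exact add_nonneg (hint (by linarith)) hnn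

theorem norm_compL_scatL_sub_le {q : ℝ} (hq : 0 ≤ q) (h : HasWeakDerivOn univ φ φ')
    (hc : Continuous φ) (h0 : φ 0 = 0) (hφ : MemLp φ 2 volume) (hφ' : MemLp φ' 2 volume) {s : ℝ}
    (hs : 0 < s) : ‖compL 1 s (scatL q hφ.toLp) - scatL q hφ.toLp‖ ≤
      (2 * ‖hφ'.toLp‖ + q⁻¹ * (2 * ‖hφ.toLp‖)) * s := by
  have hφn := memLp_comp_neg hφ
  have hφn' := memLp_comp_neg hφ'
  have hψ : MemLp (fun x => φ x + φ (-x)) 2 volume := hφ.add hφn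
  have hg : MemLp (fun x => ((‖φ' x‖ + ‖φ' (-x)‖ : ℝ) : ℂ)) 2 volume :=
    (hφ'.norm.add hφn'.norm).ofReal
  have hA : MemLp (fun x => rhoPos q x * (φ x + φ (-x))) 2 volume := (bddMeas_rhoPos q).memLp hψ
  have hev : evenL hφ.toLp = hψ.toLp := by
    apply Lp.ext
    filter_upwards [Lp.coeFn_add hφ.toLp (reflL hφ.toLp), reflL_ae hφ.toLp, hφ.coeFn_toLp,
      ae_neg hφ.coeFn_toLp, hψ.coeFn_toLp] with x h1 h2 h3 h4 h5
    rw [evenL_apply, h1, Pi.add_apply, h2, h3, h4, h5]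
  have hsc : scatL q hφ.toLp = hA.toLp := by
    apply Lp.ext
    rw [scatL, hev]
    filter_upwards [mulL_ae (bddMeas_rhoPos q) hψ.toLp, hψ.coeFn_toLp, hA.coeFn_toLp]
      with x h1 h2 h3
    rw [h1, h2, h3]
  have key := norm_compL_sub_le hA hg hψ hs (inv_nonneg.2 hq) fun x => by
    refine (norm_rhoPos_mul_sub_le hq h hc h0 hφ' hs x).trans (le_of_eq ?_)
    congr 1
    refine intervalIntegral.integral_congr fun y _ => ?_
    rw [Complex.norm_real, Real.norm_of_nonneg (by positivity)]
  have n1 : ‖hψ.toLp‖ ≤ 2 * ‖hφ.toLp‖ := by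
    rw [← hev]
    exact norm_evenL_le _
  have n2 : ‖hg.toLp‖ ≤ 2 * ‖hφ'.toLp‖ := by
    rw [Lp.norm_toLp]
    refine ENNReal.toReal_le_of_le_ofReal (by positivity) ?_
    calc eLpNorm (fun x => ((‖φ' x‖ + ‖φ' (-x)‖ : ℝ) : ℂ)) 2 volume
        = eLpNorm ((fun x => ‖φ' x‖) + fun x => ‖φ' (-x)‖) 2 volume := by
          refine eLpNorm_congr_norm_ae (Eventually.of_forall fun x => ?_)
          rw [Complex.norm_real]
          rfl
      _ ≤ eLpNorm φ' 2 volume + eLpNorm (fun x => φ' (-x)) 2 volume := by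
          refine (eLpNorm_add_le hφ'.1.norm hφn'.1.norm one_le_two).trans (le_of_eq ?_)
          rw [eLpNorm_norm, eLpNorm_norm]
      _ = ENNReal.ofReal (2 * ‖hφ'.toLp‖) := by
          have e1 : eLpNorm (fun x => φ' (-x)) 2 volume = eLpNorm φ' 2 volume :=
            eLpNorm_comp_measurePreserving hφ'.1 (Measure.measurePreserving_neg volume)
          rw [e1, ← eLpNorm_congr_ae hφ'.coeFn_toLp, eLpNorm_L2, ← ENNReal.ofReal_add
            (norm_nonneg _) (norm_nonneg _), two_mul]
  rw [hsc]
  refine key.trans (mul_le_mul_of_nonneg_right ?_ hs.le)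
  have := inv_nonneg.2 hq
  gcongr

end Modulus

/-! ### Bounds for the total error and interpolation in p -/

theorem ae_norm_evenL_halfL_le {f : L2} {M : ℝ} (hM : ∀ᵐ x, ‖f x‖ ≤ M) :
    ∀ᵐ x, ‖evenL (halfL f) x‖ ≤ 2 * M := by
  have h : ∀ᵐ x, ‖halfL f x‖ ≤ M := by
    filter_upwards [halfL_ae f, hM] with x h1 h2
    rw [h1]
    exact (norm_indicator_le_norm_self _ _).trans h2
  filter_upwards [Lp.coeFn_add (halfL f) (reflL (halfL f)), reflL_ae (halfL f), h, ae_neg h]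
    with x h1 h2 h3 h4
  rw [evenL_apply, h1, Pi.add_apply, h2, two_mul]
  exact (norm_add_le _ _).trans (add_le_add h3 h4)

theorem norm_scatRem_le (q t : ℝ) (φ : L2) :
    ‖scatRem q t φ‖ ≤ ‖freeRem t φ‖ + 2 * ‖freeRem t (scatL q φ)‖ :=
  (norm_add_le _ _).trans (add_le_add_right ((norm_evenL_le _).trans
    (mul_le_mul_of_nonneg_left (norm_halfL_le _) zero_le_two)) _)

theorem ae_norm_scatRem_le (q t : ℝ) (φ : L2) {M : ℝ}
    (h1 : ∀ᵐ x, ‖freeRem t φ x‖ ≤ M) (h2 : ∀ᵐ x, ‖freeRem t (scatL q φ) x‖ ≤ M) :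
    ∀ᵐ x, ‖scatRem q t φ x‖ ≤ 3 * M := by
  filter_upwards [Lp.coeFn_add (freeRem t φ) (evenL (halfL (freeRem t (scatL q φ)))), h1,
    ae_norm_evenL_halfL_le h2] with x e1 e2 e3
  rw [scatRem, e1, Pi.add_apply]
  refine (norm_add_le _ _).trans ?_
  linarith

/-- Bounds for the error term in terms of a common bound `B` for the data. -/
theorem scatRem_bounds (q : ℝ) {φ : L2} {B : ℝ} (hφ : ‖φ‖ ≤ B) (hφq : ‖scatL q φ‖ ≤ B)
    (hK : ∀ h : ℝ, 0 < h → ‖compL 1 h φ - φ‖ ≤ B * h)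
    (hKq : ∀ h : ℝ, 0 < h → ‖compL 1 h (scatL q φ) - scatL q φ‖ ≤ B * h) {t : ℝ} (ht : 0 < t) :
    let D := (6 + 18 * ‖memLp_weight.toLp‖) * B
    ‖scatRem q t φ‖ ≤ D ∧ ‖scatRem q t φ‖ ≤ D * t ^ (-(1 / 2) : ℝ) ∧
    (∀ᵐ x, ‖scatRem q t φ x‖ ≤ D * t ^ (-(1 / 2) : ℝ)) ∧
    ∀ᵐ x, ‖scatRem q t φ x‖ ≤ D * t ^ (-(3 / 4) : ℝ) := by
  -- The total error is one free error plus a symmetrized one, hence a factor 1 + 2 = 3. In L² this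
  -- gives 3 · 2B = 6B, and uniformly 3 · 3‖weight‖(B + B) = 18‖weight‖B.
  intro D
  have hB : 0 ≤ B := (norm_nonneg _).trans hφ
  obtain ⟨a1, a2, a3, a4⟩ := freeRem_bounds hB hK ht
  obtain ⟨b1, b2, b3, b4⟩ := freeRem_bounds hB hKq ht
  have hr := norm_scatRem_le q t φ
  have hW : 0 ≤ ‖memLp_weight.toLp‖ := norm_nonneg _
  set W := ‖memLp_weight.toLp‖
  have hWB : 0 ≤ W * B := mul_nonneg hW hB
  have hD : D = 6 * B + 18 * (W * B) := by
    simp only [D]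
    ring
  have hp : ∀ s : ℝ, 0 ≤ t ^ s := fun s => by positivity
  refine ⟨by linarith, ?_, ?_, ?_⟩
  · have : D * t ^ (-(1 / 2) : ℝ) =
        6 * (B * t ^ (-(1 / 2) : ℝ)) + 18 * (W * B * t ^ (-(1 / 2) : ℝ)) := by
      rw [hD]
      ring
    have := mul_nonneg hB (hp (-(1 / 2)))
    have := mul_nonneg hWB (hp (-(1 / 2)))
    linarith
  all_goals
    have hle : ∀ {c s : ℝ}, c ≤ B → 3 * W * (c + B) * t ^ s ≤ 6 * (W * B) * t ^ s := fun hc => by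
      refine mul_le_mul_of_nonneg_right ?_ (hp _)
      nlinarith
    have hle2 : ∀ s : ℝ, 3 * (6 * (W * B) * t ^ s) ≤ D * t ^ s := fun s => by
      rw [← mul_assoc]
      refine mul_le_mul_of_nonneg_right ?_ (hp _)
      linarith
  · filter_upwards [ae_norm_scatRem_le q t φ (M := 6 * (W * B) * t ^ (-(1 / 2) : ℝ))
      (a3.mono fun x hx => hx.trans (hle hφ))
      (b3.mono fun x hx => hx.trans (hle hφq))] with x hx
    exact hx.trans (hle2 _)
  · filter_upwards [ae_norm_scatRem_le q t φ (M := 6 * (W * B) * t ^ (-(3 / 4) : ℝ))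
      (a4.mono fun x hx => hx.trans (hle hφ))
      (b4.mono fun x hx => hx.trans (hle hφq))] with x hx
    exact hx.trans (hle2 _)

theorem rpow_two_mul_mul {D t a b s : ℝ} (hD : 0 ≤ D) (ht : 0 < t) (hs : 0 ≤ s)
    (hs1 : s ≤ 1 / 2) :
    (D * t ^ a) ^ (2 * s) * (D * t ^ b) ^ (1 - 2 * s) = D * t ^ (a * (2 * s) + b * (1 - 2 * s)) := by
  rw [Real.mul_rpow hD (by positivity), Real.mul_rpow hD (by positivity), ← Real.rpow_mul ht.le,
    ← Real.rpow_mul ht.le, Real.rpow_add ht]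
  have : D = D ^ (2 * s) * D ^ (1 - 2 * s) := by
    rw [← Real.rpow_add_of_nonneg hD (by linarith) (by linarith)]
    simp
  nth_rw 3 [this]
  ring

/-- Interpolation gives the exponent -1/2 + 1/p from the bounds suited to t ≤ 1, which is β = 0, and
-3/4 + 1/(2p) from those suited to t ≥ 1, which is β = 1/2 + 1/p. Every β in between is weaker on
the respective range of t. -/
theorem eLpNorm_le_of_decay {p : ℝ≥0∞} (hp : 2 ≤ p) {β : ℝ} (hβ : 0 ≤ β)
    (hβp : β ≤ 1 / 2 + (p⁻¹).toReal) {t : ℝ} (ht : 0 < t) (f : L2) {D : ℝ}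
    (h1 : ‖f‖ ≤ D) (h2 : ‖f‖ ≤ D * t ^ (-(1 / 2) : ℝ))
    (h3 : ∀ᵐ x, ‖f x‖ ≤ D * t ^ (-(1 / 2) : ℝ)) (h4 : ∀ᵐ x, ‖f x‖ ≤ D * t ^ (-(3 / 4) : ℝ)) :
    eLpNorm f p volume ≤ ENNReal.ofReal (D * t ^ (-(1 / 2) + (p⁻¹).toReal - β / 2)) := by
  have hD : 0 ≤ D := (norm_nonneg _).trans h1
  have hs0 : 0 ≤ (p⁻¹).toReal := ENNReal.toReal_nonneg
  have hs1 : (p⁻¹).toReal ≤ 1 / 2 := by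
    have h := ENNReal.toReal_mono (by simp) (ENNReal.inv_le_inv.2 hp)
    simpa using h
  rcases le_total t 1 with ht1 | ht1
  · have h1' : ‖f‖ ≤ D * t ^ (0 : ℝ) := by simpa using h1
    refine (eLpNorm_le_of_norm_le_of_ae_le hp f h1' (by positivity) h3).trans
      (ENNReal.ofReal_le_ofReal ?_)
    rw [rpow_two_mul_mul hD ht hs0 hs1]
    exact mul_le_mul_of_nonneg_left (Real.rpow_le_rpow_of_exponent_ge ht ht1 (by linarith)) hD
  · refine (eLpNorm_le_of_norm_le_of_ae_le hp f h2 (by positivity) h4).trans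
      (ENNReal.ofReal_le_ofReal ?_)
    rw [rpow_two_mul_mul hD ht hs0 hs1]
    exact mul_le_mul_of_nonneg_left (Real.rpow_le_rpow_of_exponent_le ht1 (by linarith)) hD

theorem leadingTerm_ae {φ : ℝ → ℂ} (hφ : MemLp φ 2 volume) {t : ℝ} (ht : 0 < t) :
    (freeConst t • mulL (chirp t) (compL t⁻¹ 0 hφ.toLp) : L2) =ᵐ[volume] leadingTerm φ t := by
  filter_upwards [Lp.coeFn_smul (freeConst t) (mulL (chirp t) (compL t⁻¹ 0 hφ.toLp)),
    mulL_ae (bddMeas_chirp t) (compL t⁻¹ 0 hφ.toLp), compL_ae (inv_ne_zero ht.ne') 0 hφ.toLp,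
    ae_affine (inv_ne_zero ht.ne') 0 hφ.coeFn_toLp] with x h1 h2 h3 h4
  rw [h1, Pi.smul_apply, h2, h3, h4, smul_eq_mul, freeConst, chirp, leadingTerm, add_zero,
    ← div_eq_inv_mul, sub_eq_add_neg, Complex.exp_add]
  push_cast
  rw [mul_div_assoc Complex.I (_ ^ 2)]
  ring

end DeltaNLS

theorem proposition3p1 (q : ℝ) (hq : 0 ≤ q) (p : ℝ≥0∞) (hp : 2 ≤ p) (β : ℝ) (hβ : 0 ≤ β)
    (hβ₂ : p = 2 → β ≤ 1)
    -- `1/2 + 1/p = (p+2)/(2p)`, which is `1/2` for `p = ∞`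
    (hβp : 2 < p → β < 1 / 2 + (p⁻¹).toReal) :
    ∃ C : ℝ, 0 < C ∧
      ∀ φ φ' : ℝ → ℂ, MemLp φ 2 volume → MemLp φ' 2 volume →
        DeltaNLS.HasWeakDerivOn univ φ φ' → Continuous φ → φ 0 = 0 →
        ∃ R : ℝ → ℝ → ℂ, ∀ t : ℝ, 0 < t →
          (∀ᵐ x, DeltaNLS.expNegI (DeltaNLS.hamiltonian q) t (DeltaNLS.distortedInvFourier q φ) x =
            DeltaNLS.leadingTerm φ t x + R t x) ∧
          MemLp (R t) p volume ∧
          eLpNorm (R t) p volume ≤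
            ENNReal.ofReal (C * t ^ (-(1 / 2) + (p⁻¹).toReal - β / 2)) *
              (eLpNorm φ 2 volume + eLpNorm φ' 2 volume) := by
  -- The two ranges of β combine into one inequality, since 1/2 + 1/p = 1 for p = 2.
  have hβp' : β ≤ 1 / 2 + (p⁻¹).toReal := by
    rcases hp.eq_or_lt with h | h
    · have := hβ₂ h.symm
      rw [← h, ENNReal.toReal_inv, ENNReal.toReal_ofNat]
      linarith
    · exact (hβp h).le
  have hq' := inv_nonneg.2 hq
  -- The factor 2 + 2q⁻¹ is large enough to cover the norms ‖φ‖ and 2‖φ‖ of the two profiles as well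
  -- as their Lipschitz constants ‖φ'‖ and 2‖φ'‖ + 2q⁻¹‖φ‖.
  refine ⟨(6 + 18 * ‖DeltaNLS.memLp_weight.toLp‖) * (2 + 2 * q⁻¹), by positivity,
    fun φ φ' hφ hφ' hw hc h0 =>
    ⟨fun t => DeltaNLS.scatRem q t hφ.toLp, fun t ht => ?_⟩⟩
  have n0 := norm_nonneg hφ.toLp
  have n1 := norm_nonneg hφ'.toLp
  have n2 := mul_nonneg hq' n0
  have n3 := mul_nonneg hq' n1
  set N := ‖hφ.toLp‖ + ‖hφ'.toLp‖ with hN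
  have hB : (2 + 2 * q⁻¹) * N = 2 * ‖hφ.toLp‖ + 2 * ‖hφ'.toLp‖ + 2 * (q⁻¹ * ‖hφ.toLp‖) +
      2 * (q⁻¹ * ‖hφ'.toLp‖) := by
    rw [hN]
    ring
  obtain ⟨b1, b2, b3, b4⟩ := DeltaNLS.scatRem_bounds q (φ := hφ.toLp) (B := (2 + 2 * q⁻¹) * N)
    (by linarith) ((DeltaNLS.norm_scatL_le q _).trans (by linarith))
    (fun s hs => (DeltaNLS.norm_compL_toLp_sub_le hw hc hφ hφ' hs).trans
      (mul_le_mul_of_nonneg_right (by linarith) hs.le))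
    (fun s hs => (DeltaNLS.norm_compL_scatL_sub_le hq hw hc h0 hφ hφ' hs).trans
      (mul_le_mul_of_nonneg_right (by linarith) hs.le)) ht
  have hle := DeltaNLS.eLpNorm_le_of_decay hp hβ hβp' ht _ b1 b2 b3 b4
  refine ⟨?_, ⟨Lp.aestronglyMeasurable _, hle.trans_lt ENNReal.ofReal_lt_top⟩, hle.trans_eq ?_⟩
  · rw [DeltaNLS.distortedInvFourier_eq q hφ, DeltaNLS.expNegI_distInvL hq ht]
    filter_upwards [Lp.coeFn_add (DeltaNLS.freeConst t • DeltaNLS.mulL (DeltaNLS.chirp t)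
      (DeltaNLS.compL t⁻¹ 0 hφ.toLp)) (DeltaNLS.scatRem q t hφ.toLp),
      DeltaNLS.leadingTerm_ae hφ ht] with x h1 h2
    rw [h1, Pi.add_apply, h2]
  · rw [← eLpNorm_congr_ae hφ.coeFn_toLp, ← eLpNorm_congr_ae hφ'.coeFn_toLp, DeltaNLS.eLpNorm_L2,
      DeltaNLS.eLpNorm_L2, ← ENNReal.ofReal_add n0 n1, ← ENNReal.ofReal_mul (by positivity)]
    congr 1
    ring
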